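/- Let $a>c>b>0$, let $\mathbb{E}=\{(x,y,z,w)\in\mathbb{R}^4:\ x^2/a^2+y^2/b^2+(z^2+w^2)/c^2=1\}$ be oriented by its inner unit normal $N$, and let $E_0=\{(x,y,z,w)\in\mathbb{E}: z=w=0\}$. Let $k_1\le k_2\le k_3$ be the principal curvatures of $\mathbb{E}$ (the eigenvalues of $-DN$ on the tangent spaces, with multiplicity). A point is umbilic if $k_1=k_2=k_3$ and partially umbilic if exactly two of the $k_i$ coincide; the set of the latter is $\mathcal{P}_{12}\cup\mathcal{P}_{23}$, with $\mathcal{P}_{12}=\{k_1=k_2<k_3\}$ and $\mathcal{P}_{23}=\{k_1<k_2=k_3\}$. Let $\mathcal{L}_i$ be the field of eigenspaces of $k_i$, which is a line field where $k_i$ is simple; the other points are the singularities of the principal foliation $\mathcal{F}_i$, whose leaves are the integral curves of $\mathcal{L}_i$. Then: (i) The umbilic set is contained in $E_0$ and consists of exactly the four points $(a\cos u,b\sin u,0,0)$ with $\cos^2u=\frac{a^2-c^2}{a^2-b^2}$. The partially umbilic set is the complement in $E_0$ of these four points. It has four connected components, which are open arcs of the ellipse: with $u_0\in(0,\pi/2)$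 defined by $\cos u_0=\sqrt{\frac{a^2-c^2}{a^2-b^2}}$, the arcs $|u|<u_0$ and $|u-\pi|<u_0$ form $\mathcal{P}_{12}$, and the arcs $u_0<u<\pi-u_0$ and $\pi+u_0<u<2\pi-u_0$ form $\mathcal{P}_{23}$. (ii) The sections $\Sigma_\theta=\mathbb{E}\cap\{\cos\theta\,z+\sin\theta\,w=0\}$ are congruent to the ellipsoid $\{X^2/a^2+Y^2/c^2+Z^2/b^2=1\}\subset\mathbb{R}^3$, they cover $\mathbb{E}$, any two distinct ones meet exactly in $E_0$, and they are the pages of an open book structure on $\mathbb{E}$ with binding $E_0$. (An open book structure on a 3-manifold $M$ with binding a regular curve $S$ is a smooth fibration $p:M\setminus S\to\mathbb{S}^1$ such that the closure of every fibre contains $S$ and is a regular surface, called a page, and such that $S$ is the intersection of all pages.) Both $\mathcal{L}_1$ and $\mathcal{L}_3$ are line fields exactly on $\mathbb{E}\setminus E_0$. At the points of $\Sigma_\theta\setminus E_0$ the tangent plane of $\Sigma_\theta$ is $\mathcal{L}_1\oplus\mathcal{L}_3$, and the connected components of $\Sigma_\theta\setminus E_0$ are leaves of this plane field. At all points of $\Sigma_\theta$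 the tangent plane of $\Sigma_\theta$ is invariant under $-DN$, and the smaller and the larger eigendirection of $-DN$ in it coincide with $\mathcal{L}_1$ and $\mathcal{L}_3$ wherever $\mathcal{L}_1$, respectively $\mathcal{L}_3$, is a line field. The configuration so obtained on $\Sigma_\theta$ is principally equivalent to that of the three-axis ellipsoid $\{X^2/a^2+Y^2/c^2+Z^2/b^2=1\}$ in $\mathbb{R}^3$ with its inner normal: there is a homeomorphism between the two surfaces that carries singularities to singularities and the leaves of the minimal (maximal) principal foliation to leaves of the minimal (maximal) principal foliation. (iii) The singular set of $\mathcal{F}_2$ is exactly $E_0$, and $\mathcal{L}_2$ does not extend to a continuous line field near any point of $E_0$. Every regular leaf of $\mathcal{F}_2$ is a circle, and it is orthogonal to the pages $\Sigma_\theta$ at all points where it meets them. -/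

import Mathlib

open Set Topology
open scoped ContDiff

namespace PrincipalConfig

/-! ### Calculus on subsets of Euclidean space -/

/-- Smoothness of a map on an arbitrary subset: it agrees there with a map that is smooth on an
open neighbourhood (here the map itself is the extension). -/
def IsSmoothOn {V W : Type*} [NormedAddCommGroup V] [NormedSpace ℝ V]
    [NormedAddCommGroup W] [NormedSpace ℝ W] (f : V → W) (A : Set V) : Prop :=
  ∃ O : Set V, IsOpen O ∧ A ⊆ O ∧ ContDiffOn ℝ ∞ f O

/-- `S` is a smooth embedded submanifold of codimension `m` (possibly empty), described locally as
the zero set of a smooth submersion to `ℝ^m`. -/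
def IsSubmanifoldOfCodim {n : ℕ} (m : ℕ) (S : Set (EuclideanSpace ℝ (Fin n))) : Prop :=
  ∀ q ∈ S, ∃ (U : Set (EuclideanSpace ℝ (Fin n)))
    (f : EuclideanSpace ℝ (Fin n) → EuclideanSpace ℝ (Fin m)),
    IsOpen U ∧ q ∈ U ∧ ContDiffOn ℝ ∞ f U ∧ Function.Surjective (fderiv ℝ f q) ∧
      S ∩ U = {x | f x = 0} ∩ U

/-- The tangent space of `S` at `q`: the span of the velocities at `q` of the `C¹` curves in `S`
through `q`.  (On a submanifold these velocities already form a linear subspace.) -/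
def tangentSpaceAt {n : ℕ} (S : Set (EuclideanSpace ℝ (Fin n))) (q : EuclideanSpace ℝ (Fin n)) :
    Submodule ℝ (EuclideanSpace ℝ (Fin n)) :=
  Submodule.span ℝ {v | ∃ γ : ℝ → EuclideanSpace ℝ (Fin n), ContDiffAt ℝ 1 γ 0 ∧ γ 0 = q ∧
    deriv γ 0 = v ∧ ∀ᶠ t in 𝓝 (0 : ℝ), γ t ∈ S}

/-- The leaf through `q` of a field `D` of tangent subspaces given on the set `R`: all points that
can be reached from `q` by a `C¹` curve that stays in `R` and is everywhere tangent to `D`. -/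
def leaf {n : ℕ} (D : EuclideanSpace ℝ (Fin n) → Submodule ℝ (EuclideanSpace ℝ (Fin n)))
    (R : Set (EuclideanSpace ℝ (Fin n))) (q : EuclideanSpace ℝ (Fin n)) :
    Set (EuclideanSpace ℝ (Fin n)) :=
  {q' | ∃ γ : ℝ → EuclideanSpace ℝ (Fin n), ContDiff ℝ 1 γ ∧ γ 0 = q ∧ γ 1 = q' ∧
    ∀ t ∈ Icc (0 : ℝ) 1, γ t ∈ R ∧ deriv γ t ∈ D (γ t)}

/-- A round circle of positive radius in Euclidean space. -/
def IsCircle {n : ℕ} (C : Set (EuclideanSpace ℝ (Fin n))) : Prop :=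
  ∃ (o e₁ e₂ : EuclideanSpace ℝ (Fin n)) (r : ℝ), 0 < r ∧ ‖e₁‖ = 1 ∧ ‖e₂‖ = 1 ∧
    inner ℝ e₁ e₂ = 0 ∧
    C = range (fun t : ℝ => o + (r * Real.cos t) • e₁ + (r * Real.sin t) • e₂)

/-! ### Principal curvatures, principal directions, principal foliations -/

/-- The operator `D(-N)` at `q` on the tangent space of `S` (composed with the orthogonal
projection to that space).  If `S` is a hypersurface with unit normal field `N`, it is the
shape operator of `S`, and the projection has no effect.  If `S` is a submanifold of such a
hypersurface whose tangent spaces are invariant under the shape operator, it is the restriction of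
the shape operator to the tangent space of `S`. -/
noncomputable def shapeOperator {n : ℕ} (S : Set (EuclideanSpace ℝ (Fin n)))
    (N : EuclideanSpace ℝ (Fin n) → EuclideanSpace ℝ (Fin n)) (q : EuclideanSpace ℝ (Fin n)) :
    Module.End ℝ (tangentSpaceAt S q) :=
  ((tangentSpaceAt S q).orthogonalProjectionOnto : EuclideanSpace ℝ (Fin n) →ₗ[ℝ] tangentSpaceAt S q) ∘ₗ
    (-(fderiv ℝ N q : EuclideanSpace ℝ (Fin n) →ₗ[ℝ] EuclideanSpace ℝ (Fin n))) ∘ₗ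
    (tangentSpaceAt S q).subtype

/-- The principal curvatures in increasing order, repeated according to multiplicity, numbered from
`0`: on a three-dimensional hypersurface, `k₁ ≤ k₂ ≤ k₃` are the values for `i = 0, 1, 2`. -/
noncomputable def principalCurvature {n : ℕ} (S : Set (EuclideanSpace ℝ (Fin n)))
    (N : EuclideanSpace ℝ (Fin n) → EuclideanSpace ℝ (Fin n)) (i : ℕ)
    (q : EuclideanSpace ℝ (Fin n)) : ℝ :=
  ((shapeOperator S N q).charpoly.roots.sort (· ≤ ·)).getD i 0

/-- The eigenspace of the principal curvature number `i` (so `𝓛₁, 𝓛₂, 𝓛₃` for `i = 0, 1, 2`), as a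
subspace of the ambient space. -/
noncomputable def principalSpace {n : ℕ} (S : Set (EuclideanSpace ℝ (Fin n)))
    (N : EuclideanSpace ℝ (Fin n) → EuclideanSpace ℝ (Fin n)) (i : ℕ)
    (q : EuclideanSpace ℝ (Fin n)) : Submodule ℝ (EuclideanSpace ℝ (Fin n)) :=
  (Module.End.eigenspace (shapeOperator S N q) (principalCurvature S N i q)).map
    (tangentSpaceAt S q).subtype

/-- The points of `S` at which the principal space number `i` is a line, i.e. the domain of the
principal line field; the other points of `S` are the singularities of the foliation. -/
def regularSet {n : ℕ} (S : Set (EuclideanSpace ℝ (Fin n)))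
    (N : EuclideanSpace ℝ (Fin n) → EuclideanSpace ℝ (Fin n)) (i : ℕ) :
    Set (EuclideanSpace ℝ (Fin n)) :=
  {q | q ∈ S ∧ Module.finrank ℝ (principalSpace S N i q) = 1}

/-- The leaf through `q` of the principal foliation number `i`. -/
def principalLeaf {n : ℕ} (S : Set (EuclideanSpace ℝ (Fin n)))
    (N : EuclideanSpace ℝ (Fin n) → EuclideanSpace ℝ (Fin n)) (i : ℕ)
    (q : EuclideanSpace ℝ (Fin n)) : Set (EuclideanSpace ℝ (Fin n)) :=
  leaf (principalSpace S N i) (regularSet S N i) q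

/-- Umbilic points of a three-dimensional hypersurface: `k₁ = k₂ = k₃`. -/
def umbilicSet (S : Set (EuclideanSpace ℝ (Fin 4)))
    (N : EuclideanSpace ℝ (Fin 4) → EuclideanSpace ℝ (Fin 4)) : Set (EuclideanSpace ℝ (Fin 4)) :=
  {q | q ∈ S ∧ principalCurvature S N 0 q = principalCurvature S N 1 q ∧
    principalCurvature S N 1 q = principalCurvature S N 2 q}

/-- Partially umbilic points with `k₁ = k₂ < k₃`. -/
def partiallyUmbilicSet12 (S : Set (EuclideanSpace ℝ (Fin 4)))
    (N : EuclideanSpace ℝ (Fin 4) → EuclideanSpace ℝ (Fin 4)) : Set (EuclideanSpace ℝ (Fin 4)) :=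
  {q | q ∈ S ∧ principalCurvature S N 0 q = principalCurvature S N 1 q ∧
    principalCurvature S N 1 q < principalCurvature S N 2 q}

/-- Partially umbilic points with `k₁ < k₂ = k₃`. -/
def partiallyUmbilicSet23 (S : Set (EuclideanSpace ℝ (Fin 4)))
    (N : EuclideanSpace ℝ (Fin 4) → EuclideanSpace ℝ (Fin 4)) : Set (EuclideanSpace ℝ (Fin 4)) :=
  {q | q ∈ S ∧ principalCurvature S N 0 q < principalCurvature S N 1 q ∧
    principalCurvature S N 1 q = principalCurvature S N 2 q}

/-- Partially umbilic points: exactly two of the three principal curvatures coincide. -/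
def partiallyUmbilicSet (S : Set (EuclideanSpace ℝ (Fin 4)))
    (N : EuclideanSpace ℝ (Fin 4) → EuclideanSpace ℝ (Fin 4)) : Set (EuclideanSpace ℝ (Fin 4)) :=
  partiallyUmbilicSet12 S N ∪ partiallyUmbilicSet23 S N

/-- Principal equivalence of the principal configurations of two surfaces `S`, `S'` (each with its
field `N`, `N'` that determines the principal directions): a homeomorphism that maps singularities
to singularities, and leaves of the minimal (`i = 0`) and of the maximal (`i = 1`) foliation to
leaves of the same foliation. -/
def PrincipallyEquivalent {n m : ℕ} (S : Set (EuclideanSpace ℝ (Fin n)))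
    (N : EuclideanSpace ℝ (Fin n) → EuclideanSpace ℝ (Fin n)) (S' : Set (EuclideanSpace ℝ (Fin m)))
    (N' : EuclideanSpace ℝ (Fin m) → EuclideanSpace ℝ (Fin m)) : Prop :=
  ∃ h : S ≃ₜ S', ∀ i ∈ ({0, 1} : Set ℕ),
    (∀ q : S, (q : EuclideanSpace ℝ (Fin n)) ∈ regularSet S N i ↔
      (h q : EuclideanSpace ℝ (Fin m)) ∈ regularSet S' N' i) ∧
    ∀ q : S, (q : EuclideanSpace ℝ (Fin n)) ∈ regularSet S N i → ∀ q' : S,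
      ((q' : EuclideanSpace ℝ (Fin n)) ∈ principalLeaf S N i q ↔
        (h q' : EuclideanSpace ℝ (Fin m)) ∈ principalLeaf S' N' i (h q))

/-! ### Open books -/

/-- `p` restricts to a smooth (locally trivial) fibration of `X` over the unit circle of `ℂ`.  Over
a neighbourhood `W` of each `ζ`, the map `(p, Ψ)` is a diffeomorphism, with inverse `Φ`, from the
part of `X` over `W` onto the product of `W` with the fibre over `ζ`. -/
def IsSmoothFibrationOverCircle {n : ℕ} (X : Set (EuclideanSpace ℝ (Fin n)))
    (p : EuclideanSpace ℝ (Fin n) → ℂ) : Prop :=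
  IsSmoothOn p X ∧ p '' X = Metric.sphere (0 : ℂ) 1 ∧
  ∀ ζ ∈ Metric.sphere (0 : ℂ) 1, ∃ W : Set ℂ, IsOpen W ∧ ζ ∈ W ∧
    ∃ (Φ : ℂ × EuclideanSpace ℝ (Fin n) → EuclideanSpace ℝ (Fin n))
      (Ψ : EuclideanSpace ℝ (Fin n) → EuclideanSpace ℝ (Fin n)),
      IsSmoothOn Φ ((Metric.sphere (0 : ℂ) 1 ∩ W) ×ˢ (X ∩ p ⁻¹' {ζ})) ∧
      IsSmoothOn Ψ (X ∩ p ⁻¹' W) ∧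
      (∀ η ∈ Metric.sphere (0 : ℂ) 1 ∩ W, ∀ y ∈ X ∩ p ⁻¹' {ζ},
        Φ (η, y) ∈ X ∧ p (Φ (η, y)) = η ∧ Ψ (Φ (η, y)) = y) ∧
      ∀ x ∈ X ∩ p ⁻¹' W, Ψ x ∈ X ∩ p ⁻¹' {ζ} ∧ Φ (p x, Ψ x) = x

/-- The page over `ζ`: the closure in `M` of the fibre of `p : M \ S → 𝕊¹` over `ζ`. -/
def pageOver (M S : Set (EuclideanSpace ℝ (Fin 4))) (p : EuclideanSpace ℝ (Fin 4) → ℂ) (ζ : ℂ) :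
    Set (EuclideanSpace ℝ (Fin 4)) :=
  M ∩ closure ((M \ S) ∩ p ⁻¹' {ζ})

/-- An open book structure on the 3-manifold `M ⊆ ℝ⁴` with binding the regular curve `S`: a smooth
fibration `p : M \ S → 𝕊¹` such that the closure of every fibre contains `S` and is a regular
surface (a page), and such that `S` is the intersection of all pages. -/
structure IsOpenBook (M S : Set (EuclideanSpace ℝ (Fin 4))) (p : EuclideanSpace ℝ (Fin 4) → ℂ) :
    Prop where
  manifold : IsSubmanifoldOfCodim 1 M
  binding_subset : S ⊆ M
  binding_curve : IsSubmanifoldOfCodim 3 S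
  fibration : IsSmoothFibrationOverCircle (M \ S) p
  page_surface : ∀ ζ ∈ Metric.sphere (0 : ℂ) 1,
    S ⊆ pageOver M S p ζ ∧ IsSubmanifoldOfCodim 2 (pageOver M S p ζ)
  binding_eq : S = ⋂ ζ ∈ Metric.sphere (0 : ℂ) 1, pageOver M S p ζ

/-! ### Ellipsoids -/

/-- The quadratic form `∑ xᵢ² / sᵢ²`. -/
noncomputable def quadric {n : ℕ} (s : Fin n → ℝ) (q : EuclideanSpace ℝ (Fin n)) : ℝ :=
  ∑ i, q i ^ 2 / s i ^ 2

/-- The ellipsoid with semi-axes `s`. -/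
def ellipsoid {n : ℕ} (s : Fin n → ℝ) : Set (EuclideanSpace ℝ (Fin n)) :=
  {q | quadric s q = 1}

/-- The inner unit normal `-∇Q / |∇Q|` of the ellipsoid. -/
noncomputable def innerNormal {n : ℕ} (s : Fin n → ℝ) (q : EuclideanSpace ℝ (Fin n)) :
    EuclideanSpace ℝ (Fin n) :=
  -(‖gradient (quadric s) q‖⁻¹ • gradient (quadric s) q)

/-- The ellipsoid `x²/a² + y²/b² + (z² + w²)/c² = 1`. -/
def ellipsoidACCB (a b c : ℝ) : Set (EuclideanSpace ℝ (Fin 4)) :=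
  ellipsoid ![a, b, c, c]

/-- Its inner unit normal. -/
noncomputable def normalACCB (a b c : ℝ) : EuclideanSpace ℝ (Fin 4) → EuclideanSpace ℝ (Fin 4) :=
  innerNormal ![a, b, c, c]

/-- The ellipse `E₀ = {z = w = 0}` in it. -/
def bindingEllipse (a b c : ℝ) : Set (EuclideanSpace ℝ (Fin 4)) :=
  {q | q ∈ ellipsoidACCB a b c ∧ q 2 = 0 ∧ q 3 = 0}

/-- The parametrization `u ↦ (a cos u, b sin u, 0, 0)` of `E₀`. -/
noncomputable def ellipsePoint (a b : ℝ) (u : ℝ) : EuclideanSpace ℝ (Fin 4) :=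
  !₂[a * Real.cos u, b * Real.sin u, 0, 0]

/-- The section by the hyperplane `cos θ z + sin θ w = 0`. -/
def ellipsoidPage (a b c θ : ℝ) : Set (EuclideanSpace ℝ (Fin 4)) :=
  {q | q ∈ ellipsoidACCB a b c ∧ Real.cos θ * q 2 + Real.sin θ * q 3 = 0}

end PrincipalConfig

namespace PrincipalConfig

/-! ### Shape operators in a frame of eigenvectors -/

/-! Write the ellipsoid as `⟪A q, q⟫ = 1` with `A = diag(1 / sᵢ²)`. The inner normal is `-A q / |A
q|`, the tangent space at `q` is the orthogonal complement of `A q`, and `-DN` acts on it as `1 / |A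
q|` times the compression of `A` (`neg_fderiv_innerNormal_eq_smul`, `tangentSpaceAt_ellipsoid`).
Everything is then linear algebra of compressions of a diagonal matrix, recorded in
`IsPrincipalFrame`.

Since the last two semi-axes are equal, `A` commutes with rotations of the `(z, w)`-plane. At a
point of the page `θ` the normal `(0, 0, cos θ, sin θ)` of the hyperplane is tangent to `E` and is
an eigenvector of `A` with eigenvalue `1 / c²`. The other two principal directions are those of the
page, a copy of the ellipsoid in `ℝ³` with semi-axes `a, c, b`. Because `b < c < a`, the number `1 /
c²` lies between the two eigenvalues of the compression for the page, strictly so off the binding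
(`exists_principalFrame`). Hence off the binding all curvatures are simple, `𝓛₂` is normal to the
pages and `𝓛₁ ⊕ 𝓛₃` is tangent to them. On the binding the `z` and `w` directions share one
curvature, and its difference from the curvature along the ellipse has the sign of `umbilicGap`
(`exists_principalFrame_bindingEllipse`), which gives the umbilic points and the arcs.

The leaves follow from first integrals. A curve tangent to `𝓛₂` keeps `x`, `y` and `z² + w²`, so it
runs on a circle. A curve tangent to `𝓛₁ ⊕ 𝓛₃` keeps the argument of `z + iw`, so it stays in a
page. Near the binding `𝓛₂` is spanned by `(0, 0, -w, z)`, whose limits depend on the direction of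
approach, so it has no continuous extension.

For the open book, the projection is the square of `(z + iw) / |z + iw|`. Squaring identifies
opposite half-pages, so each fibre is a whole page without the binding. Rotations by a local square
root trivialize it. -/

theorem shapeOperator_apply_of_mem {n : ℕ} {S : Set (EuclideanSpace ℝ (Fin n))}
    {N : EuclideanSpace ℝ (Fin n) → EuclideanSpace ℝ (Fin n)} {q : EuclideanSpace ℝ (Fin n)}
    (v : tangentSpaceAt S q) (hv : -(fderiv ℝ N q v) ∈ tangentSpaceAt S q) :
    (shapeOperator S N q v : EuclideanSpace ℝ (Fin n)) = -(fderiv ℝ N q v) := by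
  have h := (tangentSpaceAt S q).orthogonalProjectionOnto_mem_subspace_eq_self ⟨_, hv⟩
  simpa [shapeOperator] using congrArg Subtype.val h

/-- A frame of eigenvectors of `-DN` for the tangent space of `S` at `q`, with the eigenvalues in
increasing order. -/
structure IsPrincipalFrame {n d : ℕ} (S : Set (EuclideanSpace ℝ (Fin n)))
    (N : EuclideanSpace ℝ (Fin n) → EuclideanSpace ℝ (Fin n)) (q : EuclideanSpace ℝ (Fin n))
    (v : Fin d → EuclideanSpace ℝ (Fin n)) (m : Fin d → ℝ) : Prop where
  linearIndependent : LinearIndependent ℝ v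
  span_eq : Submodule.span ℝ (range v) = tangentSpaceAt S q
  apply_eq : ∀ i, -(fderiv ℝ N q (v i)) = m i • v i
  monotone : Monotone m

namespace IsPrincipalFrame

variable {n d : ℕ} {S : Set (EuclideanSpace ℝ (Fin n))}
  {N : EuclideanSpace ℝ (Fin n) → EuclideanSpace ℝ (Fin n)} {q : EuclideanSpace ℝ (Fin n)}
  {v : Fin d → EuclideanSpace ℝ (Fin n)} {m : Fin d → ℝ}

/-- Each `-DN (v i)` is a multiple of `v i`, hence already tangent, so the projection in
`shapeOperator` does nothing and the operator is diagonal in this basis. -/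
theorem exists_basis (h : IsPrincipalFrame S N q v m) :
    ∃ b : Module.Basis (Fin d) ℝ (tangentSpaceAt S q),
      (∀ i, (b i : EuclideanSpace ℝ (Fin n)) = v i) ∧
      ∀ i, shapeOperator S N q (b i) = m i • b i := by
  let b := (Module.Basis.span h.linearIndependent).map (LinearEquiv.ofEq _ _ h.span_eq)
  have hb : ∀ i, (b i : EuclideanSpace ℝ (Fin n)) = v i := fun i => by
    simp [b, Module.Basis.span_apply]
  refine ⟨b, hb, fun i => Subtype.ext ?_⟩
  have hi : -(fderiv ℝ N q (b i)) = m i • (b i : EuclideanSpace ℝ (Fin n)) := by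
    rw [hb, h.apply_eq]
  rw [shapeOperator_apply_of_mem, hi]
  · rfl
  · rw [hi]
    exact Submodule.smul_mem _ _ (b i).2

/-- In the frame the operator has the matrix `diagonal m`, so the roots of its characteristic
polynomial are the entries of `m`, and monotonicity says that they are already sorted. As `i : Fin
d`, the default value of `getD` never enters. -/
theorem principalCurvature_eq (h : IsPrincipalFrame S N q v m) (i : Fin d) :
    principalCurvature S N i q = m i := by
  obtain ⟨b, -, hb⟩ := h.exists_basis
  have hM : LinearMap.toMatrix b b (shapeOperator S N q) = Matrix.diagonal m := by
    ext i j
    rw [LinearMap.toMatrix_apply, hb, map_smul, Finsupp.smul_apply, b.repr_self,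
      Matrix.diagonal_apply, Finsupp.single_apply]
    rcases eq_or_ne i j with rfl | hij
    · simp
    · simp [hij, hij.symm]
  have hr : (shapeOperator S N q).charpoly.roots = (List.ofFn m : Multiset ℝ) := by
    rw [← LinearMap.charpoly_toMatrix _ b, hM, Matrix.charpoly_diagonal,
      Polynomial.roots_prod _ _ (Finset.prod_ne_zero_iff.2 fun i _ => Polynomial.X_sub_C_ne_zero _)]
    simp [Multiset.bind_singleton, List.ofFn_eq_map]
  have hs : (shapeOperator S N q).charpoly.roots.sort (· ≤ ·) = List.ofFn m := by
    rw [hr, Multiset.coe_sort]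
    exact List.mergeSort_of_pairwise (by simpa using (List.pairwise_ofFn.2 fun i j hij => h.monotone hij.le))
  rw [principalCurvature, hs, List.getD_eq_getElem _ _ (by simp)]
  simp

theorem principalSpace_eq (h : IsPrincipalFrame S N q v m) (i : Fin d) :
    principalSpace S N i q = Submodule.span ℝ (v '' {j | m j = m i}) := by
  rw [principalSpace, h.principalCurvature_eq i]
  obtain ⟨b, hbv, hb⟩ := h.exists_basis
  apply le_antisymm
  · rintro _ ⟨w, hw, rfl⟩
    have hw' := Module.End.mem_eigenspace_iff.1 hw
    rw [Submodule.subtype_apply, ← b.sum_repr w, Submodule.coe_sum]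
    refine Submodule.sum_mem _ fun j _ => ?_
    by_cases hj : m j = m i
    · rw [Submodule.coe_smul, hbv]
      exact Submodule.smul_mem _ _ (Submodule.subset_span ⟨j, hj, rfl⟩)
    · have : b.repr w j = 0 := by
        -- Comparison of the coordinates number `j` on both sides of the eigenvalue equation for
        -- `w`.
        have h1 := congrArg (fun x => b.repr x j) hw'
        nth_rewrite 1 [← b.sum_repr w] at h1
        simp only [map_sum, map_smul, hb, Finsupp.coe_finsetSum, Finset.sum_apply,
          Finsupp.smul_apply, b.repr_self, smul_eq_mul, Finsupp.single_apply, mul_ite, mul_one,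
          mul_zero, Finset.sum_ite_eq', Finset.mem_univ, if_true] at h1
        have h2 : (m j - m i) * b.repr w j = 0 := by linarith
        exact (mul_eq_zero.1 h2).resolve_left (sub_ne_zero.2 hj)
      simp [this]
  · rw [Submodule.span_le]
    rintro _ ⟨j, hj, rfl⟩
    refine ⟨b j, Module.End.mem_eigenspace_iff.2 ?_, hbv j⟩
    rw [hb, hj]

theorem finrank_principalSpace (h : IsPrincipalFrame S N q v m) (i : Fin d) :
    Module.finrank ℝ (principalSpace S N i q) = {j | m j = m i}.ncard := by
  classical
  have := finrank_span_eq_card (h.linearIndependent.comp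
    (Subtype.val : {j | m j = m i} → Fin d) Subtype.val_injective)
  rw [h.principalSpace_eq i, image_eq_range, ← Nat.card_coe_set_eq, Nat.card_eq_fintype_card]
  exact this

theorem mem_regularSet_iff (h : IsPrincipalFrame S N q v m) (hq : q ∈ S) (i : Fin d) :
    q ∈ regularSet S N i ↔ ∀ j, m j = m i → j = i := by
  change q ∈ S ∧ _ = 1 ↔ _
  rw [h.finrank_principalSpace i, Set.ncard_eq_one]
  constructor
  · rintro ⟨-, k, hk⟩ j hj
    have h1 : i ∈ {j | m j = m i} := rfl
    have h2 : j ∈ {j | m j = m i} := hj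
    rw [hk] at h1 h2
    rw [mem_singleton_iff] at h1 h2
    rw [h1, h2]
  · intro H
    exact ⟨hq, i, Set.ext fun j => ⟨fun hj => H j hj, fun hj => by rw [mem_singleton_iff.1 hj]; rfl⟩⟩

theorem principalSpace_eq_span_singleton (h : IsPrincipalFrame S N q v m) (i : Fin d)
    (hi : ∀ j, m j = m i → j = i) : principalSpace S N i q = Submodule.span ℝ {v i} := by
  rw [h.principalSpace_eq i]
  congr 1
  have : {j | m j = m i} = {i} :=
    Set.ext fun j => ⟨fun hj => hi j hj, fun hj => by rw [mem_singleton_iff.1 hj]; rfl⟩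
  rw [this, image_singleton]

end IsPrincipalFrame

/-! ### Linear isometric embeddings -/

section Isometry

variable {n m : ℕ} (ι : EuclideanSpace ℝ (Fin n) →ₗᵢ[ℝ] EuclideanSpace ℝ (Fin m))

/-- The adjoint is a linear left inverse defined on the whole target space, so curves that lie in
the image of `ι` only for some times can be pulled back as `C¹` curves. -/
theorem adjoint_apply_self_of_isometry (x : EuclideanSpace ℝ (Fin n)) :
    ι.toContinuousLinearMap.adjoint (ι x) = x := by
  refine ext_inner_right ℝ fun y => ?_
  rw [ContinuousLinearMap.adjoint_inner_left]
  exact ι.inner_map_map x y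

theorem deriv_isometry_comp {γ : ℝ → EuclideanSpace ℝ (Fin n)} {t : ℝ}
    (hγ : DifferentiableAt ℝ γ t) : deriv (fun s => ι (γ s)) t = ι (deriv γ t) :=
  (ι.toContinuousLinearMap.hasFDerivAt.comp_hasDerivAt t hγ.hasDerivAt).deriv

theorem deriv_adjoint_comp {γ : ℝ → EuclideanSpace ℝ (Fin m)} {t : ℝ}
    (hγ : DifferentiableAt ℝ γ t) :
    deriv (fun s => ι.toContinuousLinearMap.adjoint (γ s)) t =
      ι.toContinuousLinearMap.adjoint (deriv γ t) :=
  (ι.toContinuousLinearMap.adjoint.hasFDerivAt.comp_hasDerivAt t hγ.hasDerivAt).deriv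

theorem tangentSpaceAt_image (S : Set (EuclideanSpace ℝ (Fin n))) (p : EuclideanSpace ℝ (Fin n)) :
    tangentSpaceAt (ι '' S) (ι p) = (tangentSpaceAt S p).map (ι : _ →ₗ[ℝ] _) := by
  rw [tangentSpaceAt, tangentSpaceAt, Submodule.map_span]
  congr 1
  ext w
  constructor
  · rintro ⟨γ, hγ, h0, rfl, hS⟩
    have hd : DifferentiableAt ℝ γ 0 := hγ.differentiableAt (by simp)
    have hev : γ =ᶠ[𝓝 0] fun s => ι (ι.toContinuousLinearMap.adjoint (γ s)) := by
      filter_upwards [hS] with t ht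
      obtain ⟨x, -, hx⟩ := ht
      rw [← hx, adjoint_apply_self_of_isometry]
    refine ⟨ι.toContinuousLinearMap.adjoint (deriv γ 0),
      ⟨fun s => ι.toContinuousLinearMap.adjoint (γ s),
        ι.toContinuousLinearMap.adjoint.contDiff.contDiffAt.comp 0 hγ, ?_,
        deriv_adjoint_comp ι hd, ?_⟩, ?_⟩
    · simp [h0, adjoint_apply_self_of_isometry]
    · filter_upwards [hS] with t ht
      obtain ⟨x, hxS, hx⟩ := ht
      rwa [← hx, adjoint_apply_self_of_isometry]
    · refine Eq.symm (hev.deriv_eq.trans ?_)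
      refine (deriv_isometry_comp ι
        (ι.toContinuousLinearMap.adjoint.differentiableAt.comp 0 hd)).trans ?_
      exact congrArg ι (deriv_adjoint_comp ι hd)
  · rintro ⟨_, ⟨γ, hγ, h0, rfl, hS⟩, rfl⟩
    refine ⟨fun s => ι (γ s), ι.toContinuousLinearMap.contDiff.contDiffAt.comp 0 hγ, by simp [h0],
      deriv_isometry_comp ι (hγ.differentiableAt (by simp)), ?_⟩
    filter_upwards [hS] with t ht
    exact mem_image_of_mem _ ht

/-- Curves are pushed forward by `ι` and pulled back by its adjoint; tangency is only compared at
points of `R`. -/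
theorem leaf_image {D : EuclideanSpace ℝ (Fin n) → Submodule ℝ (EuclideanSpace ℝ (Fin n))}
    {D' : EuclideanSpace ℝ (Fin m) → Submodule ℝ (EuclideanSpace ℝ (Fin m))}
    {R : Set (EuclideanSpace ℝ (Fin n))} {R' : Set (EuclideanSpace ℝ (Fin m))}
    (hR : R' = ι '' R) (hD : ∀ p ∈ R, D' (ι p) = (D p).map (ι : _ →ₗ[ℝ] _))
    (p p' : EuclideanSpace ℝ (Fin n)) : ι p' ∈ leaf D' R' (ι p) ↔ p' ∈ leaf D R p := by
  subst hR
  constructor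
  · rintro ⟨γ, hγ, h0, h1, hS⟩
    refine ⟨fun s => ι.toContinuousLinearMap.adjoint (γ s),
      ι.toContinuousLinearMap.adjoint.contDiff.comp hγ, by simp [h0, adjoint_apply_self_of_isometry],
      by simp [h1, adjoint_apply_self_of_isometry], fun t ht => ?_⟩
    obtain ⟨⟨x, hxR, hx⟩, hd⟩ := hS t ht
    rw [← hx, hD x hxR] at hd
    obtain ⟨v, hv, hvd⟩ := hd
    rw [deriv_adjoint_comp ι (hγ.differentiable (by simp) t), ← hvd]
    dsimp only
    rw [← hx]
    have hv' : ι.toContinuousLinearMap.adjoint ((ι : _ →ₗ[ℝ] _) v) = v :=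
      adjoint_apply_self_of_isometry ι v
    rw [adjoint_apply_self_of_isometry, hv']
    exact ⟨hxR, hv⟩
  · rintro ⟨γ, hγ, h0, h1, hS⟩
    refine ⟨fun s => ι (γ s), ι.toContinuousLinearMap.contDiff.comp hγ, by simp [h0],
      by simp [h1], fun t ht => ?_⟩
    obtain ⟨hR, hd⟩ := hS t ht
    refine ⟨mem_image_of_mem _ hR, ?_⟩
    rw [deriv_isometry_comp ι (hγ.differentiable (by simp) t), hD _ hR]
    exact ⟨_, hd, rfl⟩

end Isometry

/-! ### Calculus on ellipsoids -/

/-- The diagonal operator with entries `1 / sᵢ²`. -/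
noncomputable def invSqDiag {n : ℕ} (s : Fin n → ℝ) :
    EuclideanSpace ℝ (Fin n) →L[ℝ] EuclideanSpace ℝ (Fin n) :=
  LinearMap.toContinuousLinearMap
    { toFun := fun q => WithLp.toLp 2 fun i => q i / s i ^ 2
      map_add' := fun x y => by ext i; simp [add_div]
      map_smul' := fun k x => by ext i; simp [mul_div_assoc] }

section

variable {n : ℕ} (s : Fin n → ℝ)

@[simp] theorem invSqDiag_apply (q : EuclideanSpace ℝ (Fin n)) (i : Fin n) :
    invSqDiag s q i = q i / s i ^ 2 := rfl

theorem inner_invSqDiag (v w : EuclideanSpace ℝ (Fin n)) :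
    inner ℝ (invSqDiag s v) w = ∑ i, v i * w i / s i ^ 2 := by
  rw [PiLp.inner_apply]
  exact Finset.sum_congr rfl fun i _ => by
    rw [invSqDiag_apply, real_inner_eq_re_inner, RCLike.inner_apply]; simp; ring

theorem inner_invSqDiag_comm (v w : EuclideanSpace ℝ (Fin n)) :
    inner ℝ (invSqDiag s v) w = inner ℝ v (invSqDiag s w) := by
  rw [real_inner_comm (invSqDiag s w) v, inner_invSqDiag, inner_invSqDiag]
  simp only [mul_comm]

theorem quadric_eq_inner (q : EuclideanSpace ℝ (Fin n)) :
    quadric s q = inner ℝ (invSqDiag s q) q := by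
  rw [inner_invSqDiag, quadric]
  simp only [sq]

theorem quadric_smul (k : ℝ) (q : EuclideanSpace ℝ (Fin n)) :
    quadric s (k • q) = k ^ 2 * quadric s q := by
  rw [quadric_eq_inner, quadric_eq_inner, map_smul, inner_smul_left, inner_smul_right]
  simp
  ring

theorem contDiff_quadric {k : WithTop ℕ∞} : ContDiff ℝ k (quadric s) := by
  rw [funext (quadric_eq_inner s)]
  exact (invSqDiag s).contDiff.inner ℝ contDiff_id

theorem fderiv_quadric (q v : EuclideanSpace ℝ (Fin n)) :
    fderiv ℝ (quadric s) q v = 2 * inner ℝ (invSqDiag s q) v := by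
  rw [funext (quadric_eq_inner s), fderiv_inner_apply ℝ (invSqDiag s).differentiableAt
    differentiableAt_fun_id]
  simp [inner_invSqDiag_comm s v q]
  rw [real_inner_comm]
  ring

theorem gradient_quadric (q : EuclideanSpace ℝ (Fin n)) :
    gradient (quadric s) q = (2 : ℝ) • invSqDiag s q := by
  refine ext_inner_right ℝ fun v => ?_
  rw [gradient, InnerProductSpace.toDual_symm_apply, fderiv_quadric, inner_smul_left]
  simp

theorem innerNormal_eq (q : EuclideanSpace ℝ (Fin n)) :
    innerNormal s q = -(‖invSqDiag s q‖⁻¹ • invSqDiag s q) := by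
  rw [innerNormal, gradient_quadric, norm_smul, smul_smul]
  congr 2
  simp

variable {s}

theorem invSqDiag_ne_zero_of_mem {q : EuclideanSpace ℝ (Fin n)} (hq : q ∈ ellipsoid s) :
    invSqDiag s q ≠ 0 := by
  intro h
  have : quadric s q = 1 := hq
  rw [quadric_eq_inner, h, inner_zero_left] at this
  exact zero_ne_one this

theorem hasFDerivAt_inv_norm {V : Type*} [NormedAddCommGroup V] [InnerProductSpace ℝ V] {x : V}
    (hx : x ≠ 0) :
    HasFDerivAt (fun y : V => ‖y‖⁻¹) (-(‖x‖ ^ 3)⁻¹ • innerSL ℝ x) x := by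
  have hpos : 0 < ‖x‖ := norm_pos_iff.2 hx
  have h2 : HasFDerivAt (fun y : V => ‖y‖ ^ 2) (2 • innerSL ℝ x) x :=
    (hasStrictFDerivAt_norm_sq x).hasFDerivAt
  have h3 := (h2.sqrt (pow_ne_zero 2 hpos.ne'))
  simp only [Real.sqrt_sq (norm_nonneg _)] at h3
  have h4 := (hasDerivAt_inv hpos.ne').comp_hasFDerivAt x h3
  refine h4.congr_fderiv ?_
  ext v
  simp
  field_simp

theorem hasFDerivAt_innerNormal {q : EuclideanSpace ℝ (Fin n)} (hq : invSqDiag s q ≠ 0) :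
    HasFDerivAt (innerNormal s) (-(‖invSqDiag s q‖⁻¹ • invSqDiag s +
      ((-(‖invSqDiag s q‖ ^ 3)⁻¹ • innerSL ℝ (invSqDiag s q)).comp (invSqDiag s)).smulRight
        (invSqDiag s q))) q := by
  rw [funext (innerNormal_eq s)]
  exact (((hasFDerivAt_inv_norm hq).comp q (invSqDiag s).hasFDerivAt).smul
    (invSqDiag s).hasFDerivAt).neg

theorem neg_fderiv_innerNormal {q : EuclideanSpace ℝ (Fin n)} (hq : invSqDiag s q ≠ 0)
    (v : EuclideanSpace ℝ (Fin n)) :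
    -(fderiv ℝ (innerNormal s) q v) = ‖invSqDiag s q‖⁻¹ • invSqDiag s v -
      ((‖invSqDiag s q‖ ^ 3)⁻¹ * inner ℝ (invSqDiag s q) (invSqDiag s v)) • invSqDiag s q := by
  rw [(hasFDerivAt_innerNormal hq).fderiv]
  simp [sub_eq_add_neg]

/-- For tangent `v` the derivative of `1 / |A q|` cancels exactly the component of `A v` along `A
q`. So eigenvectors of the compression of `A` to the tangent space are principal directions; `l` is
the compressed eigenvalue, `k` the discarded normal component. -/
theorem neg_fderiv_innerNormal_eq_smul {q v : EuclideanSpace ℝ (Fin n)} {l k : ℝ}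
    (hq : invSqDiag s q ≠ 0) (hv : inner ℝ (invSqDiag s q) v = 0)
    (h : invSqDiag s v = l • v + k • invSqDiag s q) :
    -(fderiv ℝ (innerNormal s) q v) = (‖invSqDiag s q‖⁻¹ * l) • v := by
  have hpos : ‖invSqDiag s q‖ ≠ 0 := norm_ne_zero_iff.2 hq
  rw [neg_fderiv_innerNormal hq, h, inner_add_right, inner_smul_right, inner_smul_right, hv,
    real_inner_self_eq_norm_sq, smul_add, add_sub_assoc, smul_smul, smul_smul, ← sub_smul]
  have : ‖invSqDiag s q‖⁻¹ * k - (‖invSqDiag s q‖ ^ 3)⁻¹ * (l * 0 + k * ‖invSqDiag s q‖ ^ 2) = 0 := by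
    field_simp
    ring
  rw [this, zero_smul, add_zero]

/-- Radial projection to the ellipsoid, the device that turns straight lines into curves on it. -/
theorem quadric_inv_sqrt_smul {x : EuclideanSpace ℝ (Fin n)} (hx : 0 < quadric s x) :
    quadric s ((√(quadric s x))⁻¹ • x) = 1 := by
  rw [quadric_smul, inv_pow, Real.sq_sqrt hx.le, inv_mul_cancel₀ hx.ne']

theorem contDiffAt_inv_sqrt_quadric_smul {k : WithTop ℕ∞} {γ : ℝ → EuclideanSpace ℝ (Fin n)} {t : ℝ}
    (hγ : ContDiffAt ℝ k γ t) (ht : 0 < quadric s (γ t)) :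
    ContDiffAt ℝ k (fun r => (√(quadric s (γ r)))⁻¹ • γ r) t := by
  have h1 : ContDiffAt ℝ k (fun r => quadric s (γ r)) t := (contDiff_quadric s).contDiffAt.comp t hγ
  exact ((h1.sqrt ht.ne').inv (Real.sqrt_pos.2 ht).ne').smul hγ

/-- Differentiating `Q (γ t) = 1` gives one inclusion. For the other, the line `q + t v` is
projected radially; `Q` is stationary along it at `t = 0`, so the normalizing factor has derivative
zero and the velocity remains `v`. -/
theorem tangentSpaceAt_ellipsoid {q : EuclideanSpace ℝ (Fin n)} (hq : q ∈ ellipsoid s) :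
    tangentSpaceAt (ellipsoid s) q = (ℝ ∙ invSqDiag s q)ᗮ := by
  have hq1 : quadric s q = 1 := hq
  apply le_antisymm
  · rw [tangentSpaceAt, Submodule.span_le]
    rintro _ ⟨γ, hγ, rfl, rfl, hS⟩
    have hd : HasDerivAt γ (deriv γ 0) 0 := (hγ.differentiableAt (by simp)).hasDerivAt
    have h1 : HasDerivAt (fun t => quadric s (γ t)) (fderiv ℝ (quadric s) (γ 0) (deriv γ 0)) 0 :=
      (((contDiff_quadric s (k := 1)).differentiable (by simp) _).hasFDerivAt).comp_hasDerivAt 0 hd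
    have h2 : (fun t => quadric s (γ t)) =ᶠ[𝓝 0] fun _ => 1 := hS
    have h3 := h1.unique ((hasDerivAt_const 0 (1 : ℝ)).congr_of_eventuallyEq h2)
    rw [fderiv_quadric] at h3
    exact Submodule.mem_orthogonal_singleton_iff_inner_right.2 (by linarith)
  · intro v hv
    have hv' := Submodule.mem_orthogonal_singleton_iff_inner_right.1 hv
    refine Submodule.subset_span ?_
    have hl : ContDiff ℝ 1 (fun t : ℝ => q + t • v) := by fun_prop
    have hl0 : q + (0 : ℝ) • v = q := by simp
    have hpos : 0 < quadric s (q + (0 : ℝ) • v) := by rw [hl0, hq1]; exact one_pos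
    have hline : HasDerivAt (fun t : ℝ => q + t • v) v 0 := by
      simpa using ((hasDerivAt_id (0 : ℝ)).smul_const v).const_add q
    refine ⟨fun t => (√(quadric s (q + t • v)))⁻¹ • (q + t • v),
      contDiffAt_inv_sqrt_quadric_smul hl.contDiffAt hpos, by simp [hq1], ?_, ?_⟩
    · have h1 : HasDerivAt (fun t : ℝ => quadric s (q + t • v))
          (fderiv ℝ (quadric s) (q + (0 : ℝ) • v) v) 0 :=
        (((contDiff_quadric s (k := 1)).differentiable (by simp) _).hasFDerivAt).comp_hasDerivAt 0
          hline
      rw [fderiv_quadric, hl0, hv', mul_zero] at h1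
      have h2 := (((h1.sqrt hpos.ne').inv (Real.sqrt_pos.2 hpos).ne').smul hline).deriv
      refine h2.trans ?_
      simp [hq1]
    · have hc : ContinuousAt (fun t : ℝ => quadric s (q + t • v)) 0 :=
        ((contDiff_quadric s (k := 1)).continuous.comp hl.continuous).continuousAt
      filter_upwards [hc.eventually (lt_mem_nhds hpos)] with t ht
      exact quadric_inv_sqrt_smul ht

end

/-! ### The pages and their principal frames -/

/-- The isometric embedding `(X, Y, Z) ↦ (X, Z, -sin θ Y, cos θ Y)` of `ℝ³` onto the hyperplane
`cos θ z + sin θ w = 0`. -/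
noncomputable def pageEmbedding (θ : ℝ) :
    EuclideanSpace ℝ (Fin 3) →ₗᵢ[ℝ] EuclideanSpace ℝ (Fin 4) where
  toFun p := !₂[p 0, p 2, -Real.sin θ * p 1, Real.cos θ * p 1]
  map_add' x y := by ext i; fin_cases i <;> simp <;> ring
  map_smul' k x := by ext i; fin_cases i <;> simp <;> ring
  norm_map' x := by
    change ‖(!₂[x 0, x 2, -Real.sin θ * x 1, Real.cos θ * x 1] : EuclideanSpace ℝ (Fin 4))‖ = ‖x‖
    rw [EuclideanSpace.norm_eq, EuclideanSpace.norm_eq]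
    congr 1
    simp [Fin.sum_univ_succ]
    linear_combination (x 1) ^ 2 * Real.sin_sq_add_cos_sq θ

/-- The unit normal `(0, 0, cos θ, sin θ)` of the hyperplane `cos θ z + sin θ w = 0`. -/
noncomputable def pageNormal (θ : ℝ) : EuclideanSpace ℝ (Fin 4) :=
  !₂[0, 0, Real.cos θ, Real.sin θ]

section

variable (θ : ℝ) (p : EuclideanSpace ℝ (Fin 3))

@[simp] theorem pageEmbedding_zero : pageEmbedding θ p 0 = p 0 := rfl
@[simp] theorem pageEmbedding_one : pageEmbedding θ p 1 = p 2 := rfl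
@[simp] theorem pageEmbedding_two : pageEmbedding θ p 2 = -Real.sin θ * p 1 := rfl
@[simp] theorem pageEmbedding_three : pageEmbedding θ p 3 = Real.cos θ * p 1 := rfl
@[simp] theorem pageNormal_zero : pageNormal θ 0 = 0 := rfl
@[simp] theorem pageNormal_one : pageNormal θ 1 = 0 := rfl
@[simp] theorem pageNormal_two : pageNormal θ 2 = Real.cos θ := rfl
@[simp] theorem pageNormal_three : pageNormal θ 3 = Real.sin θ := rfl

theorem norm_pageNormal : ‖pageNormal θ‖ = 1 := by
  rw [EuclideanSpace.norm_eq]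
  simp [Fin.sum_univ_succ]

theorem inner_pageEmbedding_pageNormal : inner ℝ (pageEmbedding θ p) (pageNormal θ) = 0 := by
  simp [PiLp.inner_apply, Fin.sum_univ_succ]
  ring

theorem inner_pageNormal (v : EuclideanSpace ℝ (Fin 4)) :
    inner ℝ (pageNormal θ) v = Real.cos θ * v 2 + Real.sin θ * v 3 := by
  simp [PiLp.inner_apply, Fin.sum_univ_succ]
  ring

theorem exists_pageEmbedding_eq {q : EuclideanSpace ℝ (Fin 4)}
    (hq : Real.cos θ * q 2 + Real.sin θ * q 3 = 0) :
    pageEmbedding θ !₂[q 0, -Real.sin θ * q 2 + Real.cos θ * q 3, q 1] = q := by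
  have h := Real.sin_sq_add_cos_sq θ
  ext i
  fin_cases i
  · rfl
  · rfl
  · simp
    linear_combination q 2 * h - Real.cos θ * hq
  · simp
    linear_combination q 3 * h - Real.sin θ * hq

variable {a b c : ℝ}

/-- The coordinate `Y` is placed in the `(z, w)`-plane, on which the diagonal operator is the scalar
`1 / c²`; this is where the equality of the last two semi-axes enters. -/
theorem invSqDiag_pageEmbedding :
    invSqDiag ![a, b, c, c] (pageEmbedding θ p) = pageEmbedding θ (invSqDiag ![a, c, b] p) := by
  ext i
  fin_cases i <;> simp <;> ring

theorem invSqDiag_pageNormal :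
    invSqDiag ![a, b, c, c] (pageNormal θ) = (c ^ 2)⁻¹ • pageNormal θ := by
  ext i
  fin_cases i <;> simp <;> ring

theorem quadric_pageEmbedding :
    quadric ![a, b, c, c] (pageEmbedding θ p) = quadric ![a, c, b] p := by
  rw [quadric_eq_inner, quadric_eq_inner, invSqDiag_pageEmbedding, LinearIsometry.inner_map_map]

theorem ellipsoidPage_eq_image :
    ellipsoidPage a b c θ = pageEmbedding θ '' ellipsoid ![a, c, b] := by
  ext q
  constructor
  · rintro ⟨hq, hθ⟩
    refine ⟨_, ?_, exists_pageEmbedding_eq θ hθ⟩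
    change quadric _ _ = 1
    rw [← quadric_pageEmbedding θ, exists_pageEmbedding_eq θ hθ]
    exact hq
  · rintro ⟨p, hp, rfl⟩
    refine ⟨(quadric_pageEmbedding θ p).trans hp, ?_⟩
    simp
    ring

theorem ellipsoidPage_subset : ellipsoidPage a b c θ ⊆ ellipsoidACCB a b c := fun _ h => h.1

variable {θ p}

/-- The formula for `-DN` involves only the diagonal operator, norms and inner products, all of
which the embedding respects. -/
theorem neg_fderiv_normalACCB (hp : p ∈ ellipsoid ![a, c, b]) (v : EuclideanSpace ℝ (Fin 3)) :
    -(fderiv ℝ (normalACCB a b c) (pageEmbedding θ p) (pageEmbedding θ v)) =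
      pageEmbedding θ (-(fderiv ℝ (innerNormal ![a, c, b]) p v)) := by
  have h := invSqDiag_ne_zero_of_mem hp
  have h' : invSqDiag ![a, b, c, c] (pageEmbedding θ p) ≠ 0 := by
    rw [invSqDiag_pageEmbedding]
    exact fun h0 => h ((pageEmbedding θ).injective (h0.trans (map_zero _).symm))
  rw [neg_fderiv_innerNormal h, normalACCB, neg_fderiv_innerNormal h']
  simp only [invSqDiag_pageEmbedding, LinearIsometry.norm_map, LinearIsometry.inner_map_map,
    map_sub, map_smul]

theorem IsPrincipalFrame.page {d : ℕ} {v : Fin d → EuclideanSpace ℝ (Fin 3)} {m : Fin d → ℝ}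
    (hp : p ∈ ellipsoid ![a, c, b])
    (h : IsPrincipalFrame (ellipsoid ![a, c, b]) (innerNormal ![a, c, b]) p v m) (θ : ℝ) :
    IsPrincipalFrame (ellipsoidPage a b c θ) (normalACCB a b c) (pageEmbedding θ p)
      (fun i => pageEmbedding θ (v i)) m where
  linearIndependent :=
    h.linearIndependent.map' (pageEmbedding θ).toLinearMap
      (LinearMap.ker_eq_bot.2 (pageEmbedding θ).injective)
  span_eq := by
    rw [ellipsoidPage_eq_image, tangentSpaceAt_image, ← h.span_eq, Submodule.map_span,
      ← range_comp]
    rfl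
  apply_eq i := by rw [neg_fderiv_normalACCB hp, h.apply_eq, map_smul]
  monotone := h.monotone

/-- The principal curvature of `E` in the direction normal to the page. -/
noncomputable def pageNormalCurvature (a b c : ℝ) (p : EuclideanSpace ℝ (Fin 3)) : ℝ :=
  ‖invSqDiag ![a, c, b] p‖⁻¹ * (c ^ 2)⁻¹

/-- The page normal is orthogonal to the gradient along the page and an honest eigenvector of the
diagonal operator, so there is no normal component to discard (`k = 0`). -/
theorem neg_fderiv_normalACCB_pageNormal (hp : p ∈ ellipsoid ![a, c, b]) :
    -(fderiv ℝ (normalACCB a b c) (pageEmbedding θ p) (pageNormal θ)) =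
      pageNormalCurvature a b c p • pageNormal θ := by
  have h' : invSqDiag ![a, b, c, c] (pageEmbedding θ p) ≠ 0 := by
    refine invSqDiag_ne_zero_of_mem ?_
    exact (quadric_pageEmbedding θ p).trans hp
  rw [normalACCB, neg_fderiv_innerNormal_eq_smul (l := (c ^ 2)⁻¹) (k := 0) h']
  · rw [invSqDiag_pageEmbedding, LinearIsometry.norm_map, pageNormalCurvature]
  · rw [invSqDiag_pageEmbedding, inner_pageEmbedding_pageNormal]
  · rw [invSqDiag_pageNormal, zero_smul, add_zero]

theorem orthonormal_pageFrame {v : Fin 2 → EuclideanSpace ℝ (Fin 3)} (hv : Orthonormal ℝ v) (θ : ℝ) :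
    Orthonormal ℝ ![pageEmbedding θ (v 0), pageNormal θ, pageEmbedding θ (v 1)] := by
  have h01 : inner ℝ (v 0) (v 1) = 0 := hv.2 (by decide)
  have h10 : inner ℝ (v 1) (v 0) = 0 := hv.2 (by decide)
  constructor
  · intro i
    fin_cases i
    · simpa using hv.1 0
    · exact norm_pageNormal θ
    · simpa using hv.1 1
  · intro i j hij
    fin_cases i <;> fin_cases j <;>
      simp [h01, h10, inner_pageEmbedding_pageNormal, real_inner_comm (pageEmbedding θ _) (pageNormal θ)] at hij ⊢

theorem span_eq_orthogonal_singleton {n : ℕ} {v : Fin n → EuclideanSpace ℝ (Fin (n + 1))}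
    (hv : LinearIndependent ℝ v) {x : EuclideanSpace ℝ (Fin (n + 1))} (hx : x ≠ 0)
    (h : ∀ i, inner ℝ x (v i) = 0) : Submodule.span ℝ (range v) = (ℝ ∙ x)ᗮ := by
  refine Submodule.eq_of_le_of_finrank_eq ?_ ?_
  · rw [Submodule.span_le]
    rintro _ ⟨i, rfl⟩
    exact Submodule.mem_orthogonal_singleton_iff_inner_right.2 (h i)
  · have : Fact (Module.finrank ℝ (EuclideanSpace ℝ (Fin (n + 1))) = n + 1) := ⟨by simp⟩
    rw [finrank_span_eq_card hv, Submodule.finrank_orthogonal_span_singleton (n := n) hx,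
      Fintype.card_fin]

/-- The page normal is inserted between the two principal directions of the page, so indices `0, 1`
of the page become `0, 2` on the hypersurface. The bounds `h0`, `h1` keep the eigenvalues in
increasing order. -/
theorem IsPrincipalFrame.ellipsoidACCB {v : Fin 2 → EuclideanSpace ℝ (Fin 3)} {m : Fin 2 → ℝ}
    (hp : p ∈ ellipsoid ![a, c, b]) (hv : Orthonormal ℝ v)
    (h : IsPrincipalFrame (ellipsoid ![a, c, b]) (innerNormal ![a, c, b]) p v m)
    (h0 : m 0 ≤ pageNormalCurvature a b c p) (h1 : pageNormalCurvature a b c p ≤ m 1) (θ : ℝ) :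
    IsPrincipalFrame (ellipsoidACCB a b c) (normalACCB a b c) (pageEmbedding θ p)
      ![pageEmbedding θ (v 0), pageNormal θ, pageEmbedding θ (v 1)]
      ![m 0, pageNormalCurvature a b c p, m 1] where
  linearIndependent := (orthonormal_pageFrame hv θ).linearIndependent
  span_eq := by
    have hE : pageEmbedding θ p ∈ PrincipalConfig.ellipsoidACCB a b c :=
      (quadric_pageEmbedding θ p).trans hp
    have hi : ∀ i, inner ℝ (invSqDiag ![a, c, b] p) (v i) = 0 := fun i => by
      rw [← Submodule.mem_orthogonal_singleton_iff_inner_right, ← tangentSpaceAt_ellipsoid hp,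
        ← h.span_eq]
      exact Submodule.subset_span (mem_range_self i)
    rw [PrincipalConfig.ellipsoidACCB, tangentSpaceAt_ellipsoid hE]
    refine span_eq_orthogonal_singleton (orthonormal_pageFrame hv θ).linearIndependent
      (invSqDiag_ne_zero_of_mem hE) fun i => ?_
    rw [invSqDiag_pageEmbedding]
    fin_cases i
    · simpa using hi 0
    · exact inner_pageEmbedding_pageNormal θ _
    · simpa using hi 1
  apply_eq i := by
    fin_cases i
    · exact (neg_fderiv_normalACCB hp (v 0)).trans (by rw [h.apply_eq, map_smul]; rfl)
    · exact neg_fderiv_normalACCB_pageNormal hp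
    · exact (neg_fderiv_normalACCB hp (v 1)).trans (by rw [h.apply_eq, map_smul]; rfl)
  monotone := by
    intro i j hij
    fin_cases i <;> fin_cases j <;> simp at hij ⊢ <;> linarith

/-- The spectral theorem for the compression of a symmetric operator of `ℝ³` to a plane. -/
theorem exists_orthonormal_compression {A : EuclideanSpace ℝ (Fin 3) →L[ℝ] EuclideanSpace ℝ (Fin 3)}
    (hA : ∀ v w, inner ℝ (A v) w = inner ℝ v (A w)) {x : EuclideanSpace ℝ (Fin 3)} (hx : x ≠ 0) :
    ∃ (v : Fin 2 → EuclideanSpace ℝ (Fin 3)) (l k : Fin 2 → ℝ), Orthonormal ℝ v ∧ l 0 ≤ l 1 ∧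
      (∀ i, inner ℝ x (v i) = 0) ∧ ∀ i, A (v i) = l i • v i + k i • x := by
  let K : Submodule ℝ (EuclideanSpace ℝ (Fin 3)) := (ℝ ∙ x)ᗮ
  let T : K →ₗ[ℝ] K := (K.orthogonalProjectionOnto : _ →ₗ[ℝ] K) ∘ₗ A.toLinearMap ∘ₗ K.subtype
  have hT : T.IsSymmetric := fun y z => by
    have h1 : inner ℝ (T y) z = inner ℝ (A y) (z : EuclideanSpace ℝ (Fin 3)) :=
      K.inner_orthogonalProjectionOnto_eq_of_mem_right z (A y)
    have h2 : inner ℝ y (T z) = inner ℝ (y : EuclideanSpace ℝ (Fin 3)) (A z) :=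
      K.inner_orthogonalProjectionOnto_eq_of_mem_left y (A z)
    rw [h1, h2, hA]
  have : Fact (Module.finrank ℝ (EuclideanSpace ℝ (Fin 3)) = 2 + 1) := ⟨by simp⟩
  have hK : Module.finrank ℝ K = 2 := Submodule.finrank_orthogonal_span_singleton hx
  let u := hT.eigenvectorBasis hK
  have hk : ∀ i, ∃ k : ℝ, A (u i) = hT.eigenvalues hK i • (u i : EuclideanSpace ℝ (Fin 3)) + k • x := by
    intro i
    have h1 : (T (u i) : EuclideanSpace ℝ (Fin 3)) = hT.eigenvalues hK i • (u i : EuclideanSpace ℝ (Fin 3)) :=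
      congrArg Subtype.val (hT.apply_eigenvectorBasis hK i)
    -- The compression discards only a multiple of `x`, since `Kᗮ` is the line through `x`.
    have h2 : A (u i) - T (u i) ∈ Kᗮ := K.sub_starProjection_mem_orthogonal (A (u i))
    rw [Submodule.orthogonal_orthogonal, Submodule.mem_span_singleton] at h2
    obtain ⟨k, hk⟩ := h2
    exact ⟨k, by rw [← h1, hk]; abel⟩
  choose k hk using hk
  have hu : Orthonormal ℝ fun i => (u i : EuclideanSpace ℝ (Fin 3)) :=
    u.orthonormal.comp_linearIsometry K.subtypeₗᵢ
  -- The eigenvalues come in decreasing order, hence the reversal of indices.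
  refine ⟨fun i => u (Fin.rev i), fun i => hT.eigenvalues hK (Fin.rev i), fun i => k (Fin.rev i),
    hu.comp _ Fin.rev_injective, hT.eigenvalues_antitone hK (by decide), fun i => ?_,
    fun i => hk _⟩
  exact Submodule.mem_orthogonal_singleton_iff_inner_right.1 (u (Fin.rev i)).2

/-- The form `⟪A w, w⟫ - |w|² / c²` equals `w₀² (1/a² - 1/c²) + w₂² (1/b² - 1/c²)`, with one
negative and one positive coefficient. If `p 1 ≠ 0`, the tangent plane contains a vector on which it
is negative and one on which it is positive, so the compressed eigenvalues lie strictly on either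
side of `1 / c²`. -/
theorem exists_principalFrame (hb : 0 < b) (hbc : b < c) (hca : c < a)
    (hp : p ∈ ellipsoid ![a, c, b]) :
    ∃ (v : Fin 2 → EuclideanSpace ℝ (Fin 3)) (m : Fin 2 → ℝ), Orthonormal ℝ v ∧
      IsPrincipalFrame (ellipsoid ![a, c, b]) (innerNormal ![a, c, b]) p v m ∧
      m 0 ≤ pageNormalCurvature a b c p ∧ pageNormalCurvature a b c p ≤ m 1 ∧
      (p 1 ≠ 0 → m 0 < pageNormalCurvature a b c p ∧ pageNormalCurvature a b c p < m 1) := by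
  have hc : 0 < c := hb.trans hbc
  have ha : 0 < a := hc.trans hca
  have hx := invSqDiag_ne_zero_of_mem hp
  set x := invSqDiag ![a, c, b] p with hxdef
  obtain ⟨v, l, k, hv, hl, hvx, hAv⟩ :=
    exists_orthonormal_compression (inner_invSqDiag_comm ![a, c, b]) hx
  have hpos : 0 < ‖x‖⁻¹ := inv_pos.2 (norm_pos_iff.2 hx)
  have hspan := span_eq_orthogonal_singleton hv.linearIndependent hx hvx
  have hv00 : inner ℝ (v 0) (v 0) = (1 : ℝ) := by rw [real_inner_self_eq_norm_sq, hv.1]; norm_num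
  have hv11 : inner ℝ (v 1) (v 1) = (1 : ℝ) := by rw [real_inner_self_eq_norm_sq, hv.1]; norm_num
  have hv01 : inner ℝ (v 0) (v 1) = (0 : ℝ) := hv.2 (by decide)
  have hv10 : inner ℝ (v 1) (v 0) = (0 : ℝ) := hv.2 (by decide)
  -- The form evaluated on a tangent vector `w` in two ways: through its components `α, β` in the
  -- eigenframe and through its coordinates.
  have test : ∀ w : EuclideanSpace ℝ (Fin 3), inner ℝ x w = (0 : ℝ) → ∃ α β : ℝ,
      α ^ 2 + β ^ 2 = w 0 ^ 2 + w 1 ^ 2 + w 2 ^ 2 ∧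
      (l 0 - (c ^ 2)⁻¹) * α ^ 2 + (l 1 - (c ^ 2)⁻¹) * β ^ 2 =
        w 0 ^ 2 * ((a ^ 2)⁻¹ - (c ^ 2)⁻¹) + w 2 ^ 2 * ((b ^ 2)⁻¹ - (c ^ 2)⁻¹) := by
    intro w hw
    have hw' : w ∈ Submodule.span ℝ (range v) := by
      rw [hspan]
      exact Submodule.mem_orthogonal_singleton_iff_inner_right.2 hw
    obtain ⟨f, hf⟩ := (Submodule.mem_span_range_iff_exists_fun ℝ).1 hw'
    rw [Fin.sum_univ_two] at hf
    have h1 : inner ℝ w w = (f 0 ^ 2 + f 1 ^ 2 : ℝ) := by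
      rw [← hf]
      simp only [inner_add_left, inner_add_right, inner_smul_left, inner_smul_right, hv00, hv11,
        hv01, hv10, RCLike.conj_to_real]
      ring
    have h2 : inner ℝ (invSqDiag ![a, c, b] w) w = (l 0 * f 0 ^ 2 + l 1 * f 1 ^ 2 : ℝ) := by
      rw [← hf]
      simp only [map_add, map_smul, hAv, inner_add_left, inner_add_right, inner_smul_left,
        inner_smul_right, hv00, hv11, hv01, hv10, hvx, RCLike.conj_to_real]
      ring
    rw [inner_invSqDiag] at h2
    have h3 : inner ℝ w w = (w 0 ^ 2 + w 1 ^ 2 + w 2 ^ 2 : ℝ) := by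
      rw [PiLp.inner_apply]
      simp [Fin.sum_univ_succ]
      ring
    refine ⟨f 0, f 1, by rw [← h1, h3], ?_⟩
    have h4 : (f 0 ^ 2 + f 1 ^ 2 : ℝ) = w 0 ^ 2 + w 1 ^ 2 + w 2 ^ 2 := by rw [← h1, h3]
    simp [Fin.sum_univ_succ] at h2
    field_simp at h2 h4 ⊢
    linear_combination -h2 - a ^ 2 * b ^ 2 * h4
  have hac : (a ^ 2)⁻¹ - (c ^ 2)⁻¹ < 0 := by
    have : (a ^ 2)⁻¹ < (c ^ 2)⁻¹ := inv_strictAnti₀ (by positivity) (by gcongr)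
    linarith
  have hbc' : 0 < (b ^ 2)⁻¹ - (c ^ 2)⁻¹ := by
    have : (c ^ 2)⁻¹ < (b ^ 2)⁻¹ := inv_strictAnti₀ (by positivity) (by gcongr)
    linarith
  have hstrict : p 1 ≠ 0 → l 0 < (c ^ 2)⁻¹ ∧ (c ^ 2)⁻¹ < l 1 := by
    intro hp1
    have hx1 : 0 < x 1 ^ 2 := by
      have : x 1 ≠ 0 := div_ne_zero hp1 (by simpa using hc.ne')
      positivity
    constructor
    -- This vector is orthogonal to `x` and has no third coordinate, so only the negative
    -- coefficient contributes.
    · obtain ⟨α, β, -, h⟩ := test !₂[x 1, -x 0, 0] (by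
        simp [PiLp.inner_apply, Fin.sum_univ_succ]; ring)
      simp at h
      by_contra! hcon
      have := mul_neg_of_pos_of_neg hx1 hac
      have h1 := mul_nonneg (sub_nonneg.2 hcon) (sq_nonneg α)
      have h2 := mul_nonneg (sub_nonneg.2 (hcon.trans hl)) (sq_nonneg β)
      linarith
    · obtain ⟨α, β, -, h⟩ := test !₂[0, x 2, -x 1] (by
        simp [PiLp.inner_apply, Fin.sum_univ_succ]; ring)
      simp at h
      by_contra! hcon
      have := mul_pos hx1 hbc'
      have h1 := mul_nonneg (sub_nonneg.2 hcon) (sq_nonneg β)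
      have h2 := mul_nonneg (sub_nonneg.2 (hl.trans hcon)) (sq_nonneg α)
      linarith
  have hweak : l 0 ≤ (c ^ 2)⁻¹ ∧ (c ^ 2)⁻¹ ≤ l 1 := by
    by_cases hp1 : p 1 = 0
    · have hx1 : x 1 = 0 := by simp [hxdef, hp1]
      -- When `p 1 = 0` the middle axis is tangent and the form vanishes on this unit vector, so its
      -- two eigenvalues cannot have the same strict sign.
      obtain ⟨α, β, h1, h2⟩ := test !₂[0, 1, 0] (by
        simp [PiLp.inner_apply, Fin.sum_univ_succ, hx1])
      simp at h1 h2
      constructor <;> nlinarith [sq_nonneg α, sq_nonneg β]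
    · exact ⟨(hstrict hp1).1.le, (hstrict hp1).2.le⟩
  refine ⟨v, fun i => ‖x‖⁻¹ * l i, hv, ⟨hv.linearIndependent, ?_, fun i => ?_, ?_⟩,
    mul_le_mul_of_nonneg_left hweak.1 hpos.le, mul_le_mul_of_nonneg_left hweak.2 hpos.le,
    fun h => ⟨mul_lt_mul_of_pos_left (hstrict h).1 hpos, mul_lt_mul_of_pos_left (hstrict h).2 hpos⟩⟩
  · rw [tangentSpaceAt_ellipsoid hp, hspan]
  · exact neg_fderiv_innerNormal_eq_smul hx (hvx i) (hAv i)
  · intro i j hij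
    have := mul_le_mul_of_nonneg_left hl hpos.le
    fin_cases i <;> fin_cases j <;> simp at hij ⊢; linarith

end

/-! ### The principal configuration of the hypersurface -/

section

variable {a b c : ℝ}

/-- The angle is the argument of `y + iz` turned by a right angle; consequently every point of `E`
lies on a page. -/
theorem exists_cos_mul_add_sin_mul_eq_zero (y z : ℝ) : ∃ θ : ℝ, Real.cos θ * y + Real.sin θ * z = 0 := by
  have h1 := Complex.norm_mul_cos_arg (⟨y, z⟩ : ℂ)
  have h2 := Complex.norm_mul_sin_arg (⟨y, z⟩ : ℂ)
  refine ⟨Complex.arg ⟨y, z⟩ + Real.pi / 2, ?_⟩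
  rw [Real.cos_add_pi_div_two, Real.sin_add_pi_div_two]
  simp only at h1 h2
  rw [← h1, ← h2, Complex.norm_mul_cos_arg, Complex.norm_mul_sin_arg]
  linear_combination Real.cos (Complex.arg ⟨y, z⟩) * (-h2) + Real.sin (Complex.arg ⟨y, z⟩) * h1

theorem exists_mem_ellipsoidPage {q : EuclideanSpace ℝ (Fin 4)} (hq : q ∈ ellipsoidACCB a b c) :
    ∃ θ, q ∈ ellipsoidPage a b c θ :=
  (exists_cos_mul_add_sin_mul_eq_zero (q 2) (q 3)).imp fun _ h => ⟨hq, h⟩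

theorem exists_eq_pageEmbedding {θ : ℝ} {q : EuclideanSpace ℝ (Fin 4)}
    (hq : q ∈ ellipsoidPage a b c θ) : ∃ p ∈ ellipsoid ![a, c, b], pageEmbedding θ p = q := by
  rwa [ellipsoidPage_eq_image] at hq

theorem pageEmbedding_mem_page {p : EuclideanSpace ℝ (Fin 3)} (hp : p ∈ ellipsoid ![a, c, b])
    (θ : ℝ) : pageEmbedding θ p ∈ ellipsoidPage a b c θ := by
  rw [ellipsoidPage_eq_image]
  exact mem_image_of_mem _ hp

theorem pageEmbedding_mem_bindingEllipse {p : EuclideanSpace ℝ (Fin 3)}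
    (hp : p ∈ ellipsoid ![a, c, b]) (θ : ℝ) :
    pageEmbedding θ p ∈ bindingEllipse a b c ↔ p 1 = 0 := by
  constructor
  · rintro ⟨-, h2, h3⟩
    simp only [pageEmbedding_two, pageEmbedding_three] at h2 h3
    linear_combination -Real.sin θ * h2 + Real.cos θ * h3 - p 1 * Real.sin_sq_add_cos_sq θ
  · intro h
    exact ⟨(pageEmbedding_mem_page hp θ).1, by simp [h], by simp [h]⟩

theorem injective_of_strict {m0 m1 m2 : ℝ} (h0 : m0 < m1) (h1 : m1 < m2) (i j : Fin 3)
    (h : ![m0, m1, m2] j = ![m0, m1, m2] i) : j = i := by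
  fin_cases i <;> fin_cases j <;> simp at h ⊢ <;> linarith

variable (hb : 0 < b) (hbc : b < c) (hca : c < a)

include hb hbc hca

/-- The structure of the principal configuration at a point of a page off the binding. -/
theorem principalSpaces_of_mem_page_diff {θ : ℝ} {q : EuclideanSpace ℝ (Fin 4)}
    (hq : q ∈ ellipsoidPage a b c θ \ bindingEllipse a b c) :
    principalCurvature (ellipsoidACCB a b c) (normalACCB a b c) 0 q <
      principalCurvature (ellipsoidACCB a b c) (normalACCB a b c) 1 q ∧
    principalCurvature (ellipsoidACCB a b c) (normalACCB a b c) 1 q <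
      principalCurvature (ellipsoidACCB a b c) (normalACCB a b c) 2 q ∧
    q ∈ regularSet (ellipsoidACCB a b c) (normalACCB a b c) 0 ∧
    q ∈ regularSet (ellipsoidACCB a b c) (normalACCB a b c) 1 ∧
    q ∈ regularSet (ellipsoidACCB a b c) (normalACCB a b c) 2 ∧
    principalSpace (ellipsoidACCB a b c) (normalACCB a b c) 1 q = Submodule.span ℝ {pageNormal θ} ∧
    tangentSpaceAt (ellipsoidPage a b c θ) q =
      principalSpace (ellipsoidACCB a b c) (normalACCB a b c) 0 q ⊔
        principalSpace (ellipsoidACCB a b c) (normalACCB a b c) 2 q := by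
  obtain ⟨p, hp, rfl⟩ := exists_eq_pageEmbedding hq.1
  have hp1 : p 1 ≠ 0 := fun h => hq.2 ((pageEmbedding_mem_bindingEllipse hp θ).2 h)
  obtain ⟨v, m, hv, hF, h0, h1, hs⟩ := exists_principalFrame hb hbc hca hp
  obtain ⟨hs0, hs1⟩ := hs hp1
  have hE := hF.ellipsoidACCB hp hv h0 h1 θ
  have hinj := injective_of_strict hs0 hs1
  have hqE := hq.1.1
  have e0 : principalSpace _ _ 0 _ = _ := hE.principalSpace_eq_span_singleton 0 (hinj 0)
  have e2 : principalSpace _ _ 2 _ = _ := hE.principalSpace_eq_span_singleton 2 (hinj 2)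
  refine ⟨?_, ?_, (hE.mem_regularSet_iff hqE 0).2 (hinj 0), (hE.mem_regularSet_iff hqE 1).2 (hinj 1),
    (hE.mem_regularSet_iff hqE 2).2 (hinj 2), hE.principalSpace_eq_span_singleton 1 (hinj 1), ?_⟩
  · exact (hE.principalCurvature_eq 0).trans_lt (hs0.trans_eq (hE.principalCurvature_eq 1).symm)
  · exact (hE.principalCurvature_eq 1).trans_lt (hs1.trans_eq (hE.principalCurvature_eq 2).symm)
  · rw [e0, e2, ← (hF.page hp θ).span_eq, ← Submodule.span_union]
    congr 1
    ext w
    simp [eq_comm, or_comm]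

/-- The principal configuration of the hypersurface restricts to the pages. -/
theorem principalSpace_page {θ : ℝ} {q : EuclideanSpace ℝ (Fin 4)}
    (hq : q ∈ ellipsoidPage a b c θ) :
    (∀ v ∈ tangentSpaceAt (ellipsoidPage a b c θ) q,
      -(fderiv ℝ (normalACCB a b c) q v) ∈ tangentSpaceAt (ellipsoidPage a b c θ) q) ∧
    (q ∈ regularSet (ellipsoidACCB a b c) (normalACCB a b c) 0 →
      principalSpace (ellipsoidPage a b c θ) (normalACCB a b c) 0 q =
        principalSpace (ellipsoidACCB a b c) (normalACCB a b c) 0 q) ∧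
    (q ∈ regularSet (ellipsoidACCB a b c) (normalACCB a b c) 2 →
      principalSpace (ellipsoidPage a b c θ) (normalACCB a b c) 1 q =
        principalSpace (ellipsoidACCB a b c) (normalACCB a b c) 2 q) := by
  obtain ⟨p, hp, rfl⟩ := exists_eq_pageEmbedding hq
  obtain ⟨v, m, hv, hF, h0, h1, -⟩ := exists_principalFrame hb hbc hca hp
  have hE := hF.ellipsoidACCB hp hv h0 h1 θ
  have hP := hF.page hp θ
  refine ⟨fun w hw => ?_, fun hr => ?_, fun hr => ?_⟩
  · rw [← hP.span_eq] at hw ⊢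
    obtain ⟨f, rfl⟩ := (Submodule.mem_span_range_iff_exists_fun ℝ).1 hw
    rw [map_sum, ← Finset.sum_neg_distrib]
    refine Submodule.sum_mem _ fun i _ => ?_
    rw [map_smul, ← smul_neg, hP.apply_eq]
    exact Submodule.smul_mem _ _ (Submodule.smul_mem _ _ (Submodule.subset_span (mem_range_self i)))
  · have hi := (hE.mem_regularSet_iff hq.1 0).1 hr
    refine (hP.principalSpace_eq_span_singleton 0 fun j hj => ?_).trans
      (hE.principalSpace_eq_span_singleton 0 hi).symm
    fin_cases j
    · rfl
    · exact absurd (hi 2 hj) (by decide)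
  · have hi := (hE.mem_regularSet_iff hq.1 2).1 hr
    refine (hP.principalSpace_eq_span_singleton 1 fun j hj => ?_).trans
      (hE.principalSpace_eq_span_singleton 2 hi).symm
    fin_cases j
    · exact absurd (hi 0 hj) (by decide)
    · rfl

theorem principalSpace_pageEmbedding {p : EuclideanSpace ℝ (Fin 3)} (hp : p ∈ ellipsoid ![a, c, b])
    (θ : ℝ) (i : Fin 2) :
    principalSpace (ellipsoidPage a b c θ) (normalACCB a b c) i (pageEmbedding θ p) =
      (principalSpace (ellipsoid ![a, c, b]) (innerNormal ![a, c, b]) i p).map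
        (pageEmbedding θ : _ →ₗ[ℝ] _) := by
  obtain ⟨v, m, -, hF, -⟩ := exists_principalFrame hb hbc hca hp
  rw [hF.principalSpace_eq i, (hF.page hp θ).principalSpace_eq i, Submodule.map_span, image_image]
  rfl

theorem regularSet_page (θ : ℝ) (i : Fin 2) :
    regularSet (ellipsoidPage a b c θ) (normalACCB a b c) i =
      pageEmbedding θ '' regularSet (ellipsoid ![a, c, b]) (innerNormal ![a, c, b]) i := by
  have key : ∀ p ∈ ellipsoid ![a, c, b],
      pageEmbedding θ p ∈ regularSet (ellipsoidPage a b c θ) (normalACCB a b c) i ↔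
        p ∈ regularSet (ellipsoid ![a, c, b]) (innerNormal ![a, c, b]) i := fun p hp => by
    obtain ⟨v, m, -, hF, -⟩ := exists_principalFrame hb hbc hca hp
    rw [hF.mem_regularSet_iff hp, (hF.page hp θ).mem_regularSet_iff (pageEmbedding_mem_page hp θ)]
  ext q
  constructor
  · intro hq
    obtain ⟨p, hp, rfl⟩ := exists_eq_pageEmbedding hq.1
    exact ⟨p, (key p hp).1 hq, rfl⟩
  · rintro ⟨p, hp, rfl⟩
    exact (key p hp.1).2 hp

/-- The isometry between the ellipsoid and the page serves as the equivalence: it matches the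
regular sets and principal spaces exactly, hence the leaves. -/
theorem principallyEquivalent_page (θ : ℝ) :
    PrincipallyEquivalent (ellipsoidPage a b c θ) (normalACCB a b c)
      (ellipsoid ![a, c, b]) (innerNormal ![a, c, b]) := by
  let e : ellipsoid ![a, c, b] ≃ₜ ellipsoidPage a b c θ :=
    ((pageEmbedding θ).isometry.isEmbedding.homeomorphImage (ellipsoid ![a, c, b])).trans
      (Homeomorph.setCongr (ellipsoidPage_eq_image θ).symm)
  have he : ∀ p, (e p : EuclideanSpace ℝ (Fin 4)) = pageEmbedding θ p := fun p => rfl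
  have key : ∀ i : Fin 2,
      (∀ q : ellipsoidPage a b c θ, (q : EuclideanSpace ℝ (Fin 4)) ∈
        regularSet (ellipsoidPage a b c θ) (normalACCB a b c) i ↔
        (e.symm q : EuclideanSpace ℝ (Fin 3)) ∈
          regularSet (ellipsoid ![a, c, b]) (innerNormal ![a, c, b]) i) ∧
      ∀ q : ellipsoidPage a b c θ, (q : EuclideanSpace ℝ (Fin 4)) ∈
        regularSet (ellipsoidPage a b c θ) (normalACCB a b c) i →
        ∀ q' : ellipsoidPage a b c θ,
        ((q' : EuclideanSpace ℝ (Fin 4)) ∈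
          principalLeaf (ellipsoidPage a b c θ) (normalACCB a b c) i q ↔
        (e.symm q' : EuclideanSpace ℝ (Fin 3)) ∈
          principalLeaf (ellipsoid ![a, c, b]) (innerNormal ![a, c, b]) i (e.symm q)) := by
    refine fun i => ⟨fun q => ?_, fun q _ q' => ?_⟩
    · obtain ⟨p, rfl⟩ := e.surjective q
      rw [e.symm_apply_apply, he, regularSet_page hb hbc hca,
        (pageEmbedding θ).injective.mem_set_image]
    · obtain ⟨p, rfl⟩ := e.surjective q
      obtain ⟨p', rfl⟩ := e.surjective q'
      rw [e.symm_apply_apply, e.symm_apply_apply, he, he]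
      exact leaf_image _ (regularSet_page hb hbc hca θ i)
        (fun p hp => principalSpace_pageEmbedding hb hbc hca hp.1 θ i) _ _
  refine ⟨e.symm, fun i hi => ?_⟩
  rcases hi with rfl | rfl
  · exact key 0
  · exact key 1

/-! ### The binding -/

omit hb hbc hca in
theorem bindingEllipse_eq {q : EuclideanSpace ℝ (Fin 4)} (hq : q ∈ bindingEllipse a b c) :
    q 0 ^ 2 / a ^ 2 + q 1 ^ 2 / b ^ 2 = 1 := by
  obtain ⟨h, h2, h3⟩ := hq
  have h' : quadric ![a, b, c, c] q = 1 := h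
  simpa [quadric, Fin.sum_univ_succ, h2, h3] using h'

/-- The function on the binding that has the sign of the difference between the principal curvature
along the binding and the double principal curvature. -/
noncomputable def umbilicGap (a b c : ℝ) (q : EuclideanSpace ℝ (Fin 4)) : ℝ :=
  (q 0 / a) ^ 2 * (a ^ 2 - b ^ 2) - (a ^ 2 - c ^ 2)

/-- The principal frames at the points of the binding. -/
theorem exists_principalFrame_bindingEllipse {q : EuclideanSpace ℝ (Fin 4)}
    (hq : q ∈ bindingEllipse a b c) :
    ∃ (t : EuclideanSpace ℝ (Fin 4)) (μ κ G : ℝ), 0 < G ∧ μ - κ = G * umbilicGap a b c q ∧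
      (μ ≤ κ → IsPrincipalFrame (ellipsoidACCB a b c) (normalACCB a b c) q
        ![t, EuclideanSpace.single 2 1, EuclideanSpace.single 3 1] ![μ, κ, κ]) ∧
      (κ ≤ μ → IsPrincipalFrame (ellipsoidACCB a b c) (normalACCB a b c) q
        ![EuclideanSpace.single 2 1, EuclideanSpace.single 3 1, t] ![κ, κ, μ]) := by
  have hc : 0 < c := hb.trans hbc
  have ha : 0 < a := hc.trans hca
  have h1 := bindingEllipse_eq hq
  obtain ⟨hE, h2, h3⟩ := hq
  have hx : invSqDiag ![a, b, c, c] q ≠ 0 := invSqDiag_ne_zero_of_mem hE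
  have hpos : 0 < ‖invSqDiag ![a, b, c, c] q‖⁻¹ := inv_pos.2 (norm_pos_iff.2 hx)
  set x := invSqDiag ![a, b, c, c] q with hxdef
  have x0 : x 0 = q 0 / a ^ 2 := rfl
  have x1 : x 1 = q 1 / b ^ 2 := rfl
  have x2 : x 2 = 0 := by simp [hxdef, h2]
  have x3 : x 3 = 0 := by simp [hxdef, h3]
  have hn : 0 < x 0 ^ 2 + x 1 ^ 2 := by
    rw [x0, x1]
    by_contra! hcon
    have e0 : q 0 / a ^ 2 = 0 := by nlinarith [sq_nonneg (q 0 / a ^ 2), sq_nonneg (q 1 / b ^ 2)]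
    have e1 : q 1 / b ^ 2 = 0 := by nlinarith [sq_nonneg (q 0 / a ^ 2), sq_nonneg (q 1 / b ^ 2)]
    have e0' : q 0 = 0 := (div_eq_zero_iff.1 e0).resolve_right (by positivity)
    have e1' : q 1 = 0 := (div_eq_zero_iff.1 e1).resolve_right (by positivity)
    simp [e0', e1'] at h1
  -- The direction of the binding: the normal, which has no `z, w` components here, turned by a
  -- right angle.
  let t : EuclideanSpace ℝ (Fin 4) := !₂[-x 1, x 0, 0, 0]
  have ht : t ≠ 0 := fun h => by
    have e0 : -x 1 = 0 := congrArg (fun y : EuclideanSpace ℝ (Fin 4) => y 0) h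
    have e1 : x 0 = 0 := congrArg (fun y : EuclideanSpace ℝ (Fin 4) => y 1) h
    have e0' : x 1 = 0 := by linarith
    simp [e0', e1] at hn
  -- With `A` the diagonal operator, `l = ⟪A t, t⟫ / |t|²` and `k = ⟪A t, x⟫ / |x|²`, the components
  -- of `A t` in the orthogonal basis `t, x` of the `(x, y)`-plane.
  let l : ℝ := (x 0 ^ 2 / b ^ 2 + x 1 ^ 2 / a ^ 2) / (x 0 ^ 2 + x 1 ^ 2)
  let k : ℝ := x 0 * x 1 * (1 / b ^ 2 - 1 / a ^ 2) / (x 0 ^ 2 + x 1 ^ 2)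
  have hxt : inner ℝ x t = 0 := by
    rw [PiLp.inner_apply]
    simp [Fin.sum_univ_succ, t]
    ring
  have hxs2 : inner ℝ x (EuclideanSpace.single (2 : Fin 4) (1 : ℝ)) = 0 := by
    rw [EuclideanSpace.inner_single_right]; simp [x2]
  have hxs3 : inner ℝ x (EuclideanSpace.single (3 : Fin 4) (1 : ℝ)) = 0 := by
    rw [EuclideanSpace.inner_single_right]; simp [x3]
  have hts2 : inner ℝ t (EuclideanSpace.single (2 : Fin 4) (1 : ℝ)) = 0 := by
    rw [EuclideanSpace.inner_single_right]; simp [t]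
  have hts3 : inner ℝ t (EuclideanSpace.single (3 : Fin 4) (1 : ℝ)) = 0 := by
    rw [EuclideanSpace.inner_single_right]; simp [t]
  have hs23 : inner ℝ (EuclideanSpace.single (2 : Fin 4) (1 : ℝ))
      (EuclideanSpace.single (3 : Fin 4) (1 : ℝ)) = 0 := by
    rw [EuclideanSpace.inner_single_right]; simp
  have hAt : invSqDiag ![a, b, c, c] t = l • t + k • x := by
    ext i
    fin_cases i
    · simp [t, l, k]; field_simp; ring
    · simp [t, l, k]; field_simp; ring
    · simp [t, x2]
    · simp [t, x3]
  have Dt := neg_fderiv_innerNormal_eq_smul hx hxt hAt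
  have D2 := neg_fderiv_innerNormal_eq_smul (l := (c ^ 2)⁻¹) (k := 0) hx hxs2 (by
    ext i; fin_cases i <;> simp)
  have D3 := neg_fderiv_innerNormal_eq_smul (l := (c ^ 2)⁻¹) (k := 0) hx hxs3 (by
    ext i; fin_cases i <;> simp)
  have hne : ∀ i : Fin 4, EuclideanSpace.single i (1 : ℝ) ≠ 0 := fun i => by simp
  have li1 : LinearIndependent ℝ ![t, EuclideanSpace.single 2 1, EuclideanSpace.single 3 1] := by
    refine linearIndependent_of_ne_zero_of_inner_eq_zero (𝕜 := ℝ) (fun i => ?_) fun i j hij => ?_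
    · fin_cases i
      · exact ht
      · exact hne 2
      · exact hne 3
    · fin_cases i <;> fin_cases j <;>
        first
        | exact absurd rfl hij
        | exact hts2
        | exact hts3
        | exact hs23
        | exact (real_inner_comm _ _).trans hts2
        | exact (real_inner_comm _ _).trans hts3
        | exact (real_inner_comm _ _).trans hs23
  have li2 : LinearIndependent ℝ ![EuclideanSpace.single 2 1, EuclideanSpace.single 3 1, t] := by
    have := li1.comp ![1, 2, 0] (by decide)
    convert this using 1
    ext i
    fin_cases i <;> rfl
  refine ⟨t, ‖x‖⁻¹ * l, ‖x‖⁻¹ * (c ^ 2)⁻¹, ‖x‖⁻¹ / (a ^ 2 * b ^ 2 * c ^ 2 * (x 0 ^ 2 + x 1 ^ 2)),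
    by positivity, ?_, fun hle => ⟨li1, ?_, fun i => ?_, ?_⟩, fun hle => ⟨li2, ?_, fun i => ?_, ?_⟩⟩
  · have hl : l - (c ^ 2)⁻¹ = umbilicGap a b c q / (a ^ 2 * b ^ 2 * c ^ 2 * (x 0 ^ 2 + x 1 ^ 2)) := by
      have hq1 : q 1 ^ 2 = b ^ 2 * (1 - q 0 ^ 2 / a ^ 2) := by
        field_simp at h1 ⊢
        linear_combination h1
      have e : x 0 ^ 2 / b ^ 2 + x 1 ^ 2 / a ^ 2 - (c ^ 2)⁻¹ * (x 0 ^ 2 + x 1 ^ 2) =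
          umbilicGap a b c q / (a ^ 2 * b ^ 2 * c ^ 2) := by
        rw [x0, x1, umbilicGap, div_pow, div_pow, div_pow, hq1]
        field_simp
        ring
      rw [← div_div, ← e]
      simp only [l]
      field_simp
    rw [← mul_sub, hl]
    ring
  · rw [ellipsoidACCB, tangentSpaceAt_ellipsoid hE]
    refine span_eq_orthogonal_singleton li1 hx fun i => ?_
    fin_cases i
    exacts [hxt, hxs2, hxs3]
  · fin_cases i
    exacts [Dt, D2, D3]
  · intro i j hij
    fin_cases i <;> fin_cases j <;> simp at hij ⊢ <;> linarith
  · rw [ellipsoidACCB, tangentSpaceAt_ellipsoid hE]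
    refine span_eq_orthogonal_singleton li2 hx fun i => ?_
    fin_cases i
    exacts [hxs2, hxs3, hxt]
  · fin_cases i
    exacts [D2, D3, Dt]
  · intro i j hij
    fin_cases i <;> fin_cases j <;> simp at hij ⊢ <;> linarith

theorem principalCurvatures_of_mem_bindingEllipse {q : EuclideanSpace ℝ (Fin 4)}
    (hq : q ∈ bindingEllipse a b c) : ∃ μ κ G : ℝ, 0 < G ∧ μ - κ = G * umbilicGap a b c q ∧
      (μ ≤ κ → principalCurvature (ellipsoidACCB a b c) (normalACCB a b c) 0 q = μ ∧
        principalCurvature (ellipsoidACCB a b c) (normalACCB a b c) 1 q = κ ∧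
        principalCurvature (ellipsoidACCB a b c) (normalACCB a b c) 2 q = κ) ∧
      (κ ≤ μ → principalCurvature (ellipsoidACCB a b c) (normalACCB a b c) 0 q = κ ∧
        principalCurvature (ellipsoidACCB a b c) (normalACCB a b c) 1 q = κ ∧
        principalCurvature (ellipsoidACCB a b c) (normalACCB a b c) 2 q = μ) := by
  obtain ⟨t, μ, κ, G, hG, h, h1, h2⟩ := exists_principalFrame_bindingEllipse hb hbc hca hq
  exact ⟨μ, κ, G, hG, h,
    fun hle => ⟨(h1 hle).principalCurvature_eq 0, (h1 hle).principalCurvature_eq 1,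
      (h1 hle).principalCurvature_eq 2⟩,
    fun hle => ⟨(h2 hle).principalCurvature_eq 0, (h2 hle).principalCurvature_eq 1,
      (h2 hle).principalCurvature_eq 2⟩⟩

/-- Whatever the order of `μ` and `κ`, the repeated value `κ` occupies index `1` and one of the
indices `0`, `2`. -/
theorem notMem_regularSet_of_mem_bindingEllipse {q : EuclideanSpace ℝ (Fin 4)}
    (hq : q ∈ bindingEllipse a b c) :
    q ∉ regularSet (ellipsoidACCB a b c) (normalACCB a b c) 1 ∧
    ¬ (q ∈ regularSet (ellipsoidACCB a b c) (normalACCB a b c) 0 ∧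
      q ∈ regularSet (ellipsoidACCB a b c) (normalACCB a b c) 2) := by
  obtain ⟨t, μ, κ, G, -, -, h1, h2⟩ := exists_principalFrame_bindingEllipse hb hbc hca hq
  rcases le_total μ κ with hle | hle
  · have h := h1 hle
    exact ⟨fun hr => absurd ((h.mem_regularSet_iff hq.1 1).1 hr 2 rfl) (by decide),
      fun hr => absurd ((h.mem_regularSet_iff hq.1 2).1 hr.2 1 rfl) (by decide)⟩
  · have h := h2 hle
    exact ⟨fun hr => absurd ((h.mem_regularSet_iff hq.1 1).1 hr 0 rfl) (by decide),
      fun hr => absurd ((h.mem_regularSet_iff hq.1 0).1 hr.1 1 rfl) (by decide)⟩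

theorem regularSet_one_eq :
    regularSet (ellipsoidACCB a b c) (normalACCB a b c) 1 =
      ellipsoidACCB a b c \ bindingEllipse a b c := by
  ext q
  refine ⟨fun h => ⟨h.1, fun h0 => (notMem_regularSet_of_mem_bindingEllipse hb hbc hca h0).1 h⟩,
    fun h => ?_⟩
  obtain ⟨θ, hθ⟩ := exists_mem_ellipsoidPage h.1
  exact (principalSpaces_of_mem_page_diff hb hbc hca ⟨hθ, h.2⟩).2.2.2.1

/-- At a partially umbilic point one extreme curvature is still simple, so neither regular set alone
avoids the binding, only their intersection. -/
theorem regularSet_zero_inter_two_eq :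
    regularSet (ellipsoidACCB a b c) (normalACCB a b c) 0 ∩
      regularSet (ellipsoidACCB a b c) (normalACCB a b c) 2 =
      ellipsoidACCB a b c \ bindingEllipse a b c := by
  ext q
  refine ⟨fun h => ⟨h.1.1, fun h0 => (notMem_regularSet_of_mem_bindingEllipse hb hbc hca h0).2 h⟩,
    fun h => ?_⟩
  obtain ⟨θ, hθ⟩ := exists_mem_ellipsoidPage h.1
  have := principalSpaces_of_mem_page_diff hb hbc hca ⟨hθ, h.2⟩
  exact ⟨this.2.2.1, this.2.2.2.2.1⟩

theorem mem_bindingEllipse_of_principalCurvature_eq {q : EuclideanSpace ℝ (Fin 4)}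
    (hq : q ∈ ellipsoidACCB a b c)
    (h : principalCurvature (ellipsoidACCB a b c) (normalACCB a b c) 0 q =
        principalCurvature (ellipsoidACCB a b c) (normalACCB a b c) 1 q ∨
      principalCurvature (ellipsoidACCB a b c) (normalACCB a b c) 1 q =
        principalCurvature (ellipsoidACCB a b c) (normalACCB a b c) 2 q) :
    q ∈ bindingEllipse a b c := by
  by_contra h0
  obtain ⟨θ, hθ⟩ := exists_mem_ellipsoidPage hq
  obtain ⟨h1, h2, -⟩ := principalSpaces_of_mem_page_diff hb hbc hca ⟨hθ, h0⟩
  rcases h with h | h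
  · exact h1.ne h
  · exact h2.ne h

/-- Coincidences of curvatures occur only on the binding, where `umbilicGap` has the sign of `μ -
κ`. The cases zero, positive and negative give this set and the two partially umbilic sets below. -/
theorem umbilicSet_eq :
    umbilicSet (ellipsoidACCB a b c) (normalACCB a b c) =
      {q | q ∈ bindingEllipse a b c ∧ umbilicGap a b c q = 0} := by
  ext q
  constructor
  · rintro ⟨hq, h1, h2⟩
    have h0 := mem_bindingEllipse_of_principalCurvature_eq hb hbc hca hq (Or.inl h1)
    obtain ⟨μ, κ, G, hG, h, hl, hr⟩ := principalCurvatures_of_mem_bindingEllipse hb hbc hca h0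
    refine ⟨h0, ?_⟩
    have : μ = κ := by
      rcases le_total μ κ with hle | hle
      · obtain ⟨e0, e1, e2⟩ := hl hle
        linarith
      · obtain ⟨e0, e1, e2⟩ := hr hle
        linarith
    exact (mul_eq_zero.1 (h.symm.trans (by linarith))).resolve_left hG.ne'
  · rintro ⟨h0, hg⟩
    obtain ⟨μ, κ, G, hG, h, hl, hr⟩ := principalCurvatures_of_mem_bindingEllipse hb hbc hca h0
    rw [hg, mul_zero] at h
    obtain ⟨e0, e1, e2⟩ := hl (by linarith)
    exact ⟨h0.1, by linarith, by linarith⟩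

theorem partiallyUmbilicSet12_eq :
    partiallyUmbilicSet12 (ellipsoidACCB a b c) (normalACCB a b c) =
      {q | q ∈ bindingEllipse a b c ∧ 0 < umbilicGap a b c q} := by
  ext q
  constructor
  · rintro ⟨hq, h1, h2⟩
    have h0 := mem_bindingEllipse_of_principalCurvature_eq hb hbc hca hq (Or.inl h1)
    obtain ⟨μ, κ, G, hG, h, hl, hr⟩ := principalCurvatures_of_mem_bindingEllipse hb hbc hca h0
    refine ⟨h0, ?_⟩
    have : κ < μ := by
      rcases le_total μ κ with hle | hle
      · obtain ⟨e0, e1, e2⟩ := hl hle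
        linarith
      · obtain ⟨e0, e1, e2⟩ := hr hle
        linarith
    exact pos_of_mul_pos_right (h ▸ sub_pos.2 this) hG.le
  · rintro ⟨h0, hg⟩
    obtain ⟨μ, κ, G, hG, h, hl, hr⟩ := principalCurvatures_of_mem_bindingEllipse hb hbc hca h0
    have := mul_pos hG hg
    obtain ⟨e0, e1, e2⟩ := hr (by linarith)
    exact ⟨h0.1, by linarith, by linarith⟩

theorem partiallyUmbilicSet23_eq :
    partiallyUmbilicSet23 (ellipsoidACCB a b c) (normalACCB a b c) =
      {q | q ∈ bindingEllipse a b c ∧ umbilicGap a b c q < 0} := by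
  ext q
  constructor
  · rintro ⟨hq, h1, h2⟩
    have h0 := mem_bindingEllipse_of_principalCurvature_eq hb hbc hca hq (Or.inr h2)
    obtain ⟨μ, κ, G, hG, h, hl, hr⟩ := principalCurvatures_of_mem_bindingEllipse hb hbc hca h0
    refine ⟨h0, ?_⟩
    have : μ < κ := by
      rcases le_total μ κ with hle | hle
      · obtain ⟨e0, e1, e2⟩ := hl hle
        linarith
      · obtain ⟨e0, e1, e2⟩ := hr hle
        linarith
    exact (pos_iff_neg_of_mul_neg (h ▸ sub_neg.2 this)).1 hG
  · rintro ⟨h0, hg⟩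
    obtain ⟨μ, κ, G, hG, h, hl, hr⟩ := principalCurvatures_of_mem_bindingEllipse hb hbc hca h0
    have := mul_neg_of_pos_of_neg hG hg
    obtain ⟨e0, e1, e2⟩ := hl (by linarith)
    exact ⟨h0.1, by linarith, by linarith⟩

end

/-! ### Umbilic points and the arcs of partially umbilic points -/

theorem pos_of_isPreconnected {X : Type*} [TopologicalSpace X] {C : Set X} (hC : IsPreconnected C)
    {f : X → ℝ} (hf : ContinuousOn f C) (h0 : ∀ x ∈ C, f x ≠ 0) {x y : X} (hx : x ∈ C) (hy : y ∈ C)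
    (hfx : 0 < f x) : 0 < f y := by
  by_contra! hcon
  obtain ⟨z, hz, hz0⟩ := hC.intermediate_value hy hx hf ⟨hcon, hfx.le⟩
  exact h0 z hz hz0

theorem ncard_four {X : Type*} {x y z w : X} (h1 : x ≠ y) (h2 : x ≠ z) (h3 : x ≠ w) (h4 : y ≠ z)
    (h5 : y ≠ w) (h6 : z ≠ w) : ({x, y, z, w} : Set X).ncard = 4 := by
  rw [ncard_insert_of_notMem (by simp [h1, h2, h3]), ncard_insert_of_notMem (by simp [h4, h5]),
    ncard_pair h6]

section

variable {a b c u₀ : ℝ}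

theorem ellipsePoint_zero (u : ℝ) : ellipsePoint a b u 0 = a * Real.cos u := rfl
theorem ellipsePoint_one (u : ℝ) : ellipsePoint a b u 1 = b * Real.sin u := rfl

theorem continuous_ellipsePoint : Continuous (ellipsePoint a b) := by
  refine (PiLp.continuous_toLp 2 _).comp (continuous_pi fun i => ?_)
  fin_cases i
  · exact continuous_const.mul Real.continuous_cos
  · exact continuous_const.mul Real.continuous_sin
  · exact continuous_const
  · exact continuous_const

theorem continuous_umbilicGap : Continuous (umbilicGap a b c) := by
  unfold umbilicGap
  fun_prop

theorem umbilicGap_ellipsePoint_eq (ha : a ≠ 0) (u : ℝ) :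
    umbilicGap a b c (ellipsePoint a b u) = Real.cos u ^ 2 * (a ^ 2 - b ^ 2) - (a ^ 2 - c ^ 2) := by
  rw [umbilicGap, ellipsePoint_zero, mul_div_cancel_left₀ _ ha]

/-- It rests on `cos² u - cos² u₀ = sin (u₀ - u) sin (u₀ + u)`; in factored form the sign on each
arc is visible. -/
theorem umbilicGap_ellipsePoint (ha : a ≠ 0)
    (hu : Real.cos u₀ ^ 2 * (a ^ 2 - b ^ 2) = a ^ 2 - c ^ 2) (u : ℝ) :
    umbilicGap a b c (ellipsePoint a b u) =
      (a ^ 2 - b ^ 2) * (Real.sin (u₀ - u) * Real.sin (u₀ + u)) := by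
  rw [umbilicGap_ellipsePoint_eq ha, Real.sin_sub, Real.sin_add]
  linear_combination hu - (a ^ 2 - b ^ 2) * (Real.cos u ^ 2 * Real.sin_sq_add_cos_sq u₀
    - Real.cos u₀ ^ 2 * Real.sin_sq_add_cos_sq u)

theorem ellipsePoint_mem_bindingEllipse (ha : a ≠ 0) (hb : b ≠ 0) (u : ℝ) :
    ellipsePoint a b u ∈ bindingEllipse a b c := by
  refine ⟨?_, rfl, rfl⟩
  change quadric ![a, b, c, c] (ellipsePoint a b u) = 1
  simp [quadric, Fin.sum_univ_succ, ellipsePoint]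
  field_simp
  exact Real.cos_sq_add_sin_sq u

/-- The parameter is the argument of the unit complex number `q 0 / a + i q 1 / b`, moved by
periodicity into a window with a start `u₁` of free choice. -/
theorem exists_eq_ellipsePoint (ha : a ≠ 0) (hb : b ≠ 0) {q : EuclideanSpace ℝ (Fin 4)}
    (hq : q ∈ bindingEllipse a b c) (u₁ : ℝ) :
    ∃ u ∈ Ico u₁ (u₁ + 2 * Real.pi), q = ellipsePoint a b u := by
  have h := bindingEllipse_eq hq
  have hz : ‖(⟨q 0 / a, q 1 / b⟩ : ℂ)‖ = 1 := by
    rw [Complex.norm_eq_sqrt_sq_add_sq]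
    simp only [div_pow]
    rw [h, Real.sqrt_one]
  have h1 := Complex.norm_mul_cos_arg (⟨q 0 / a, q 1 / b⟩ : ℂ)
  have h2 := Complex.norm_mul_sin_arg (⟨q 0 / a, q 1 / b⟩ : ℂ)
  rw [hz, one_mul] at h1 h2
  have hper : Function.Periodic (ellipsePoint a b) (2 * Real.pi) := fun u => by
    simp [ellipsePoint]
  obtain ⟨y, hy, he⟩ := hper.exists_mem_Ico Real.two_pi_pos (Complex.arg ⟨q 0 / a, q 1 / b⟩) u₁
  refine ⟨y, hy, he ▸ ?_⟩
  ext i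
  fin_cases i
  · simp only [Fin.zero_eta, ellipsePoint_zero, h1]
    field_simp
  · simp only [Fin.mk_one, ellipsePoint_one, h2]
    field_simp
  · exact hq.2.1
  · exact hq.2.2

/-! ### The arcs of the binding between consecutive umbilic points. -/

section Arcs

variable (ha : 0 < a) (hb : 0 < b) (hab : b < a) (h0 : 0 < u₀) (h1 : u₀ < Real.pi / 2)
  (hu : Real.cos u₀ ^ 2 * (a ^ 2 - b ^ 2) = a ^ 2 - c ^ 2)

include ha hb hab h0 h1 hu

omit h0 in
-- The sign of `umbilicGap` and the sign of one coordinate together single out an arc among the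
-- four; the separation into components uses nothing else.
theorem arc_right {q : EuclideanSpace ℝ (Fin 4)} (hq : q ∈ ellipsePoint a b '' Ioo (-u₀) u₀) :
    q ∈ bindingEllipse a b c ∧ 0 < umbilicGap a b c q ∧ 0 < q 0 := by
  obtain ⟨u, ⟨hu1, hu2⟩, rfl⟩ := hq
  refine ⟨ellipsePoint_mem_bindingEllipse ha.ne' hb.ne' u, ?_, ?_⟩
  · rw [umbilicGap_ellipsePoint ha.ne' hu]
    have := Real.sin_pos_of_pos_of_lt_pi (x := u₀ - u) (by linarith) (by linarith)
    have := Real.sin_pos_of_pos_of_lt_pi (x := u₀ + u) (by linarith) (by linarith)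
    have : 0 < a ^ 2 - b ^ 2 := by nlinarith
    positivity
  · exact mul_pos ha (Real.cos_pos_of_mem_Ioo ⟨by linarith, by linarith⟩)

omit h1 in
theorem arc_top {q : EuclideanSpace ℝ (Fin 4)}
    (hq : q ∈ ellipsePoint a b '' Ioo u₀ (Real.pi - u₀)) :
    q ∈ bindingEllipse a b c ∧ umbilicGap a b c q < 0 ∧ 0 < q 1 := by
  obtain ⟨u, ⟨hu1, hu2⟩, rfl⟩ := hq
  refine ⟨ellipsePoint_mem_bindingEllipse ha.ne' hb.ne' u, ?_, ?_⟩
  · rw [umbilicGap_ellipsePoint ha.ne' hu]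
    have h3 := Real.sin_neg_of_neg_of_neg_pi_lt (x := u₀ - u) (by linarith) (by linarith)
    have h4 := Real.sin_pos_of_pos_of_lt_pi (x := u₀ + u) (by linarith) (by linarith)
    have h5 : 0 < a ^ 2 - b ^ 2 := by nlinarith
    exact mul_neg_of_pos_of_neg h5 (mul_neg_of_neg_of_pos h3 h4)
  · exact mul_pos hb (Real.sin_pos_of_pos_of_lt_pi (by linarith) (by linarith))

omit ha hb hab h0 h1 hu in
theorem umbilicGap_ellipsePoint_add_pi (ha : a ≠ 0) (u : ℝ) :
    umbilicGap a b c (ellipsePoint a b (u + Real.pi)) = umbilicGap a b c (ellipsePoint a b u) := by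
  rw [umbilicGap_ellipsePoint_eq ha, umbilicGap_ellipsePoint_eq ha, Real.cos_add_pi, neg_sq]

omit h0 in
-- The shift of the parameter by `π` keeps `umbilicGap` and reverses the coordinates, so this is
-- `arc_right` transported.
theorem arc_left {q : EuclideanSpace ℝ (Fin 4)}
    (hq : q ∈ ellipsePoint a b '' Ioo (Real.pi - u₀) (Real.pi + u₀)) :
    q ∈ bindingEllipse a b c ∧ 0 < umbilicGap a b c q ∧ q 0 < 0 := by
  obtain ⟨u, ⟨hu1, hu2⟩, rfl⟩ := hq
  obtain ⟨-, h2, h3⟩ := arc_right ha hb hab h1 hu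
    (mem_image_of_mem _ (show u - Real.pi ∈ Ioo (-u₀) u₀ from ⟨by linarith, by linarith⟩))
  rw [← umbilicGap_ellipsePoint_add_pi ha.ne', sub_add_cancel] at h2
  rw [ellipsePoint_zero, Real.cos_sub_pi] at h3
  exact ⟨ellipsePoint_mem_bindingEllipse ha.ne' hb.ne' u, h2, by rw [ellipsePoint_zero]; linarith⟩

omit h1 in
theorem arc_bottom {q : EuclideanSpace ℝ (Fin 4)}
    (hq : q ∈ ellipsePoint a b '' Ioo (Real.pi + u₀) (2 * Real.pi - u₀)) :
    q ∈ bindingEllipse a b c ∧ umbilicGap a b c q < 0 ∧ q 1 < 0 := by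
  obtain ⟨u, ⟨hu1, hu2⟩, rfl⟩ := hq
  obtain ⟨-, h2, h3⟩ := arc_top ha hb hab h0 hu
    (mem_image_of_mem _ (show u - Real.pi ∈ Ioo u₀ (Real.pi - u₀) from ⟨by linarith, by linarith⟩))
  rw [← umbilicGap_ellipsePoint_add_pi ha.ne', sub_add_cancel] at h2
  rw [ellipsePoint_one, Real.sin_sub_pi] at h3
  exact ⟨ellipsePoint_mem_bindingEllipse ha.ne' hb.ne' u, h2, by rw [ellipsePoint_one]; linarith⟩

omit hab h0 h1 in
theorem four_points {q : EuclideanSpace ℝ (Fin 4)}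
    (hq : q ∈ ({ellipsePoint a b u₀, ellipsePoint a b (Real.pi - u₀),
      ellipsePoint a b (Real.pi + u₀), ellipsePoint a b (-u₀)} : Set _)) :
    q ∈ bindingEllipse a b c ∧ umbilicGap a b c q = 0 := by
  rcases hq with rfl | rfl | rfl | rfl <;>
    refine ⟨ellipsePoint_mem_bindingEllipse ha.ne' hb.ne' _, ?_⟩ <;>
    simp [umbilicGap_ellipsePoint ha.ne' hu]

omit hab h0 h1 hu in
theorem bindingEllipse_cover {q : EuclideanSpace ℝ (Fin 4)} (hq : q ∈ bindingEllipse a b c) :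
    q ∈ ({ellipsePoint a b u₀, ellipsePoint a b (Real.pi - u₀),
      ellipsePoint a b (Real.pi + u₀), ellipsePoint a b (-u₀)} : Set _) ∨
    q ∈ ellipsePoint a b '' Ioo (-u₀) u₀ ∨ q ∈ ellipsePoint a b '' Ioo u₀ (Real.pi - u₀) ∨
    q ∈ ellipsePoint a b '' Ioo (Real.pi - u₀) (Real.pi + u₀) ∨
    q ∈ ellipsePoint a b '' Ioo (Real.pi + u₀) (2 * Real.pi - u₀) := by
  -- The window of parameters starts at one of the four points, so that its ends cut no arc.
  obtain ⟨u, ⟨hu1, hu2⟩, rfl⟩ := exists_eq_ellipsePoint ha.ne' hb.ne' hq (-u₀)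
  simp only [mem_insert_iff, mem_singleton_iff]
  rcases eq_or_lt_of_le hu1 with rfl | h1
  · simp
  rcases lt_trichotomy u u₀ with h2 | rfl | h2
  · exact Or.inr (Or.inl ⟨u, ⟨h1, h2⟩, rfl⟩)
  · simp
  rcases lt_trichotomy u (Real.pi - u₀) with h3 | rfl | h3
  · exact Or.inr (Or.inr (Or.inl ⟨u, ⟨h2, h3⟩, rfl⟩))
  · simp
  rcases lt_trichotomy u (Real.pi + u₀) with h4 | rfl | h4
  · exact Or.inr (Or.inr (Or.inr (Or.inl ⟨u, ⟨h3, h4⟩, rfl⟩)))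
  · simp
  · exact Or.inr (Or.inr (Or.inr (Or.inr ⟨u, ⟨h4, by linarith⟩, rfl⟩)))

theorem setOf_gap_eq_zero :
    {q | q ∈ bindingEllipse a b c ∧ umbilicGap a b c q = 0} =
      {ellipsePoint a b u₀, ellipsePoint a b (Real.pi - u₀),
        ellipsePoint a b (Real.pi + u₀), ellipsePoint a b (-u₀)} := by
  ext q
  refine ⟨fun ⟨hq, hg⟩ => ?_, four_points ha hb hu⟩
  rcases bindingEllipse_cover (u₀ := u₀) ha hb hq with h | h | h | h | h
  · exact h
  · exact absurd hg (arc_right ha hb hab h1 hu h).2.1.ne'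
  · exact absurd hg (arc_top ha hb hab h0 hu h).2.1.ne
  · exact absurd hg (arc_left ha hb hab h1 hu h).2.1.ne'
  · exact absurd hg (arc_bottom ha hb hab h0 hu h).2.1.ne

theorem setOf_gap_pos :
    {q | q ∈ bindingEllipse a b c ∧ 0 < umbilicGap a b c q} =
      ellipsePoint a b '' Ioo (-u₀) u₀ ∪ ellipsePoint a b '' Ioo (Real.pi - u₀) (Real.pi + u₀) := by
  ext q
  constructor
  · rintro ⟨hq, hg⟩
    rcases bindingEllipse_cover (u₀ := u₀) ha hb hq with h | h | h | h | h
    · exact absurd (four_points ha hb hu h).2 hg.ne'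
    · exact Or.inl h
    · exact absurd hg (arc_top ha hb hab h0 hu h).2.1.not_gt
    · exact Or.inr h
    · exact absurd hg (arc_bottom ha hb hab h0 hu h).2.1.not_gt
  · rintro (h | h)
    · exact ⟨(arc_right ha hb hab h1 hu h).1, (arc_right ha hb hab h1 hu h).2.1⟩
    · exact ⟨(arc_left ha hb hab h1 hu h).1, (arc_left ha hb hab h1 hu h).2.1⟩

theorem setOf_gap_neg :
    {q | q ∈ bindingEllipse a b c ∧ umbilicGap a b c q < 0} =
      ellipsePoint a b '' Ioo u₀ (Real.pi - u₀) ∪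
        ellipsePoint a b '' Ioo (Real.pi + u₀) (2 * Real.pi - u₀) := by
  ext q
  constructor
  · rintro ⟨hq, hg⟩
    rcases bindingEllipse_cover (u₀ := u₀) ha hb hq with h | h | h | h | h
    · exact absurd (four_points ha hb hu h).2 hg.ne
    · exact absurd hg (arc_right ha hb hab h1 hu h).2.1.not_gt
    · exact Or.inl h
    · exact absurd hg (arc_left ha hb hab h1 hu h).2.1.not_gt
    · exact Or.inr h
  · rintro (h | h)
    · exact ⟨(arc_top ha hb hab h0 hu h).1, (arc_top ha hb hab h0 hu h).2.1⟩
    · exact ⟨(arc_bottom ha hb hab h0 hu h).1, (arc_bottom ha hb hab h0 hu h).2.1⟩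

omit ha hb hab h0 h1 hu in
/-- An arc that is cut out of `P` by the signs of two functions is a connected component. -/
theorem connectedComponentIn_eq_of_signs {X : Type*} [TopologicalSpace X] {P A : Set X} {f g : X → ℝ}
    (hf : Continuous f) (hg : Continuous g) (hA : IsPreconnected A) (hAP : A ⊆ P)
    (hfP : ∀ x ∈ P, f x ≠ 0) (hgP : ∀ x ∈ P, 0 < f x → g x ≠ 0)
    (hpos : ∀ x ∈ A, 0 < f x ∧ 0 < g x) (hmem : ∀ x ∈ P, 0 < f x → 0 < g x → x ∈ A) {x : X}
    (hx : x ∈ A) : connectedComponentIn P x = A := by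
  refine Subset.antisymm (fun y hy => ?_) (hA.subset_connectedComponentIn hx hAP)
  have hC : IsPreconnected (connectedComponentIn P x) := isPreconnected_connectedComponentIn
  have hsub := connectedComponentIn_subset P x
  have hxC := mem_connectedComponentIn (hAP hx)
  have hfC : ∀ z ∈ connectedComponentIn P x, 0 < f z := fun z hz =>
    pos_of_isPreconnected hC hf.continuousOn (fun w hw => hfP w (hsub hw)) hxC hz (hpos x hx).1
  have hgC := pos_of_isPreconnected hC hg.continuousOn (fun w hw => hgP w (hsub hw) (hfC w hw)) hxC
    hy (hpos x hx).2
  exact hmem y (hsub hy) (hfC y hy) hgC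

/-- `umbilicGap` does not vanish on `P` and separates two pairs of arcs; within the positive pair
the coordinate `x` separates, within the negative pair `y` does. -/
theorem connectedComponentIn_arcs {P : Set (EuclideanSpace ℝ (Fin 4))}
    (hP : P = (ellipsePoint a b '' Ioo (-u₀) u₀ ∪
        ellipsePoint a b '' Ioo (Real.pi - u₀) (Real.pi + u₀)) ∪
      (ellipsePoint a b '' Ioo u₀ (Real.pi - u₀) ∪
        ellipsePoint a b '' Ioo (Real.pi + u₀) (2 * Real.pi - u₀))) :
    connectedComponentIn P '' P =
      {ellipsePoint a b '' Ioo (-u₀) u₀, ellipsePoint a b '' Ioo u₀ (Real.pi - u₀),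
        ellipsePoint a b '' Ioo (Real.pi - u₀) (Real.pi + u₀),
        ellipsePoint a b '' Ioo (Real.pi + u₀) (2 * Real.pi - u₀)} ∧
    (connectedComponentIn P '' P).ncard = 4 := by
  have hr := fun q hq => arc_right ha hb hab h1 hu (q := q) hq
  have ht := fun q hq => arc_top ha hb hab h0 hu (q := q) hq
  have hl := fun q hq => arc_left ha hb hab h1 hu (q := q) hq
  have hbt := fun q hq => arc_bottom ha hb hab h0 hu (q := q) hq
  have hpre : ∀ x y : ℝ, IsPreconnected (ellipsePoint a b '' Ioo x y) := fun x y =>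
    isPreconnected_Ioo.image _ continuous_ellipsePoint.continuousOn
  have p1 := hpre (-u₀) u₀
  have p2 := hpre u₀ (Real.pi - u₀)
  have p3 := hpre (Real.pi - u₀) (Real.pi + u₀)
  have p4 := hpre (Real.pi + u₀) (2 * Real.pi - u₀)
  have ne1 : (ellipsePoint a b '' Ioo (-u₀) u₀).Nonempty :=
    (nonempty_Ioo.2 (by linarith)).image _
  have ne2 : (ellipsePoint a b '' Ioo u₀ (Real.pi - u₀)).Nonempty :=
    (nonempty_Ioo.2 (by linarith)).image _
  have ne3 : (ellipsePoint a b '' Ioo (Real.pi - u₀) (Real.pi + u₀)).Nonempty :=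
    (nonempty_Ioo.2 (by linarith)).image _
  have ne4 : (ellipsePoint a b '' Ioo (Real.pi + u₀) (2 * Real.pi - u₀)).Nonempty :=
    (nonempty_Ioo.2 (by linarith)).image _
  have hG : Continuous (umbilicGap a b c) := continuous_umbilicGap
  have hX : Continuous fun q : EuclideanSpace ℝ (Fin 4) => q 0 := by fun_prop
  have hY : Continuous fun q : EuclideanSpace ℝ (Fin 4) => q 1 := by fun_prop
  -- From here on only the sign tables, preconnectedness and nonemptiness of the arcs matter.
  generalize ellipsePoint a b '' Ioo (-u₀) u₀ = A₁ at *
  generalize ellipsePoint a b '' Ioo u₀ (Real.pi - u₀) = A₂ at *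
  generalize ellipsePoint a b '' Ioo (Real.pi - u₀) (Real.pi + u₀) = A₃ at *
  generalize ellipsePoint a b '' Ioo (Real.pi + u₀) (2 * Real.pi - u₀) = A₄ at *
  subst hP
  have hgap : ∀ q ∈ (A₁ ∪ A₃) ∪ (A₂ ∪ A₄), umbilicGap a b c q ≠ 0 := by
    rintro q ((h | h) | (h | h))
    exacts [(hr q h).2.1.ne', (hl q h).2.1.ne', (ht q h).2.1.ne, (hbt q h).2.1.ne]
  have c1 : ∀ q ∈ A₁, connectedComponentIn ((A₁ ∪ A₃) ∪ (A₂ ∪ A₄)) q = A₁ := fun q hq => by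
    refine connectedComponentIn_eq_of_signs hG hX p1 (fun x hx => Or.inl (Or.inl hx)) hgap ?_
      (fun x hx => (hr x hx).2) ?_ hq
    · rintro x ((h | h) | (h | h)) hx
      exacts [(hr x h).2.2.ne', (hl x h).2.2.ne, absurd hx (ht x h).2.1.not_gt,
        absurd hx (hbt x h).2.1.not_gt]
    · rintro x ((h | h) | (h | h)) hx hx'
      exacts [h, absurd hx' (hl x h).2.2.not_gt, absurd hx (ht x h).2.1.not_gt,
        absurd hx (hbt x h).2.1.not_gt]
  have c3 : ∀ q ∈ A₃, connectedComponentIn ((A₁ ∪ A₃) ∪ (A₂ ∪ A₄)) q = A₃ := fun q hq => by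
    refine connectedComponentIn_eq_of_signs hG hX.neg p3 (fun x hx => Or.inl (Or.inr hx)) hgap ?_
      (fun x hx => ⟨(hl x hx).2.1, neg_pos.2 (hl x hx).2.2⟩) ?_ hq
    · rintro x ((h | h) | (h | h)) hx
      exacts [neg_ne_zero.2 (hr x h).2.2.ne', neg_ne_zero.2 (hl x h).2.2.ne,
        absurd hx (ht x h).2.1.not_gt, absurd hx (hbt x h).2.1.not_gt]
    · rintro x ((h | h) | (h | h)) hx hx'
      exacts [absurd (neg_pos.1 hx') (hr x h).2.2.not_gt, h, absurd hx (ht x h).2.1.not_gt,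
        absurd hx (hbt x h).2.1.not_gt]
  have c2 : ∀ q ∈ A₂, connectedComponentIn ((A₁ ∪ A₃) ∪ (A₂ ∪ A₄)) q = A₂ := fun q hq => by
    refine connectedComponentIn_eq_of_signs hG.neg hY p2 (fun x hx => Or.inr (Or.inl hx))
      (fun x hx => neg_ne_zero.2 (hgap x hx)) ?_
      (fun x hx => ⟨neg_pos.2 (ht x hx).2.1, (ht x hx).2.2⟩) ?_ hq
    · rintro x ((h | h) | (h | h)) hx
      exacts [absurd (neg_pos.1 hx) (hr x h).2.1.not_gt, absurd (neg_pos.1 hx) (hl x h).2.1.not_gt,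
        (ht x h).2.2.ne', (hbt x h).2.2.ne]
    · rintro x ((h | h) | (h | h)) hx hx'
      exacts [absurd (neg_pos.1 hx) (hr x h).2.1.not_gt, absurd (neg_pos.1 hx) (hl x h).2.1.not_gt,
        h, absurd hx' (hbt x h).2.2.not_gt]
  have c4 : ∀ q ∈ A₄, connectedComponentIn ((A₁ ∪ A₃) ∪ (A₂ ∪ A₄)) q = A₄ := fun q hq => by
    refine connectedComponentIn_eq_of_signs hG.neg hY.neg p4 (fun x hx => Or.inr (Or.inr hx))
      (fun x hx => neg_ne_zero.2 (hgap x hx)) ?_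
      (fun x hx => ⟨neg_pos.2 (hbt x hx).2.1, neg_pos.2 (hbt x hx).2.2⟩) ?_ hq
    · rintro x ((h | h) | (h | h)) hx
      exacts [absurd (neg_pos.1 hx) (hr x h).2.1.not_gt, absurd (neg_pos.1 hx) (hl x h).2.1.not_gt,
        neg_ne_zero.2 (ht x h).2.2.ne', neg_ne_zero.2 (hbt x h).2.2.ne]
    · rintro x ((h | h) | (h | h)) hx hx'
      exacts [absurd (neg_pos.1 hx) (hr x h).2.1.not_gt, absurd (neg_pos.1 hx) (hl x h).2.1.not_gt,
        absurd (neg_pos.1 hx') (ht x h).2.2.not_gt, h]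
  have hset : connectedComponentIn ((A₁ ∪ A₃) ∪ (A₂ ∪ A₄)) '' ((A₁ ∪ A₃) ∪ (A₂ ∪ A₄)) =
      {A₁, A₂, A₃, A₄} := by
    have him : ∀ {A : Set (EuclideanSpace ℝ (Fin 4))}
        {f : EuclideanSpace ℝ (Fin 4) → Set (EuclideanSpace ℝ (Fin 4))}, A.Nonempty →
        (∀ q ∈ A, f q = A) → f '' A = {A} := fun hA hf => by
      rw [image_congr hf, hA.image_const]
    rw [image_union, image_union, image_union, him ne1 c1, him ne2 c2, him ne3 c3, him ne4 c4]
    ext A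
    simp only [mem_union, mem_insert_iff, mem_singleton_iff]
    tauto
  refine ⟨hset, hset ▸ ?_⟩
  obtain ⟨q₁, hq₁⟩ := ne1
  obtain ⟨q₂, hq₂⟩ := ne2
  obtain ⟨q₃, hq₃⟩ := ne3
  refine ncard_four ?_ ?_ ?_ ?_ ?_ ?_ <;> rintro rfl
  · exact (hr q₁ hq₁).2.1.not_gt (ht q₁ hq₁).2.1
  · exact (hr q₁ hq₁).2.2.not_gt (hl q₁ hq₁).2.2
  · exact (hr q₁ hq₁).2.1.not_gt (hbt q₁ hq₁).2.1
  · exact (hl q₂ hq₂).2.1.not_gt (ht q₂ hq₂).2.1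
  · exact (ht q₂ hq₂).2.2.not_gt (hbt q₂ hq₂).2.2
  · exact (hl q₃ hq₃).2.1.not_gt (hbt q₃ hq₃).2.1

omit hab hu in
theorem ncard_four_points :
    ({ellipsePoint a b u₀, ellipsePoint a b (Real.pi - u₀),
      ellipsePoint a b (Real.pi + u₀), ellipsePoint a b (-u₀)} : Set _).ncard = 4 := by
  have hc : 0 < a * Real.cos u₀ := mul_pos ha (Real.cos_pos_of_mem_Ioo ⟨by linarith, h1⟩)
  have hs : 0 < b * Real.sin u₀ :=
    mul_pos hb (Real.sin_pos_of_pos_of_lt_pi h0 (by linarith [Real.pi_pos]))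
  have key : ∀ {u v : ℝ}, ellipsePoint a b u = ellipsePoint a b v →
      a * Real.cos u = a * Real.cos v ∧ b * Real.sin u = b * Real.sin v := fun h =>
    ⟨congrArg (fun y : EuclideanSpace ℝ (Fin 4) => y 0) h,
      congrArg (fun y : EuclideanSpace ℝ (Fin 4) => y 1) h⟩
  have c2 : Real.cos (Real.pi + u₀) = -Real.cos u₀ := by rw [add_comm, Real.cos_add_pi]
  have s2 : Real.sin (Real.pi + u₀) = -Real.sin u₀ := by rw [add_comm, Real.sin_add_pi]
  refine ncard_four ?_ ?_ ?_ ?_ ?_ ?_ <;> intro h <;> obtain ⟨k1, k2⟩ := key h <;>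
    simp only [Real.cos_pi_sub, Real.sin_pi_sub, c2, s2, Real.cos_neg, Real.sin_neg] at k1 k2 <;>
    linarith

end Arcs

/-- The umbilic set and the components of the partially umbilic set. -/
theorem umbilic_structure (hb : 0 < b) (hbc : b < c) (hca : c < a) :
    umbilicSet (ellipsoidACCB a b c) (normalACCB a b c) = {q | ∃ u : ℝ,
      Real.cos u ^ 2 = (a ^ 2 - c ^ 2) / (a ^ 2 - b ^ 2) ∧ q = ellipsePoint a b u} ∧
    umbilicSet (ellipsoidACCB a b c) (normalACCB a b c) ⊆ bindingEllipse a b c ∧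
    (umbilicSet (ellipsoidACCB a b c) (normalACCB a b c)).ncard = 4 ∧
    partiallyUmbilicSet (ellipsoidACCB a b c) (normalACCB a b c) =
      bindingEllipse a b c \ umbilicSet (ellipsoidACCB a b c) (normalACCB a b c) ∧
    ∃ u₀ ∈ Ioo 0 (Real.pi / 2),
      Real.cos u₀ = √((a ^ 2 - c ^ 2) / (a ^ 2 - b ^ 2)) ∧
      umbilicSet (ellipsoidACCB a b c) (normalACCB a b c) =
        {ellipsePoint a b u₀, ellipsePoint a b (Real.pi - u₀),
          ellipsePoint a b (Real.pi + u₀), ellipsePoint a b (-u₀)} ∧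
      partiallyUmbilicSet23 (ellipsoidACCB a b c) (normalACCB a b c) =
        ellipsePoint a b '' Ioo u₀ (Real.pi - u₀) ∪
          ellipsePoint a b '' Ioo (Real.pi + u₀) (2 * Real.pi - u₀) ∧
      partiallyUmbilicSet12 (ellipsoidACCB a b c) (normalACCB a b c) =
        ellipsePoint a b '' Ioo (-u₀) u₀ ∪
          ellipsePoint a b '' Ioo (Real.pi - u₀) (Real.pi + u₀) ∧
      connectedComponentIn (partiallyUmbilicSet (ellipsoidACCB a b c) (normalACCB a b c)) ''
          partiallyUmbilicSet (ellipsoidACCB a b c) (normalACCB a b c) =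
        {ellipsePoint a b '' Ioo (-u₀) u₀, ellipsePoint a b '' Ioo u₀ (Real.pi - u₀),
          ellipsePoint a b '' Ioo (Real.pi - u₀) (Real.pi + u₀),
          ellipsePoint a b '' Ioo (Real.pi + u₀) (2 * Real.pi - u₀)} ∧
      (connectedComponentIn (partiallyUmbilicSet (ellipsoidACCB a b c) (normalACCB a b c)) ''
          partiallyUmbilicSet (ellipsoidACCB a b c) (normalACCB a b c)).ncard = 4 := by
  have hc : 0 < c := hb.trans hbc
  have ha : 0 < a := hc.trans hca
  have hab : b < a := hbc.trans hca
  have hab2 : 0 < a ^ 2 - b ^ 2 := by nlinarith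
  have hac2 : 0 < a ^ 2 - c ^ 2 := by nlinarith
  have hbc2 : 0 < c ^ 2 - b ^ 2 := by nlinarith
  have hρ0 : 0 < (a ^ 2 - c ^ 2) / (a ^ 2 - b ^ 2) := div_pos hac2 hab2
  have hρ1 : (a ^ 2 - c ^ 2) / (a ^ 2 - b ^ 2) < 1 := by rw [div_lt_one hab2]; linarith
  have hd0 : 0 < √((a ^ 2 - c ^ 2) / (a ^ 2 - b ^ 2)) := Real.sqrt_pos.2 hρ0
  have hd1 : √((a ^ 2 - c ^ 2) / (a ^ 2 - b ^ 2)) < 1 := by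
    rw [Real.sqrt_lt' one_pos]; simpa using hρ1
  have hcos := Real.cos_arccos (by linarith) hd1.le
  have h0 := Real.arccos_pos.2 hd1
  have h1 := Real.arccos_lt_pi_div_two.2 hd0
  generalize Real.arccos √((a ^ 2 - c ^ 2) / (a ^ 2 - b ^ 2)) = u₀ at hcos h0 h1
  have hu : Real.cos u₀ ^ 2 * (a ^ 2 - b ^ 2) = a ^ 2 - c ^ 2 := by
    rw [hcos, Real.sq_sqrt hρ0.le, div_mul_cancel₀ _ hab2.ne']
  have hU := umbilicSet_eq hb hbc hca
  have h12 := partiallyUmbilicSet12_eq hb hbc hca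
  have h23 := partiallyUmbilicSet23_eq hb hbc hca
  have hU' := hU.trans (setOf_gap_eq_zero ha hb hab h0 h1 hu)
  have h12' := h12.trans (setOf_gap_pos ha hb hab h0 h1 hu)
  have h23' := h23.trans (setOf_gap_neg ha hb hab h0 h1 hu)
  have hcomp := connectedComponentIn_arcs ha hb hab h0 h1 hu (P := partiallyUmbilicSet
    (ellipsoidACCB a b c) (normalACCB a b c)) (by rw [partiallyUmbilicSet, h12', h23'])
  refine ⟨?_, ?_, ?_, ?_, u₀, ⟨h0, h1⟩, hcos, hU', h23', h12', hcomp.1, hcomp.2⟩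
  · rw [hU]
    ext q
    constructor
    · rintro ⟨hq, hg⟩
      obtain ⟨u, -, rfl⟩ := exists_eq_ellipsePoint ha.ne' hb.ne' hq 0
      rw [umbilicGap_ellipsePoint_eq ha.ne'] at hg
      exact ⟨u, by rw [eq_div_iff hab2.ne']; linarith, rfl⟩
    · rintro ⟨u, h, rfl⟩
      refine ⟨ellipsePoint_mem_bindingEllipse ha.ne' hb.ne' u, ?_⟩
      rw [umbilicGap_ellipsePoint_eq ha.ne', h, div_mul_cancel₀ _ hab2.ne', sub_self]
  · rw [hU]
    exact fun q hq => hq.1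
  · rw [hU', ncard_four_points ha hb h0 h1]
  · rw [partiallyUmbilicSet, h12, h23, hU]
    ext q
    constructor
    · rintro (⟨h, hg⟩ | ⟨h, hg⟩)
      exacts [⟨h, fun h' => hg.ne' h'.2⟩, ⟨h, fun h' => hg.ne h'.2⟩]
    · rintro ⟨h, hg⟩
      rcases lt_trichotomy (umbilicGap a b c q) 0 with h' | h' | h'
      exacts [Or.inr ⟨h, h'⟩, absurd ⟨h, h'⟩ hg, Or.inl ⟨h, h'⟩]

end

/-! ### Leaves -/

theorem hasDerivAt_coord {n : ℕ} {γ : ℝ → EuclideanSpace ℝ (Fin n)} (hγ : ContDiff ℝ 1 γ) (t : ℝ)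
    (i : Fin n) : HasDerivAt (fun r => γ r i) (deriv γ t i) t :=
  (EuclideanSpace.proj (𝕜 := ℝ) i).hasFDerivAt.comp_hasDerivAt t
    (hγ.differentiable (by simp) t).hasDerivAt

theorem deriv_mem_tangentSpaceAt {n : ℕ} {S : Set (EuclideanSpace ℝ (Fin n))}
    {γ : ℝ → EuclideanSpace ℝ (Fin n)} (hγ : ContDiff ℝ 1 γ) (hS : ∀ t, γ t ∈ S) (t : ℝ) :
    deriv γ t ∈ tangentSpaceAt S (γ t) := by
  refine Submodule.subset_span ⟨fun r => γ (t + r), ?_, by simp, ?_, Filter.Eventually.of_forall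
    fun r => hS _⟩
  · exact (hγ.comp (contDiff_const.add contDiff_id)).contDiffAt
  · rw [deriv_comp_const_add, add_zero]

theorem eq_of_hasDerivAt_zero {f : ℝ → ℝ} (hf : ∀ t ∈ Icc (0 : ℝ) 1, HasDerivAt f 0 t) {t : ℝ}
    (ht : t ∈ Icc (0 : ℝ) 1) : f t = f 0 :=
  constant_of_has_deriv_right_zero (fun x hx => (hf x hx).continuousAt.continuousWithinAt)
    (fun x hx => (hf x (Ico_subset_Icc_self hx)).hasDerivWithinAt) t ht

theorem quadric_pos {n : ℕ} {s : Fin n → ℝ} (hs : ∀ i, s i ≠ 0) {x : EuclideanSpace ℝ (Fin n)}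
    (hx : x ≠ 0) : 0 < quadric s x := by
  have : ∃ i, x i ≠ 0 := by
    by_contra! h
    exact hx (by ext i; simp [h])
  obtain ⟨i, hi⟩ := this
  refine Finset.sum_pos' (fun j _ => by positivity) ⟨i, Finset.mem_univ i, ?_⟩
  have := hs i
  positivity

/-- The velocity field `(0, 0, -w, z)` of the rotations in the plane of the last two coordinates. -/
noncomputable def rotationField (q : EuclideanSpace ℝ (Fin 4)) : EuclideanSpace ℝ (Fin 4) :=
  !₂[0, 0, -q 3, q 2]

/-- The circle of radius `r` in the plane of the last two coordinates. -/
noncomputable def rotationCircle (x y r t : ℝ) : EuclideanSpace ℝ (Fin 4) :=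
  !₂[x, y, r * Real.cos t, r * Real.sin t]

theorem exists_polar (y z : ℝ) :
    ∃ t : ℝ, √(y ^ 2 + z ^ 2) * Real.cos t = y ∧ √(y ^ 2 + z ^ 2) * Real.sin t = z := by
  have h1 := Complex.norm_mul_cos_arg (⟨y, z⟩ : ℂ)
  have h2 := Complex.norm_mul_sin_arg (⟨y, z⟩ : ℂ)
  rw [Complex.norm_eq_sqrt_sq_add_sq] at h1 h2
  exact ⟨_, h1, h2⟩

theorem eq_rotationCircle {q : EuclideanSpace ℝ (Fin 4)} {x y r t : ℝ} (h0 : q 0 = x)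
    (h1 : q 1 = y) (h2 : r * Real.cos t = q 2) (h3 : r * Real.sin t = q 3) :
    rotationCircle x y r t = q := by
  ext i
  fin_cases i
  exacts [h0.symm, h1.symm, h2, h3]

theorem isCircle_range_rotationCircle {x y r : ℝ} (hr : 0 < r) :
    IsCircle (range (rotationCircle x y r)) := by
  refine ⟨!₂[x, y, 0, 0], EuclideanSpace.single 2 1, EuclideanSpace.single 3 1, r, hr, by simp,
    by simp, by simp [EuclideanSpace.inner_single_right], ?_⟩
  congr 1
  ext t i
  fin_cases i <;> simp [rotationCircle]

/-- The affine angle `m + u * k` allows any arc of the circle to be traversed in unit time, as the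
definition of `leaf` demands. -/
theorem hasDerivAt_rotationCircle (x y r k m t : ℝ) :
    HasDerivAt (fun u => rotationCircle x y r (m + u * k))
      (k • rotationField (rotationCircle x y r (m + t * k))) t := by
  have hl : HasDerivAt (fun u : ℝ => m + u * k) k t := by
    simpa using ((hasDerivAt_id t).mul_const k).const_add m
  refine (PiLp.continuousLinearEquiv 2 ℝ fun _ : Fin 4 => ℝ).symm.hasFDerivAt.comp_hasDerivAt t
    (f' := (k • rotationField (rotationCircle x y r (m + t * k))).ofLp) (hasDerivAt_pi.2 fun i => ?_)
  fin_cases i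
  · simpa [rotationCircle, rotationField] using hasDerivAt_const t x
  · simpa [rotationCircle, rotationField] using hasDerivAt_const t y
  · refine (hl.cos.const_mul r).congr_deriv ?_
    simp [rotationCircle, rotationField]
    ring
  · refine (hl.sin.const_mul r).congr_deriv ?_
    simp [rotationCircle, rotationField]
    ring

theorem contDiff_rotationCircle (x y r k m : ℝ) :
    ContDiff ℝ 1 (fun u => rotationCircle x y r (m + u * k)) := by
  rw [contDiff_euclidean]
  intro i
  fin_cases i
  · exact contDiff_const
  · exact contDiff_const
  · exact contDiff_const.mul (Real.contDiff_cos.comp (by fun_prop))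
  · exact contDiff_const.mul (Real.contDiff_sin.comp (by fun_prop))

section

variable {a b c : ℝ}

theorem mem_ellipsoidACCB_iff {q : EuclideanSpace ℝ (Fin 4)} : q ∈ ellipsoidACCB a b c ↔
    q 0 ^ 2 / a ^ 2 + q 1 ^ 2 / b ^ 2 + (q 2 ^ 2 + q 3 ^ 2) / c ^ 2 = 1 := by
  change quadric _ q = 1 ↔ _
  simp [quadric, Fin.sum_univ_succ, add_assoc, add_div]

theorem notMem_bindingEllipse_iff {q : EuclideanSpace ℝ (Fin 4)} (hq : q ∈ ellipsoidACCB a b c) :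
    q ∉ bindingEllipse a b c ↔ 0 < q 2 ^ 2 + q 3 ^ 2 := by
  constructor
  · intro h
    by_contra! hcon
    refine h ⟨hq, ?_, ?_⟩ <;> nlinarith [sq_nonneg (q 2), sq_nonneg (q 3)]
  · rintro h ⟨-, h2, h3⟩
    simp [h2, h3] at h

/-- The last two coordinates are `ε (y, z)` and the point `q₀` is shrunk by `√(1 - ε² / c²)` to stay
on the ellipsoid. Approaching the binding in a prescribed direction serves both the closure of the
fibres and the non-extendability of `𝓛₂`. -/
theorem exists_path_to_bindingEllipse (hc : 0 < c) {q₀ : EuclideanSpace ℝ (Fin 4)}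
    (hq₀ : q₀ ∈ bindingEllipse a b c) {y z : ℝ} (hyz : y ^ 2 + z ^ 2 = 1) :
    ∃ x : ℝ → EuclideanSpace ℝ (Fin 4), Filter.Tendsto x (𝓝[≠] 0) (𝓝 q₀) ∧
      (∀ᶠ ε in 𝓝[≠] (0 : ℝ), x ε ∈ ellipsoidACCB a b c \ bindingEllipse a b c) ∧
      (∀ ε, x ε 2 = ε * y) ∧ ∀ ε, x ε 3 = ε * z := by
  let x : ℝ → EuclideanSpace ℝ (Fin 4) := fun ε =>
    !₂[√(1 - ε ^ 2 / c ^ 2) * q₀ 0, √(1 - ε ^ 2 / c ^ 2) * q₀ 1, ε * y, ε * z]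
  have hx0 : x 0 = q₀ := by
    ext i
    fin_cases i
    · simp [x]
    · simp [x]
    · simp [x, hq₀.2.1]
    · simp [x, hq₀.2.2]
  have hxc : Continuous x := by
    refine (PiLp.continuous_toLp 2 _).comp (continuous_pi fun i => ?_)
    fin_cases i <;> simp <;> fun_prop
  have htend : Filter.Tendsto x (𝓝[≠] 0) (𝓝 q₀) := by
    have := hxc.tendsto 0
    rw [hx0] at this
    exact this.mono_left nhdsWithin_le_nhds
  refine ⟨x, htend, ?_, fun _ => rfl, fun _ => rfl⟩
  have h1 : ∀ᶠ ε in 𝓝[≠] (0 : ℝ), ε ∈ Ioo (-c) c :=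
    nhdsWithin_le_nhds (Ioo_mem_nhds (by linarith) hc)
  filter_upwards [h1, self_mem_nhdsWithin] with ε hε hne
  have hle : 0 ≤ 1 - ε ^ 2 / c ^ 2 := by
    rw [sub_nonneg, div_le_one (by positivity)]
    nlinarith [hε.1, hε.2]
  have hE : x ε ∈ ellipsoidACCB a b c := by
    rw [mem_ellipsoidACCB_iff]
    simp only [x, Matrix.cons_val_zero, Matrix.cons_val_one, Matrix.cons_val, mul_pow,
      Real.sq_sqrt hle]
    linear_combination (1 - ε ^ 2 / c ^ 2) * bindingEllipse_eq hq₀ + ε ^ 2 / c ^ 2 * hyz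
  refine ⟨hE, (notMem_bindingEllipse_iff hE).2 ?_⟩
  have : x ε 2 ^ 2 + x ε 3 ^ 2 = ε ^ 2 := by
    simp only [x, Matrix.cons_val]
    linear_combination ε ^ 2 * hyz
  rw [this]
  have : ε ≠ 0 := hne
  positivity

theorem inner_pageNormal_of_mem_tangentSpaceAt {θ : ℝ} {q v : EuclideanSpace ℝ (Fin 4)}
    (hq : q ∈ ellipsoidPage a b c θ) (hv : v ∈ tangentSpaceAt (ellipsoidPage a b c θ) q) :
    inner ℝ (pageNormal θ) v = 0 := by
  obtain ⟨p, hp, rfl⟩ := exists_eq_pageEmbedding hq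
  rw [ellipsoidPage_eq_image, tangentSpaceAt_image] at hv
  obtain ⟨w, -, rfl⟩ := hv
  rw [real_inner_comm]
  exact inner_pageEmbedding_pageNormal θ w

variable (hb : 0 < b) (hbc : b < c) (hca : c < a)

include hb hbc hca

/-- At a point of a page the rotation field is a nonzero multiple of the page normal. This describes
`𝓛₂` without reference to the page. -/
theorem principalSpace_one_eq {q : EuclideanSpace ℝ (Fin 4)}
    (hq : q ∈ ellipsoidACCB a b c \ bindingEllipse a b c) :
    principalSpace (ellipsoidACCB a b c) (normalACCB a b c) 1 q =
      Submodule.span ℝ {rotationField q} := by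
  obtain ⟨θ, hθ⟩ := exists_mem_ellipsoidPage hq.1
  rw [(principalSpaces_of_mem_page_diff hb hbc hca ⟨hθ, hq.2⟩).2.2.2.2.2.1]
  obtain ⟨p, hp, rfl⟩ := exists_eq_pageEmbedding hθ
  have hp1 : p 1 ≠ 0 := fun h => hq.2 ((pageEmbedding_mem_bindingEllipse hp θ).2 h)
  have h : rotationField (pageEmbedding θ p) = (-p 1) • pageNormal θ := by
    ext i
    fin_cases i <;> simp [rotationField] <;> ring
  rw [h, Submodule.span_singleton_smul_eq (neg_ne_zero.2 hp1).isUnit]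

/-- The functions `x`, `y` and `z² + w²` are annihilated by the rotation field, hence constant on
any admissible curve, whatever its speed. Conversely, moving the angle affinely reaches every point
of the circle. -/
theorem principalLeaf_one_eq {q : EuclideanSpace ℝ (Fin 4)}
    (hq : q ∈ ellipsoidACCB a b c \ bindingEllipse a b c) :
    principalLeaf (ellipsoidACCB a b c) (normalACCB a b c) 1 q =
      range (rotationCircle (q 0) (q 1) √(q 2 ^ 2 + q 3 ^ 2)) := by
  have hpos := (notMem_bindingEllipse_iff hq.1).1 hq.2
  rw [principalLeaf, regularSet_one_eq hb hbc hca]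
  ext q'
  constructor
  · rintro ⟨γ, hγ, rfl, rfl, h⟩
    have hd : ∀ t ∈ Icc (0 : ℝ) 1, ∃ k : ℝ, k • rotationField (γ t) = deriv γ t := fun t ht => by
      have := (h t ht).2
      rw [principalSpace_one_eq hb hbc hca (h t ht).1] at this
      exact Submodule.mem_span_singleton.1 this
    have e0 : γ 1 0 = γ 0 0 := eq_of_hasDerivAt_zero (f := fun t => γ t 0) (fun t ht => by
      obtain ⟨k, hk⟩ := hd t ht
      have := hasDerivAt_coord hγ t 0
      rw [← hk] at this
      simpa [rotationField] using this) (right_mem_Icc.2 zero_le_one)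
    have e1 : γ 1 1 = γ 0 1 := eq_of_hasDerivAt_zero (f := fun t => γ t 1) (fun t ht => by
      obtain ⟨k, hk⟩ := hd t ht
      have := hasDerivAt_coord hγ t 1
      rw [← hk] at this
      simpa [rotationField] using this) (right_mem_Icc.2 zero_le_one)
    have e2 : γ 1 2 ^ 2 + γ 1 3 ^ 2 = γ 0 2 ^ 2 + γ 0 3 ^ 2 :=
      eq_of_hasDerivAt_zero (f := fun t => γ t 2 ^ 2 + γ t 3 ^ 2) (fun t ht => by
        obtain ⟨k, hk⟩ := hd t ht
        refine (((hasDerivAt_coord hγ t 2).pow 2).add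
          ((hasDerivAt_coord hγ t 3).pow 2)).congr_deriv ?_
        rw [← hk]
        simp [rotationField]
        ring) (right_mem_Icc.2 zero_le_one)
    obtain ⟨φ, h2, h3⟩ := exists_polar (γ 1 2) (γ 1 3)
    exact ⟨φ, eq_rotationCircle e0 e1 (e2 ▸ h2) (e2 ▸ h3)⟩
  · rintro ⟨ψ, rfl⟩
    obtain ⟨φ, h2, h3⟩ := exists_polar (q 2) (q 3)
    have hqφ := eq_rotationCircle rfl rfl h2 h3
    have hsq := Real.sq_sqrt hpos.le
    generalize hr : √(q 2 ^ 2 + q 3 ^ 2) = r at *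
    refine ⟨fun t => rotationCircle (q 0) (q 1) r (φ + t * (ψ - φ)),
      contDiff_rotationCircle _ _ _ _ _, by simpa using hqφ, by simp, fun t _ => ?_⟩
    have hcs : (r * Real.cos (φ + t * (ψ - φ))) ^ 2 + (r * Real.sin (φ + t * (ψ - φ))) ^ 2 =
        q 2 ^ 2 + q 3 ^ 2 := by
      rw [← hsq]
      linear_combination r ^ 2 * Real.sin_sq_add_cos_sq (φ + t * (ψ - φ))
    have hE : rotationCircle (q 0) (q 1) r (φ + t * (ψ - φ)) ∈ ellipsoidACCB a b c := by
      have := mem_ellipsoidACCB_iff.1 hq.1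
      rw [← hcs] at this
      exact mem_ellipsoidACCB_iff.2 this
    have hmem : rotationCircle (q 0) (q 1) r (φ + t * (ψ - φ)) ∈
        ellipsoidACCB a b c \ bindingEllipse a b c :=
      ⟨hE, (notMem_bindingEllipse_iff hE).2 (hpos.trans_eq hcs.symm)⟩
    refine ⟨hmem, ?_⟩
    rw [(hasDerivAt_rotationCircle _ _ _ _ _ _).deriv, principalSpace_one_eq hb hbc hca hmem]
    exact Submodule.smul_mem _ _ (Submodule.mem_span_singleton_self _)

theorem isCircle_principalLeaf_one {q : EuclideanSpace ℝ (Fin 4)}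
    (hq : q ∈ regularSet (ellipsoidACCB a b c) (normalACCB a b c) 1) :
    IsCircle (principalLeaf (ellipsoidACCB a b c) (normalACCB a b c) 1 q) := by
  rw [regularSet_one_eq hb hbc hca] at hq
  rw [principalLeaf_one_eq hb hbc hca hq]
  exact isCircle_range_rotationCircle
    (Real.sqrt_pos.2 ((notMem_bindingEllipse_iff hq.1).1 hq.2))

theorem principalSpace_one_isOrtho_page {q q' : EuclideanSpace ℝ (Fin 4)} {θ : ℝ}
    (hl : q' ∈ principalLeaf (ellipsoidACCB a b c) (normalACCB a b c) 1 q)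
    (hθ : q' ∈ ellipsoidPage a b c θ) :
    principalSpace (ellipsoidACCB a b c) (normalACCB a b c) 1 q' ⟂
      tangentSpaceAt (ellipsoidPage a b c θ) q' := by
  obtain ⟨γ, -, -, rfl, h⟩ := hl
  have hR := (h 1 (right_mem_Icc.2 zero_le_one)).1
  rw [regularSet_one_eq hb hbc hca] at hR
  rw [(principalSpaces_of_mem_page_diff hb hbc hca ⟨hθ, hR.2⟩).2.2.2.2.2.1,
    Submodule.isOrtho_iff_inner_eq]
  intro u hu v hv
  obtain ⟨k, rfl⟩ := Submodule.mem_span_singleton.1 hu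
  rw [inner_smul_left, inner_pageNormal_of_mem_tangentSpaceAt hθ hv, mul_zero]

/-- The middle principal line field does not extend continuously to a point of the binding. -/
theorem not_exists_continuous_extension {q₀ : EuclideanSpace ℝ (Fin 4)}
    (hq₀ : q₀ ∈ bindingEllipse a b c) :
    ¬ ∃ O ∈ nhds q₀, ∃ X : EuclideanSpace ℝ (Fin 4) → EuclideanSpace ℝ (Fin 4),
      ContinuousOn X (ellipsoidACCB a b c ∩ O) ∧ (∀ q ∈ ellipsoidACCB a b c ∩ O, X q ≠ 0) ∧
      ∀ q ∈ regularSet (ellipsoidACCB a b c) (normalACCB a b c) 1 ∩ O,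
        X q ∈ principalSpace (ellipsoidACCB a b c) (normalACCB a b c) 1 q := by
  rintro ⟨O, hO, X, hX, hX0, hL⟩
  have hc : 0 < c := hb.trans hbc
  -- Along the direction `(y, z)` the line `𝓛₂` is constantly spanned by `(0, 0, -z, y)`, so the
  -- limit `X q₀` lies in it. The directions `(1, 0)` and `(0, 1)` together force `X q₀ = 0`.
  have key : ∀ y z : ℝ, y ^ 2 + z ^ 2 = 1 →
      X q₀ 0 = 0 ∧ X q₀ 1 = 0 ∧ y * X q₀ 2 + z * X q₀ 3 = 0 := by
    intro y z hyz
    obtain ⟨x, htend, hxE, hx2, hx3⟩ := exists_path_to_bindingEllipse hc hq₀ hyz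
    have hxO : ∀ᶠ ε in 𝓝[≠] (0 : ℝ), x ε ∈ O := htend.eventually hO
    have hlim : Filter.Tendsto (fun ε => X (x ε)) (𝓝[≠] 0) (𝓝 (X q₀)) := by
      refine (hX q₀ ⟨hq₀.1, mem_of_mem_nhds hO⟩).tendsto.comp
        (tendsto_nhdsWithin_iff.2 ⟨htend, ?_⟩)
      filter_upwards [hxE, hxO] with ε h1 h2 using ⟨h1.1, h2⟩
    have hrot : ∀ᶠ ε in 𝓝[≠] (0 : ℝ), ∃ k : ℝ, k • rotationField (x ε) = X (x ε) := by
      filter_upwards [hxE, hxO] with ε h1 h2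
      have := hL (x ε) ⟨by rwa [regularSet_one_eq hb hbc hca], h2⟩
      rw [principalSpace_one_eq hb hbc hca h1] at this
      exact Submodule.mem_span_singleton.1 this
    have hzero : ∀ f : EuclideanSpace ℝ (Fin 4) → ℝ, Continuous f →
        (∀ (ε k : ℝ), f (k • rotationField (x ε)) = 0) → f (X q₀) = 0 := by
      intro f hf h0
      refine tendsto_nhds_unique ((hf.tendsto _).comp hlim) (tendsto_const_nhds.congr' ?_)
      filter_upwards [hrot] with ε ⟨k, hk⟩
      simp only [Function.comp, ← hk, h0]
    refine ⟨hzero (fun v => v 0) (by fun_prop) fun ε k => by simp [rotationField],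
      hzero (fun v => v 1) (by fun_prop) fun ε k => by simp [rotationField],
      hzero (fun v => y * v 2 + z * v 3) (by fun_prop) fun ε k => ?_⟩
    simp [rotationField, hx2, hx3]
    ring
  obtain ⟨e0, e1, e2⟩ := key 1 0 (by norm_num)
  obtain ⟨-, -, e3⟩ := key 0 1 (by norm_num)
  refine hX0 q₀ ⟨hq₀.1, mem_of_mem_nhds hO⟩ ?_
  ext i
  fin_cases i
  · exact e0
  · exact e1
  · simpa using e2
  · simpa using e3

/-- The leaves of the plane field spanned by the extreme principal directions are the connected
components of the pages without the binding. -/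
theorem leaf_sup_eq {θ : ℝ} {q : EuclideanSpace ℝ (Fin 4)}
    (hq : q ∈ ellipsoidPage a b c θ \ bindingEllipse a b c) :
    leaf (fun x => principalSpace (ellipsoidACCB a b c) (normalACCB a b c) 0 x ⊔
        principalSpace (ellipsoidACCB a b c) (normalACCB a b c) 2 x)
      (regularSet (ellipsoidACCB a b c) (normalACCB a b c) 0 ∩
        regularSet (ellipsoidACCB a b c) (normalACCB a b c) 2) q =
      connectedComponentIn (ellipsoidPage a b c θ \ bindingEllipse a b c) q := by
  have hc : 0 < c := hb.trans hbc
  have ha : 0 < a := hc.trans hca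
  rw [regularSet_zero_inter_two_eq hb hbc hca]
  ext q'
  constructor
  · rintro ⟨γ, hγ, rfl, rfl, h⟩
    -- Tangency to the page through `γ t` means that the argument of `z + iw` is stationary. The
    -- determinant expresses this without the angle `η`, which is chosen separately for each `t`.
    have hdet : ∀ t ∈ Icc (0 : ℝ) 1, γ t 2 * deriv γ t 3 - γ t 3 * deriv γ t 2 = 0 := by
      intro t ht
      obtain ⟨hR, hd⟩ := h t ht
      obtain ⟨η, hη⟩ := exists_mem_ellipsoidPage hR.1
      have hT : deriv γ t ∈ tangentSpaceAt (ellipsoidPage a b c η) (γ t) := by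
        rw [(principalSpaces_of_mem_page_diff hb hbc hca ⟨hη, hR.2⟩).2.2.2.2.2.2]
        exact hd
      have h1 := inner_pageNormal_of_mem_tangentSpaceAt hη hT
      rw [inner_pageNormal] at h1
      have h2 := hη.2
      have h3 := Real.sin_sq_add_cos_sq η
      linear_combination (-(γ t 2 * deriv γ t 3 - γ t 3 * deriv γ t 2)) * h3 +
        (Real.cos η * deriv γ t 3 - Real.sin η * deriv γ t 2) * h2 +
        (Real.sin η * γ t 2 - Real.cos η * γ t 3) * h1
    have hpos : ∀ t ∈ Icc (0 : ℝ) 1, 0 < γ t 2 ^ 2 + γ t 3 ^ 2 := fun t ht =>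
      (notMem_bindingEllipse_iff (h t ht).1.1).1 (h t ht).1.2
    have hconst : ∀ t ∈ Icc (0 : ℝ) 1, Real.cos θ * γ t 2 + Real.sin θ * γ t 3 = 0 := by
      intro t ht
      -- The quotient is homogeneous of degree zero in `(z, w)`, so it depends on the argument only;
      -- its derivative is a multiple of the determinant, and it vanishes at time `0`.
      have := eq_of_hasDerivAt_zero (f := fun r => (Real.cos θ * γ r 2 + Real.sin θ * γ r 3) ^ 2 /
        (γ r 2 ^ 2 + γ r 3 ^ 2)) (fun r hr => by
          have h2 := hasDerivAt_coord hγ r 2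
          have h3 := hasDerivAt_coord hγ r 3
          refine ((((h2.const_mul (Real.cos θ)).add (h3.const_mul (Real.sin θ))).pow 2).div
            ((h2.pow 2).add (h3.pow 2)) (hpos r hr).ne').congr_deriv ?_
          rw [div_eq_zero_iff]
          left
          simp
          linear_combination (2 * (Real.cos θ * γ r 2 + Real.sin θ * γ r 3) *
            (Real.sin θ * γ r 2 - Real.cos θ * γ r 3)) * hdet r hr) ht
      simp only [hq.1.2] at this
      rw [zero_pow two_ne_zero, zero_div, div_eq_zero_iff] at this
      exact pow_eq_zero_iff two_ne_zero |>.1 (this.resolve_right (hpos t ht).ne')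
    have hpre : IsPreconnected (γ '' Icc 0 1) :=
      isPreconnected_Icc.image _ hγ.continuous.continuousOn
    refine hpre.subset_connectedComponentIn (mem_image_of_mem _ (left_mem_Icc.2 zero_le_one)) ?_
      (mem_image_of_mem _ (right_mem_Icc.2 zero_le_one))
    rintro _ ⟨t, ht, rfl⟩
    exact ⟨⟨(h t ht).1.1, hconst t ht⟩, (h t ht).1.2⟩
  · intro hq'
    have hsub := connectedComponentIn_subset (ellipsoidPage a b c θ \ bindingEllipse a b c) q
    -- The coordinate of `(z, w)` along the page. It has no zero on the page off the binding, so its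
    -- sign is constant on a component.
    let k : EuclideanSpace ℝ (Fin 4) → ℝ := fun x => -Real.sin θ * x 2 + Real.cos θ * x 3
    have hkc : Continuous k := by fun_prop
    have hk0 : ∀ x ∈ ellipsoidPage a b c θ \ bindingEllipse a b c, k x ≠ 0 := by
      intro x hx h0
      have h1 := hx.1.2
      have h3 := Real.sin_sq_add_cos_sq θ
      refine hx.2 ⟨hx.1.1, ?_, ?_⟩
      · simp only [k] at h0
        linear_combination (-x 2) * h3 - Real.sin θ * h0 + Real.cos θ * h1
      · simp only [k] at h0
        linear_combination (-x 3) * h3 + Real.cos θ * h0 + Real.sin θ * h1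
    have hkq := hk0 q hq
    have hkk : 0 < k q * k q' :=
      pos_of_isPreconnected (f := fun x => k q * k x) isPreconnected_connectedComponentIn
        (by fun_prop) (fun x hx => mul_ne_zero hkq (hk0 x (hsub hx)))
        (mem_connectedComponentIn hq) hq' (mul_self_pos.2 hkq)
    -- A smooth function with `σ 0 = 0`, `σ 1 = 1` and values in `[0, 1]` for all real `t`. The
    -- segment parametrized by it never leaves the open half-page side `0 < k q * k x`, so its
    -- radial projection is `C¹` on all of `ℝ`, as `leaf` requires.
    let σ : ℝ → ℝ := fun t => (1 - Real.cos (Real.pi * t)) / 2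
    have hσ : ContDiff ℝ 1 σ := by
      have : ContDiff ℝ 1 fun t : ℝ => Real.cos (Real.pi * t) :=
        Real.contDiff_cos.comp (by fun_prop)
      exact (contDiff_const.sub this).div_const 2
    have hσ0 : ∀ t, 0 ≤ σ t := fun t => by
      have := Real.cos_le_one (Real.pi * t)
      simp only [σ]
      linarith
    have hσ1 : ∀ t, σ t ≤ 1 := fun t => by
      have := Real.neg_one_le_cos (Real.pi * t)
      simp only [σ]
      linarith
    let x : ℝ → EuclideanSpace ℝ (Fin 4) := fun t => q + σ t • (q' - q)
    have hx : ContDiff ℝ 1 x := contDiff_const.add (hσ.smul contDiff_const)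
    have hkx : ∀ t, 0 < k q * k (x t) := fun t => by
      have : k q * k (x t) = (1 - σ t) * (k q * k q) + σ t * (k q * k q') := by
        simp [k, x]
        ring
      rw [this]
      rcases eq_or_lt_of_le (hσ1 t) with h | h
      · rw [h]
        linarith
      · have h1 := mul_pos (sub_pos.2 h) (mul_self_pos.2 hkq)
        have h2 := mul_nonneg (hσ0 t) hkk.le
        linarith
    have hQ : ∀ t, 0 < quadric ![a, b, c, c] (x t) := fun t => by
      refine quadric_pos (fun i => ?_) fun h => ?_
      · fin_cases i
        exacts [ha.ne', hb.ne', hc.ne', hc.ne']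
      · have := hkx t
        simp [h, k] at this
    have hpl : ∀ t, Real.cos θ * x t 2 + Real.sin θ * x t 3 = 0 := fun t => by
      have h1 := hq.1.2
      have h2 := (hsub hq').1.2
      simp [x]
      linear_combination (1 - σ t) * h1 + σ t * h2
    let γ : ℝ → EuclideanSpace ℝ (Fin 4) := fun t => (√(quadric ![a, b, c, c] (x t)))⁻¹ • x t
    have hγ : ContDiff ℝ 1 γ := contDiff_iff_contDiffAt.2 fun t =>
      contDiffAt_inv_sqrt_quadric_smul hx.contDiffAt (hQ t)
    have hγS : ∀ t, γ t ∈ ellipsoidPage a b c θ := fun t => by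
      refine ⟨quadric_inv_sqrt_smul (hQ t), ?_⟩
      simp [γ]
      linear_combination (√(quadric ![a, b, c, c] (x t)))⁻¹ * hpl t
    have hγE : ∀ t, γ t ∉ bindingEllipse a b c := fun t ht => by
      have h0 : k q * k (γ t) = 0 := by simp [k, ht.2.1, ht.2.2]
      have h1 : k q * k (γ t) = (√(quadric ![a, b, c, c] (x t)))⁻¹ * (k q * k (x t)) := by
        simp [k, γ]
        ring
      exact (mul_pos (inv_pos.2 (Real.sqrt_pos.2 (hQ t))) (hkx t)).ne' (h1.symm.trans h0)
    have hone : ∀ y ∈ ellipsoidPage a b c θ, quadric ![a, b, c, c] y = 1 := fun y hy => hy.1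
    refine ⟨γ, hγ, ?_, ?_, fun t _ => ⟨⟨(hγS t).1, hγE t⟩, ?_⟩⟩
    · simp [γ, x, σ, hone q hq.1]
    · simp [γ, x, σ, hone q' (hsub hq').1]
    · have hT := deriv_mem_tangentSpaceAt hγ hγS t
      rw [(principalSpaces_of_mem_page_diff hb hbc hca ⟨hγS t, hγE t⟩).2.2.2.2.2.2] at hT
      exact hT

end

/-! ### The open book -/

/-- Ellipsoid, page and binding are all zero sets of one global map `(Q - 1) e + L` with `L` linear;
`hsurj` is the surjectivity of its derivative. -/
theorem isSubmanifoldOfCodim_quadric {n m : ℕ} {s : Fin n → ℝ} (e : EuclideanSpace ℝ (Fin m))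
    (L : EuclideanSpace ℝ (Fin n) →L[ℝ] EuclideanSpace ℝ (Fin m)) {S : Set (EuclideanSpace ℝ (Fin n))}
    (hS : ∀ x, x ∈ S ↔ (quadric s x - 1) • e + L x = 0)
    (hsurj : ∀ q ∈ S, ∀ w, ∃ v, (2 * inner ℝ (invSqDiag s q) v) • e + L v = w) :
    IsSubmanifoldOfCodim m S := by
  intro q hq
  have hQ : ContDiff ℝ ∞ fun x => (quadric s x - 1) • e + L x :=
    (((contDiff_quadric s).sub contDiff_const).smul contDiff_const).add L.contDiff
  refine ⟨univ, fun x => (quadric s x - 1) • e + L x, isOpen_univ, mem_univ q, hQ.contDiffOn,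
    fun w => ?_, ?_⟩
  · obtain ⟨v, hv⟩ := hsurj q hq w
    refine ⟨v, ?_⟩
    have hd : HasFDerivAt (fun x => (quadric s x - 1) • e + L x)
        ((fderiv ℝ (quadric s) q).smulRight e + L) q :=
      ((((contDiff_quadric s (k := 1)).differentiable (by simp) q).hasFDerivAt.sub_const 1).smul_const
        e).add L.hasFDerivAt
    rw [hd.fderiv, ← hv]
    simp [fderiv_quadric]
  · ext x
    simp [hS]

theorem isSubmanifoldOfCodim_one_ellipsoid {n : ℕ} (s : Fin n → ℝ) :
    IsSubmanifoldOfCodim 1 (ellipsoid s) := by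
  refine isSubmanifoldOfCodim_quadric (s := s) (EuclideanSpace.single 0 1) 0 (fun x => ?_)
    -- By Euler's relation the derivative of `Q` at `q` in the direction `q` is `2`, hence the
    -- factor one half.
    fun q hq w => ⟨(2⁻¹ * w 0) • q, ?_⟩
  · change quadric s x = 1 ↔ _
    simp [sub_eq_zero]
  · have h : inner ℝ (invSqDiag s q) q = 1 := (quadric_eq_inner s q).symm.trans hq
    ext i
    fin_cases i
    simp [inner_smul_right, h]

/-! ### Regularity of the pages and the binding, and the fibration over the circle. -/

section

variable {a b c : ℝ}

theorem isSubmanifoldOfCodim_two_page (θ : ℝ) :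
    IsSubmanifoldOfCodim 2 (ellipsoidPage a b c θ) := by
  refine isSubmanifoldOfCodim_quadric (s := ![a, b, c, c]) (EuclideanSpace.single 0 1)
    ((innerSL ℝ (pageNormal θ)).smulRight (EuclideanSpace.single 1 1)) (fun x => ?_)
    -- The position vector changes only the quadric and the page normal only the linear form, so the
    -- two components can be prescribed independently.
    fun q hq w => ⟨(2⁻¹ * w 0) • q + w 1 • pageNormal θ, ?_⟩
  · constructor
    · rintro ⟨h1, h2⟩
      have h1' : quadric ![a, b, c, c] x = 1 := h1
      simp [h1', inner_pageNormal, h2]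
    · intro h
      have h0 := congrArg (fun y : EuclideanSpace ℝ (Fin 2) => y 0) h
      have h1 := congrArg (fun y : EuclideanSpace ℝ (Fin 2) => y 1) h
      simp [sub_eq_zero, inner_pageNormal] at h0 h1
      exact ⟨h0, h1⟩
  · have h : inner ℝ (invSqDiag ![a, b, c, c] q) q = 1 := (quadric_eq_inner _ q).symm.trans hq.1
    have h1 : inner ℝ (pageNormal θ) q = 0 := by rw [inner_pageNormal, hq.2]
    have h2 : inner ℝ (invSqDiag ![a, b, c, c] q) (pageNormal θ) = 0 := by
      rw [inner_invSqDiag_comm, invSqDiag_pageNormal, inner_smul_right, real_inner_comm, h1, mul_zero]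
    have h3 : inner ℝ (pageNormal θ) (pageNormal θ) = 1 := by
      rw [real_inner_self_eq_norm_sq, norm_pageNormal, one_pow]
    ext i
    fin_cases i
    · simp [inner_add_right, inner_smul_right, h, h2]
    · simp only [Fin.mk_one, ContinuousLinearMap.smulRight_apply, innerSL_apply_apply,
        inner_add_right, inner_smul_right, h1, h3]
      simp

theorem isSubmanifoldOfCodim_three_bindingEllipse :
    IsSubmanifoldOfCodim 3 (bindingEllipse a b c) := by
  refine isSubmanifoldOfCodim_quadric (s := ![a, b, c, c]) (EuclideanSpace.single 0 1)
    ((EuclideanSpace.proj (2 : Fin 4)).smulRight (EuclideanSpace.single 1 1) +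
      (EuclideanSpace.proj (3 : Fin 4)).smulRight (EuclideanSpace.single 2 1)) (fun x => ?_)
    fun q hq w => ⟨(2⁻¹ * w 0) • q + w 1 • EuclideanSpace.single 2 1 +
      w 2 • EuclideanSpace.single 3 1, ?_⟩
  · constructor
    · rintro ⟨h1, h2, h3⟩
      have h1' : quadric ![a, b, c, c] x = 1 := h1
      simp [h1', h2, h3]
    · intro h
      have h0 := congrArg (fun y : EuclideanSpace ℝ (Fin 3) => y 0) h
      have h1 := congrArg (fun y : EuclideanSpace ℝ (Fin 3) => y 1) h
      have h2 := congrArg (fun y : EuclideanSpace ℝ (Fin 3) => y 2) h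
      simp [sub_eq_zero] at h0 h1 h2
      exact ⟨h0, h1, h2⟩
  · have h : inner ℝ (invSqDiag ![a, b, c, c] q) q = 1 := (quadric_eq_inner _ q).symm.trans hq.1
    ext i
    fin_cases i <;>
      simp [inner_add_right, inner_smul_right, h, EuclideanSpace.inner_single_right, hq.2.1, hq.2.2]

/-- The last two coordinates as a complex number. -/
noncomputable def lastTwo : EuclideanSpace ℝ (Fin 4) →L[ℝ] ℂ :=
  (EuclideanSpace.proj (2 : Fin 4)).smulRight (1 : ℂ) +
    (EuclideanSpace.proj (3 : Fin 4)).smulRight Complex.I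

@[simp] theorem lastTwo_re (q : EuclideanSpace ℝ (Fin 4)) : (lastTwo q).re = q 2 := by
  simp [lastTwo]

@[simp] theorem lastTwo_im (q : EuclideanSpace ℝ (Fin 4)) : (lastTwo q).im = q 3 := by
  simp [lastTwo]

theorem lastTwo_eq_zero_iff {q : EuclideanSpace ℝ (Fin 4)} :
    lastTwo q = 0 ↔ q 2 = 0 ∧ q 3 = 0 := by
  simp [Complex.ext_iff]

theorem normSq_lastTwo (q : EuclideanSpace ℝ (Fin 4)) :
    Complex.normSq (lastTwo q) = q 2 ^ 2 + q 3 ^ 2 := by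
  rw [Complex.normSq_apply, lastTwo_re, lastTwo_im]
  ring

theorem mem_compl_binding_iff {q : EuclideanSpace ℝ (Fin 4)} :
    q ∈ ellipsoidACCB a b c \ bindingEllipse a b c ↔ q ∈ ellipsoidACCB a b c ∧ lastTwo q ≠ 0 := by
  rw [Ne, lastTwo_eq_zero_iff]
  exact ⟨fun h => ⟨h.1, fun h' => h.2 ⟨h.1, h'⟩⟩, fun h => ⟨h.1, fun h' => h.2 h'.2⟩⟩

/-- The complex number of modulus one with the argument of `z`. -/
noncomputable def unitPart (z : ℂ) : ℂ := ‖z‖⁻¹ • z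

theorem contDiffOn_unitPart_comp {V : Type*} [NormedAddCommGroup V] [NormedSpace ℝ V] {f : V → ℂ}
    {A : Set V} (hf : ContDiffOn ℝ ∞ f A) (h0 : ∀ x ∈ A, f x ≠ 0) :
    ContDiffOn ℝ ∞ (fun x => unitPart (f x)) A :=
  ((hf.norm ℝ h0).inv fun x hx => norm_ne_zero_iff.2 (h0 x hx)).smul hf

theorem norm_unitPart {z : ℂ} (hz : z ≠ 0) : ‖unitPart z‖ = 1 := by
  rw [unitPart, norm_smul, norm_inv, norm_norm, inv_mul_cancel₀ (norm_ne_zero_iff.2 hz)]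

theorem unitPart_mul (z w : ℂ) : unitPart (z * w) = unitPart z * unitPart w := by
  simp only [unitPart, norm_mul, mul_inv, Complex.real_smul, Complex.ofReal_mul]
  ring

theorem unitPart_of_norm_eq_one {z : ℂ} (hz : ‖z‖ = 1) : unitPart z = z := by
  rw [unitPart, hz, inv_one, one_smul]

theorem conj_mul_self_of_norm_eq_one {z : ℂ} (hz : ‖z‖ = 1) : (starRingEnd ℂ) z * z = 1 := by
  rw [mul_comm, Complex.mul_conj, Complex.normSq_eq_norm_sq, hz]
  simp

/-- `unitPart (1 + u)` is a square root of a unit complex number `u`. -/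
theorem unitPart_one_add_sq {u : ℂ} (hu : ‖u‖ = 1) (h : 1 + u ≠ 0) : unitPart (1 + u) ^ 2 = u := by
  have h1 := conj_mul_self_of_norm_eq_one hu
  -- The square is `(1 + u)² / |1 + u|² = (1 + u) / (1 + ū)`, which is `u` because `u ū = 1`.
  have h2 : ((‖1 + u‖ : ℝ) : ℂ) ^ 2 = (1 + u) * (1 + (starRingEnd ℂ) u) := by
    rw [← Complex.ofReal_pow, ← Complex.normSq_eq_norm_sq, ← Complex.mul_conj]
    simp
  have h3 : ((‖1 + u‖ : ℝ) : ℂ) ^ 2 ≠ 0 := by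
    simpa using h
  rw [unitPart, Complex.real_smul, mul_pow, Complex.ofReal_inv, inv_pow, inv_mul_eq_iff_eq_mul₀ h3,
    h2]
  linear_combination (-(1 + u)) * h1

/-- The projection of the open book: the square of the unit part of `z + i w`. -/
noncomputable def bookProjection (q : EuclideanSpace ℝ (Fin 4)) : ℂ := unitPart (lastTwo q) ^ 2

theorem norm_bookProjection {q : EuclideanSpace ℝ (Fin 4)} (hq : lastTwo q ≠ 0) :
    ‖bookProjection q‖ = 1 := by
  rw [bookProjection, norm_pow, norm_unitPart hq, one_pow]

theorem contDiffOn_bookProjection : ContDiffOn ℝ ∞ bookProjection {q | lastTwo q ≠ 0} :=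
  (contDiffOn_unitPart_comp lastTwo.contDiff.contDiffOn fun _ h => h).pow 2

theorem isOpen_lastTwo_ne_zero : IsOpen {q : EuclideanSpace ℝ (Fin 4) | lastTwo q ≠ 0} :=
  isOpen_ne_fun lastTwo.continuous continuous_const

/-- The base point of the page with parameter `θ`. -/
noncomputable def pageBase (θ : ℝ) : ℂ := ⟨-(Real.cos θ ^ 2 - Real.sin θ ^ 2), -(2 * Real.sin θ * Real.cos θ)⟩

theorem exists_pageBase_eq {ζ : ℂ} (hζ : ‖ζ‖ = 1) : ∃ θ, pageBase θ = ζ := by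
  have h1 := Complex.norm_mul_cos_arg (-ζ)
  have h2 := Complex.norm_mul_sin_arg (-ζ)
  rw [norm_neg, hζ, one_mul] at h1 h2
  refine ⟨Complex.arg (-ζ) / 2, ?_⟩
  have hc := Real.cos_two_mul' (Complex.arg (-ζ) / 2)
  have hs := Real.sin_two_mul (Complex.arg (-ζ) / 2)
  rw [mul_div_cancel₀ _ two_ne_zero] at hc hs
  refine Complex.ext ?_ ?_
  · simp only [pageBase]
    rw [← hc, h1]
    simp
  · simp only [pageBase]
    rw [← hs, h2]
    simp

theorem norm_pageBase (θ : ℝ) : ‖pageBase θ‖ = 1 := by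
  rw [Complex.norm_eq_sqrt_sq_add_sq, Real.sqrt_eq_one]
  simp only [pageBase]
  linear_combination (Real.sin θ ^ 2 + Real.cos θ ^ 2 + 1) * Real.sin_sq_add_cos_sq θ

/-- On the page `z + iw` is a real multiple of `i e^{iθ}`, whose square is `-e^{2iθ} = pageBase θ`.
The square forgets the sign of the multiple, so both halves of the page lie over one point. -/
theorem bookProjection_eq_pageBase_iff {q : EuclideanSpace ℝ (Fin 4)} (hq : lastTwo q ≠ 0) (θ : ℝ) :
    bookProjection q = pageBase θ ↔ Real.cos θ * q 2 + Real.sin θ * q 3 = 0 := by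
  have hn : (q 2 ^ 2 + q 3 ^ 2) ≠ 0 := by
    rw [← normSq_lastTwo]
    exact (map_ne_zero _).2 hq
  have hsq : bookProjection q = ((q 2 ^ 2 + q 3 ^ 2)⁻¹ : ℝ) • lastTwo q ^ 2 := by
    rw [bookProjection, unitPart, smul_pow, inv_pow, ← Complex.normSq_eq_norm_sq, normSq_lastTwo]
  have h3 := Real.sin_sq_add_cos_sq θ
  rw [hsq, inv_smul_eq_iff₀ hn, Complex.ext_iff]
  simp only [pow_two (lastTwo q), Complex.mul_re, Complex.mul_im, lastTwo_re, lastTwo_im,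
    Complex.smul_re, Complex.smul_im, pageBase, smul_eq_mul]
  constructor
  · rintro ⟨h1, h2⟩
    -- With `v = z + iw`, twice the square of the linear form is `|v|²` minus the real part of `v²`
    -- times the conjugate of `pageBase θ`.
    refine pow_eq_zero_iff two_ne_zero |>.1 ?_
    set C := Real.cos θ
    set S := Real.sin θ
    linear_combination (C ^ 2 - S ^ 2) / 2 * h1 + C * S * h2 +
      (-((C ^ 2 + S ^ 2) / 2 * (q 2 ^ 2 + q 3 ^ 2))) * h3
  · intro h
    set C := Real.cos θ
    set S := Real.sin θ
    constructor
    · linear_combination 2 * (C * q 2 - S * q 3) * h - (q 2 ^ 2 - q 3 ^ 2) * h3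
    · linear_combination 2 * (S * q 2 + C * q 3) * h - 2 * q 2 * q 3 * h3

/-- Multiplication of the last two coordinates by the complex number `s`. -/
noncomputable def rotate (s : ℂ) (y : EuclideanSpace ℝ (Fin 4)) : EuclideanSpace ℝ (Fin 4) :=
  !₂[y 0, y 1, (s * lastTwo y).re, (s * lastTwo y).im]

theorem lastTwo_rotate (s : ℂ) (y : EuclideanSpace ℝ (Fin 4)) :
    lastTwo (rotate s y) = s * lastTwo y := by
  apply Complex.ext
  · rw [lastTwo_re]; rfl
  · rw [lastTwo_im]; rfl

theorem rotate_rotate (s t : ℂ) (y : EuclideanSpace ℝ (Fin 4)) :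
    rotate s (rotate t y) = rotate (s * t) y := by
  rw [rotate, lastTwo_rotate, ← mul_assoc]
  rfl

theorem rotate_one (y : EuclideanSpace ℝ (Fin 4)) : rotate 1 y = y := by
  ext i
  fin_cases i <;> simp [rotate]

theorem rotate_mem {s : ℂ} (hs : ‖s‖ = 1) {y : EuclideanSpace ℝ (Fin 4)}
    (hy : y ∈ ellipsoidACCB a b c \ bindingEllipse a b c) :
    rotate s y ∈ ellipsoidACCB a b c \ bindingEllipse a b c := by
  rw [mem_compl_binding_iff] at hy ⊢
  have hs0 : s ≠ 0 := norm_ne_zero_iff.1 (by rw [hs]; exact one_ne_zero)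
  refine ⟨?_, by rw [lastTwo_rotate]; exact mul_ne_zero hs0 hy.2⟩
  have h := mem_ellipsoidACCB_iff.1 hy.1
  rw [mem_ellipsoidACCB_iff, ← normSq_lastTwo, lastTwo_rotate, map_mul, Complex.normSq_eq_norm_sq s,
    hs, one_pow, one_mul, normSq_lastTwo]
  exact h

theorem bookProjection_rotate {s : ℂ} (hs : ‖s‖ = 1) (y : EuclideanSpace ℝ (Fin 4)) :
    bookProjection (rotate s y) = s ^ 2 * bookProjection y := by
  rw [bookProjection, lastTwo_rotate, unitPart_mul, unitPart_of_norm_eq_one hs, mul_pow]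
  rfl

theorem contDiffOn_rotate {V : Type*} [NormedAddCommGroup V] [NormedSpace ℝ V] {f : V → ℂ}
    {g : V → EuclideanSpace ℝ (Fin 4)} {A : Set V} (hf : ContDiffOn ℝ ∞ f A)
    (hg : ContDiffOn ℝ ∞ g A) : ContDiffOn ℝ ∞ (fun x => rotate (f x) (g x)) A := by
  have hm : ContDiffOn ℝ ∞ (fun x => f x * lastTwo (g x)) A :=
    hf.mul (lastTwo.contDiff.comp_contDiffOn hg)
  have hg' := contDiffOn_euclidean.1 hg
  refine contDiffOn_euclidean.2 fun i => ?_
  fin_cases i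
  · exact hg' 0
  · exact hg' 1
  · exact Complex.reCLM.contDiff.comp_contDiffOn hm
  · exact Complex.imCLM.contDiff.comp_contDiffOn hm

/-- Rotation by a unit `s` multiplies the projection by `s²`. So rotation by the smooth square root
`unitPart (1 + η ζ̄)` of `η / ζ` carries the fibre over `ζ` to that over `η`, and the conjugate
rotation carries it back. -/
theorem isSmoothFibrationOverCircle_bookProjection (hc : c ≠ 0) :
    IsSmoothFibrationOverCircle (ellipsoidACCB a b c \ bindingEllipse a b c) bookProjection := by
  have hX : ∀ q ∈ ellipsoidACCB a b c \ bindingEllipse a b c, lastTwo q ≠ 0 := fun q hq =>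
    (mem_compl_binding_iff.1 hq).2
  refine ⟨⟨_, isOpen_lastTwo_ne_zero, hX, contDiffOn_bookProjection⟩, ?_, ?_⟩
  · ext ζ
    rw [mem_sphere_zero_iff_norm]
    constructor
    · rintro ⟨q, hq, rfl⟩
      exact norm_bookProjection (hX q hq)
    · intro hζ
      obtain ⟨θ, rfl⟩ := exists_pageBase_eq hζ
      have hE : (!₂[0, 0, -c * Real.sin θ, c * Real.cos θ] : EuclideanSpace ℝ (Fin 4)) ∈
          ellipsoidACCB a b c := by
        rw [mem_ellipsoidACCB_iff]
        simp
        field_simp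
        exact Real.sin_sq_add_cos_sq θ
      have hmem : (!₂[0, 0, -c * Real.sin θ, c * Real.cos θ] : EuclideanSpace ℝ (Fin 4)) ∈
          ellipsoidACCB a b c \ bindingEllipse a b c := by
        refine ⟨hE, (notMem_bindingEllipse_iff hE).2 ?_⟩
        have h1 : (-c * Real.sin θ) ^ 2 + (c * Real.cos θ) ^ 2 = c ^ 2 := by
          linear_combination c ^ 2 * Real.sin_sq_add_cos_sq θ
        exact h1 ▸ (by positivity)
      refine ⟨_, hmem, (bookProjection_eq_pageBase_iff (hX _ hmem) θ).2 ?_⟩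
      simp
      ring
  · intro ζ hζ
    rw [mem_sphere_zero_iff_norm] at hζ
    have hζζ := conj_mul_self_of_norm_eq_one hζ
    -- On the circle this vanishes only at `η = -ζ`, so the trivialization covers all but the
    -- antipode.
    let f : ℂ → ℂ := fun η => 1 + η * (starRingEnd ℂ) ζ
    have hf : ContDiff ℝ ∞ f := contDiff_const.add (contDiff_id.mul contDiff_const)
    have hfo : IsOpen {η | f η ≠ 0} := isOpen_ne_fun hf.continuous continuous_const
    let s : ℂ → ℂ := fun η => unitPart (f η)
    have hs : ∀ η, ‖η‖ = 1 → f η ≠ 0 → ‖s η‖ = 1 ∧ s η ^ 2 * ζ = η := fun η hη h0 => by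
      refine ⟨norm_unitPart h0, ?_⟩
      have hu : ‖η * (starRingEnd ℂ) ζ‖ = 1 := by
        rw [norm_mul, Complex.norm_conj, hη, hζ, one_mul]
      rw [unitPart_one_add_sq hu h0]
      linear_combination η * hζζ
    refine ⟨{η | f η ≠ 0}, hfo, ?_, fun x => rotate (s x.1) x.2,
      fun x => rotate ((starRingEnd ℂ) (s (bookProjection x))) x, ?_, ?_, ?_, ?_⟩
    · have : f ζ = 2 := by
        simp only [f]
        linear_combination hζζ
      simp [this]
    · refine ⟨{x | f x.1 ≠ 0}, hfo.preimage continuous_fst, fun x hx => hx.1.2,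
        contDiffOn_rotate ?_ contDiff_snd.contDiffOn⟩
      exact contDiffOn_unitPart_comp (hf.comp contDiff_fst).contDiffOn fun x hx => hx
    · refine ⟨{x | lastTwo x ≠ 0} ∩ bookProjection ⁻¹' {η | f η ≠ 0},
        contDiffOn_bookProjection.continuousOn.isOpen_inter_preimage isOpen_lastTwo_ne_zero hfo,
        fun x hx => ⟨hX x hx.1, hx.2⟩, contDiffOn_rotate ?_ contDiff_id.contDiffOn⟩
      refine Complex.conjCLE.contDiff.comp_contDiffOn (contDiffOn_unitPart_comp
        (hf.comp_contDiffOn (contDiffOn_bookProjection.mono inter_subset_left)) fun x hx => hx.2)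
    · rintro η ⟨hη, h0⟩ y ⟨hy, hyζ⟩
      rw [mem_sphere_zero_iff_norm] at hη
      have hyζ' : bookProjection y = ζ := hyζ
      obtain ⟨h1, h2⟩ := hs η hη h0
      have h3 : bookProjection (rotate (s η) y) = η := by rw [bookProjection_rotate h1, hyζ', h2]
      refine ⟨rotate_mem h1 hy, h3, ?_⟩
      dsimp only
      rw [h3, rotate_rotate, conj_mul_self_of_norm_eq_one h1, rotate_one]
    · rintro x ⟨hx, h0⟩
      obtain ⟨h1, h2⟩ := hs _ (norm_bookProjection (hX x hx)) h0
      have h3 := conj_mul_self_of_norm_eq_one h1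
      refine ⟨⟨rotate_mem (by rwa [Complex.norm_conj]) hx, ?_⟩, ?_⟩
      · change bookProjection (rotate _ x) = ζ
        rw [bookProjection_rotate (by rwa [Complex.norm_conj])]
        nth_rewrite 2 [← h2]
        linear_combination ζ * ((starRingEnd ℂ) (s (bookProjection x)) * s (bookProjection x) + 1) * h3
      · dsimp only
        rw [rotate_rotate, mul_comm, h3, rotate_one]

/-! ### Pages as closures of the fibres, and the open book. -/

theorem bindingEllipse_subset_page (θ : ℝ) : bindingEllipse a b c ⊆ ellipsoidPage a b c θ :=
  fun q hq => ⟨hq.1, by rw [hq.2.1, hq.2.2]; ring⟩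

theorem isClosed_page (θ : ℝ) : IsClosed (ellipsoidPage a b c θ) :=
  (isClosed_eq (contDiff_quadric ![a, b, c, c] (k := 1)).continuous continuous_const).inter
    (isClosed_eq (f := fun q : EuclideanSpace ℝ (Fin 4) => Real.cos θ * q 2 + Real.sin θ * q 3)
      (by fun_prop) continuous_const)

/-- The fibre is the page without the binding. The page is closed, and each binding point is a limit
of points of the page along the direction `(-sin θ, cos θ)`. -/
theorem pageOver_pageBase (hc : 0 < c) (θ : ℝ) :
    pageOver (ellipsoidACCB a b c) (bindingEllipse a b c) bookProjection (pageBase θ) =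
      ellipsoidPage a b c θ := by
  have hfib : (ellipsoidACCB a b c \ bindingEllipse a b c) ∩ bookProjection ⁻¹' {pageBase θ} =
      ellipsoidPage a b c θ \ bindingEllipse a b c := by
    ext q
    constructor
    · rintro ⟨hq, h⟩
      exact ⟨⟨hq.1, (bookProjection_eq_pageBase_iff (mem_compl_binding_iff.1 hq).2 θ).1 h⟩, hq.2⟩
    · rintro ⟨hq, h⟩
      exact ⟨⟨hq.1, h⟩, (bookProjection_eq_pageBase_iff
        (mem_compl_binding_iff.1 ⟨hq.1, h⟩).2 θ).2 hq.2⟩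
  rw [pageOver, hfib]
  refine Subset.antisymm (fun q hq => ?_) fun q hq => ⟨hq.1, ?_⟩
  · exact closure_minimal sdiff_subset (isClosed_page θ) hq.2
  · by_cases h0 : q ∈ bindingEllipse a b c
    · obtain ⟨x, hx, hE, h2, h3⟩ := exists_path_to_bindingEllipse hc h0
        (y := -Real.sin θ) (z := Real.cos θ) (by rw [neg_sq]; exact Real.sin_sq_add_cos_sq θ)
      refine mem_closure_of_tendsto hx ?_
      filter_upwards [hE] with ε hε
      exact ⟨⟨hε.1, by rw [h2, h3]; ring⟩, hε.2⟩
    · exact subset_closure ⟨hq, h0⟩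

theorem page_inter_page {θ θ' : ℝ} (h : ellipsoidPage a b c θ ≠ ellipsoidPage a b c θ') :
    ellipsoidPage a b c θ ∩ ellipsoidPage a b c θ' = bindingEllipse a b c := by
  -- This is the determinant of the two linear forms in `(z, w)`. If it vanishes the forms are
  -- proportional and the pages agree; otherwise Cramer's rule gives `z = w = 0`.
  have hne : Real.cos θ * Real.sin θ' - Real.sin θ * Real.cos θ' ≠ 0 := by
    intro h0
    refine h ?_
    have h1 := Real.sin_sq_add_cos_sq θ
    have h2 := Real.sin_sq_add_cos_sq θ'
    ext q
    refine and_congr_right fun _ => ⟨fun hq => ?_, fun hq => ?_⟩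
    · linear_combination (-(Real.cos θ' * q 2 + Real.sin θ' * q 3)) * h1 +
        (Real.cos θ * Real.cos θ' + Real.sin θ * Real.sin θ') * hq +
        (Real.cos θ * q 3 - Real.sin θ * q 2) * h0
    · linear_combination (-(Real.cos θ * q 2 + Real.sin θ * q 3)) * h2 +
        (Real.cos θ * Real.cos θ' + Real.sin θ * Real.sin θ') * hq -
        (Real.cos θ' * q 3 - Real.sin θ' * q 2) * h0
  refine Subset.antisymm ?_
    (subset_inter (bindingEllipse_subset_page θ) (bindingEllipse_subset_page θ'))
  rintro q ⟨⟨hq, h1⟩, -, h2⟩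
  refine ⟨hq, (mul_eq_zero.1 ?_).resolve_left hne, (mul_eq_zero.1 ?_).resolve_left hne⟩
  · linear_combination Real.sin θ' * h1 - Real.sin θ * h2
  · linear_combination Real.cos θ * h2 - Real.cos θ' * h1

theorem isOpenBook_bookProjection (hc : 0 < c) :
    IsOpenBook (ellipsoidACCB a b c) (bindingEllipse a b c) bookProjection where
  manifold := isSubmanifoldOfCodim_one_ellipsoid _
  binding_subset _ hq := hq.1
  binding_curve := isSubmanifoldOfCodim_three_bindingEllipse
  fibration := isSmoothFibrationOverCircle_bookProjection hc.ne'
  page_surface ζ hζ := by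
    obtain ⟨θ, rfl⟩ := exists_pageBase_eq (mem_sphere_zero_iff_norm.1 hζ)
    rw [pageOver_pageBase hc]
    exact ⟨bindingEllipse_subset_page θ, isSubmanifoldOfCodim_two_page θ⟩
  binding_eq := by
    refine Subset.antisymm (subset_iInter₂ fun ζ hζ => ?_) fun q hq => ?_
    · obtain ⟨θ, rfl⟩ := exists_pageBase_eq (mem_sphere_zero_iff_norm.1 hζ)
      rw [pageOver_pageBase hc]
      exact bindingEllipse_subset_page θ
    · have h : ∀ θ, q ∈ ellipsoidPage a b c θ := fun θ => by
        rw [← pageOver_pageBase hc]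
        exact mem_iInter₂.1 hq _ (mem_sphere_zero_iff_norm.2 (norm_pageBase θ))
      -- The two pages `w`-free and `z`-free, that is `z = 0` and `w = 0`, already meet in the
      -- binding alone.
      have h0 := (h 0).2
      have h1 := (h (Real.pi / 2)).2
      simp only [Real.cos_zero, Real.sin_zero, Real.cos_pi_div_two, Real.sin_pi_div_two] at h0 h1
      exact ⟨(h 0).1, by linarith, by linarith⟩

theorem image_pageOver (hc : 0 < c) :
    pageOver (ellipsoidACCB a b c) (bindingEllipse a b c) bookProjection '' Metric.sphere (0 : ℂ) 1 =
      range (ellipsoidPage a b c) := by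
  ext A
  constructor
  · rintro ⟨ζ, hζ, rfl⟩
    obtain ⟨θ, rfl⟩ := exists_pageBase_eq (mem_sphere_zero_iff_norm.1 hζ)
    exact ⟨θ, (pageOver_pageBase hc θ).symm⟩
  · rintro ⟨θ, rfl⟩
    exact ⟨pageBase θ, mem_sphere_zero_iff_norm.2 (norm_pageBase θ), pageOver_pageBase hc θ⟩

theorem iUnion_page : ⋃ θ : ℝ, ellipsoidPage a b c θ = ellipsoidACCB a b c :=
  Subset.antisymm (iUnion_subset fun θ => ellipsoidPage_subset θ) fun _ hq =>
    mem_iUnion.2 (exists_mem_ellipsoidPage hq)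

end

end PrincipalConfig

/-! ### The main theorem. -/

theorem theorem1 (a b c : ℝ) (hb : 0 < b) (hbc : b < c) (hca : c < a) :
    let E := PrincipalConfig.ellipsoidACCB a b c
    let N := PrincipalConfig.normalACCB a b c
    let E₀ := PrincipalConfig.bindingEllipse a b c
    let γ := PrincipalConfig.ellipsePoint a b
    let U := PrincipalConfig.umbilicSet E N
    let P := PrincipalConfig.partiallyUmbilicSet E N
    let L₁ := PrincipalConfig.principalSpace E N 0
    let L₂ := PrincipalConfig.principalSpace E N 1
    let L₃ := PrincipalConfig.principalSpace E N 2
    let R₁ := PrincipalConfig.regularSet E N 0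
    let R₂ := PrincipalConfig.regularSet E N 1
    let R₃ := PrincipalConfig.regularSet E N 2
    let page := PrincipalConfig.ellipsoidPage a b c
    -- (i) umbilic and partially umbilic points
    (U = {q | ∃ u : ℝ, Real.cos u ^ 2 = (a ^ 2 - c ^ 2) / (a ^ 2 - b ^ 2) ∧ q = γ u} ∧
      U ⊆ E₀ ∧ U.ncard = 4 ∧ P = E₀ \ U ∧
      ∃ u₀ ∈ Set.Ioo 0 (Real.pi / 2),
        Real.cos u₀ = Real.sqrt ((a ^ 2 - c ^ 2) / (a ^ 2 - b ^ 2)) ∧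
        U = {γ u₀, γ (Real.pi - u₀), γ (Real.pi + u₀), γ (-u₀)} ∧
        PrincipalConfig.partiallyUmbilicSet23 E N =
          γ '' Set.Ioo u₀ (Real.pi - u₀) ∪ γ '' Set.Ioo (Real.pi + u₀) (2 * Real.pi - u₀) ∧
        PrincipalConfig.partiallyUmbilicSet12 E N =
          γ '' Set.Ioo (-u₀) u₀ ∪ γ '' Set.Ioo (Real.pi - u₀) (Real.pi + u₀) ∧
        connectedComponentIn P '' P =
          {γ '' Set.Ioo (-u₀) u₀, γ '' Set.Ioo u₀ (Real.pi - u₀),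
            γ '' Set.Ioo (Real.pi - u₀) (Real.pi + u₀),
            γ '' Set.Ioo (Real.pi + u₀) (2 * Real.pi - u₀)} ∧
        (connectedComponentIn P '' P).ncard = 4) ∧
    -- (ii) the open book of two-dimensional ellipsoids
    ((∃ p : EuclideanSpace ℝ (Fin 4) → ℂ, PrincipalConfig.IsOpenBook E E₀ p ∧
        PrincipalConfig.pageOver E E₀ p '' Metric.sphere (0 : ℂ) 1 = Set.range page) ∧
      (⋃ θ : ℝ, page θ) = E ∧
      (∀ θ θ' : ℝ, page θ ≠ page θ' → page θ ∩ page θ' = E₀) ∧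
      (∀ θ : ℝ, ∃ ι : EuclideanSpace ℝ (Fin 3) →ₗᵢ[ℝ] EuclideanSpace ℝ (Fin 4),
        page θ = ι '' PrincipalConfig.ellipsoid ![a, c, b]) ∧
      -- the pages are integral leaves of the plane field spanned by `L₁` and `L₃`
      R₁ ∩ R₃ = E \ E₀ ∧
      (∀ θ : ℝ, ∀ q ∈ page θ \ E₀,
        PrincipalConfig.tangentSpaceAt (page θ) q = L₁ q ⊔ L₃ q ∧
        PrincipalConfig.leaf (fun x => L₁ x ⊔ L₃ x) (R₁ ∩ R₃) q =
          connectedComponentIn (page θ \ E₀) q) ∧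
      -- the principal configuration of `E` restricts to each page
      (∀ θ : ℝ, ∀ q ∈ page θ,
        (∀ v ∈ PrincipalConfig.tangentSpaceAt (page θ) q,
          -(fderiv ℝ N q v) ∈ PrincipalConfig.tangentSpaceAt (page θ) q) ∧
        (q ∈ R₁ → PrincipalConfig.principalSpace (page θ) N 0 q = L₁ q) ∧
        (q ∈ R₃ → PrincipalConfig.principalSpace (page θ) N 1 q = L₃ q)) ∧
      -- and the restriction is principally equivalent to the three-axis ellipsoid in `ℝ³`
      (∀ θ : ℝ, PrincipalConfig.PrincipallyEquivalent (page θ) N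
        (PrincipalConfig.ellipsoid ![a, c, b]) (PrincipalConfig.innerNormal ![a, c, b]))) ∧
    -- (iii) the second principal foliation
    (E \ R₂ = E₀ ∧
      -- at no point of `E₀` does the line field `L₂` extend continuously
      (∀ q₀ ∈ E₀, ¬ ∃ O ∈ nhds q₀, ∃ X : EuclideanSpace ℝ (Fin 4) → EuclideanSpace ℝ (Fin 4),
        ContinuousOn X (E ∩ O) ∧ (∀ q ∈ E ∩ O, X q ≠ 0) ∧ ∀ q ∈ R₂ ∩ O, X q ∈ L₂ q) ∧
      ∀ q ∈ R₂, PrincipalConfig.IsCircle (PrincipalConfig.principalLeaf E N 1 q) ∧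
        ∀ θ : ℝ, ∀ q' ∈ PrincipalConfig.principalLeaf E N 1 q ∩ page θ,
          L₂ q' ⟂ PrincipalConfig.tangentSpaceAt (page θ) q') := by
  intro E N E₀ γ U P L₁ L₂ L₃ R₁ R₂ R₃ page
  have hc : 0 < c := hb.trans hbc
  refine ⟨PrincipalConfig.umbilic_structure hb hbc hca,
    ⟨⟨PrincipalConfig.bookProjection, PrincipalConfig.isOpenBook_bookProjection hc,
      PrincipalConfig.image_pageOver hc⟩, PrincipalConfig.iUnion_page,
      fun θ θ' h => PrincipalConfig.page_inter_page h,
      fun θ => ⟨PrincipalConfig.pageEmbedding θ, PrincipalConfig.ellipsoidPage_eq_image θ⟩,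
      PrincipalConfig.regularSet_zero_inter_two_eq hb hbc hca,
      fun θ q hq => ⟨(PrincipalConfig.principalSpaces_of_mem_page_diff hb hbc hca hq).2.2.2.2.2.2,
        PrincipalConfig.leaf_sup_eq hb hbc hca hq⟩,
      fun θ q hq => PrincipalConfig.principalSpace_page hb hbc hca hq,
      fun θ => PrincipalConfig.principallyEquivalent_page hb hbc hca θ⟩,
    ?_, fun q₀ hq₀ => PrincipalConfig.not_exists_continuous_extension hb hbc hca hq₀,
    fun q hq => ⟨PrincipalConfig.isCircle_principalLeaf_one hb hbc hca hq,
      fun θ q' hq' => PrincipalConfig.principalSpace_one_isOrtho_page hb hbc hca hq'.1 hq'.2⟩⟩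
  simp only [E, R₂, E₀, N, PrincipalConfig.regularSet_one_eq hb hbc hca]
  rw [Set.sdiff_sdiff_cancel_left fun q hq => hq.1]
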